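/- Let $b>1$, let $c_+,c_-\in\mathbb R\setminus\{0\}$, and put $\gamma_b(t)=c_+t^b$ for $t>0$, $\gamma_b(t)=c_-(-t)^b$ for $t<0$, $\gamma_b(0)=0$. For $u>0$ and a Schwartz function $f:\mathbb R^2\to\mathbb C$ let $$H^{(u)}f(x)=\mathrm{p.v.}\int_{\mathbb R}f(x_1-t,\,x_2-u\gamma_b(t))\,\frac{dt}{t}=\lim_{\varepsilon\to0+}\int_{|t|>\varepsilon}f(x_1-t,\,x_2-u\gamma_b(t))\,\frac{dt}{t};$$ the truncated integrals converge absolutely and the limit exists for every $x\in\mathbb R^2$. For a set $V\subset(0,\infty)$ let $$\mathfrak N(V)=1+\#\{n\in\mathbb Z:[2^n,2^{n+1}]\cap V\ne\emptyset\}.$$ There is a constant $c>0$, depending only on $b$ and $|c_+/c_-|$, and uniform as long as $b$ stays in a compact subset of $(1,\infty)$ and $|c_+/c_-|$ stays in a compact subset of $(0,\infty)$, such that the following holds. Let $C_\circ\ge1$, let $\tilde U\subset(0,\infty)$ be a finite set having at most one point in each interval $[2^n,2^{n+1}]$, $n\in\mathbb Z$, and put $K=(C_\circ\,\mathfrak N(\tilde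 U))^{2b}$. Let $M\ge1$ and let $u_1<\dots<u_M$ be elements of $\tilde U$ such that $$\frac{u_{j+1}}{u_j}\ge16K^2\qquad(1\le j<M).$$ Then $$\sup_{f\in\mathcal S(\mathbb R^2),\ \|f\|_2=1}\Big\|\sup_{1\le j\le M}|H^{(u_j)}f|\Big\|_{L^2(\mathbb R^2)}\ \ge\ c\sqrt{\log M}.$$ -/

import Mathlib

open Real Set Filter Topology MeasureTheory
open scoped SchwartzMap ENNReal

noncomputable section

/-- The plane `ℝ²` with its Euclidean norm and Lebesgue measure. -/
abbrev Plane : Type := EuclideanSpace ℝ (Fin 2)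

/-- The function `γ_b`, homogeneous of degree `b`: it equals `c₊ t ^ b` for `t > 0` and
`c₋ (-t) ^ b` for `t < 0` (and `0` at `t = 0`, since `b ≠ 0`). -/
def homGamma (b cp cm t : ℝ) : ℝ :=
  if 0 < t then cp * t ^ b else cm * (-t) ^ b

/-- The integrand `f (x₁ - t, x₂ - u γ_b(t)) / t` of the Hilbert transform along the curve
`t ↦ (t, u γ_b(t))`. -/
def hilbertIntegrand (b cp cm u : ℝ) (f : 𝓢(Plane, ℂ)) (x : Plane) (t : ℝ) : ℂ :=
  f !₂[x 0 - t, x 1 - u * homGamma b cp cm t] / (t : ℂ)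

/-- The truncated integral over `|t| > ε`. -/
def truncatedHilbert (b cp cm u : ℝ) (f : 𝓢(Plane, ℂ)) (x : Plane) (ε : ℝ) : ℂ :=
  ∫ t in {t : ℝ | ε < |t|}, hilbertIntegrand b cp cm u f x t

/-- The Hilbert transform `H^{(u)} f (x)` of a Schwartz function `f` along the curve
`t ↦ (t, u γ_b(t))`: the principal value, i.e. the limit of the truncated integrals
as `ε → 0+`. -/
def curveHilbert (b cp cm u : ℝ) (f : 𝓢(Plane, ℂ)) (x : Plane) : ℂ :=
  limUnder (𝓝[>] (0 : ℝ)) (truncatedHilbert b cp cm u f x)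

/-- `𝔑(V) = 1 + #{n ∈ ℤ : [2 ^ n, 2 ^ (n + 1)] ∩ V ≠ ∅}` (used for finite `V ⊆ (0, ∞)`, for which
the set of such `n` is finite). -/
def dyadicCount (V : Set ℝ) : ℕ :=
  1 + {n : ℤ | (Icc ((2 : ℝ) ^ n) ((2 : ℝ) ^ (n + 1)) ∩ V).Nonempty}.ncard

/-- The separation parameter `K = (C₀ 𝔑(V)) ^ (2 b)`. -/
def sepParam (b C₀ : ℝ) (V : Set ℝ) : ℝ :=
  (C₀ * (dyadicCount V : ℝ)) ^ (2 * b)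

/-- The `L²` norm of the maximal function `x ↦ sup_{1 ≤ j ≤ M} |H^{(u_j)} f (x)|`. -/
def maximalL2Norm (b cp cm : ℝ) (M : ℕ) (u : ℕ → ℝ) (f : 𝓢(Plane, ℂ)) : ℝ≥0∞ :=
  eLpNorm (fun x : Plane => ⨆ j ∈ Icc 1 M, ‖curveHilbert b cp cm (u j) f x‖ₑ) 2 volume

end

/-! On a wave with frequency (ξ₁, ξ₂), ξ₁, ξ₂ > 0, the operator H^{(u)} is multiplication by p.v. ∫
e^{-i(ξ₁t + uξ₂γ_b(t))} dt/t. Where uξ₂ is small against ξ₁^b this is close to A = -2iD, with D =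
∫_0^∞ sin t / t dt; where uξ₂ is large it is close to B = (log|c₋/c₊| - iD(sgn c₊ - sgn c₋))/b
(`exists_threshold_oscKernel`). Since |Im B| ≤ 2D/b < 2D, the two values stay apart. A bump
modulated at frequency (R, R^b s) feels the same dichotomy pointwise once R is large, and the regime
depends only on the product su (`exists_threshold_curveHilbert`). Given widely separated parameters
v_j, choose s_k so that the k-th modulation has value A for the v_j with j ≤ k and value B for those
with j > k (`exists_isOrderedMultiplier`). For f = Σ f_k, with f_k modulated at index k, the j-th
operator then gives about Bf + (A - B) Σ_{k ≥ j} f_k, so the maximal function controls maximal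
partial sums. These are made large by a binary tree of depth n using 2^n operators
(`IsOrderedMultiplier.exists_isTreeFunction`). A node carries a weight times a modulation; its left
child lives where the cosine of the phase is positive, its right child where it is negative.
Operators of the left half keep the node in the partial sum, where its real part is nonnegative;
those of the right half drop it. So at each point some operator collects only nonnegative real parts
along the branch of that point, and the integral of this sum is of order n. The frequencies are
taken so high that nodes are almost orthogonal, so ‖f‖₂² is of order n as well. By Cauchy–Schwarz on
a ball the ratio of norms is at least of order √n; the term Bf is of size √n only and is absorbed.
With parameters growing by factors of at least 16, a fixed stride makes them as separated as needed,
which leaves n comparable to log M. Bounded M is covered by one operator and one bump. -/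

noncomputable section

/-! ### Oscillatory integrals with phase αt + βt^b against dt/t. -/

/-- First-derivative van der Corput estimate for `∫ e^{iP(t)} dt / t` with `P'` monotone. -/
theorem norm_integral_exp_div_le {P P' P'' : ℝ → ℝ} {a N l : ℝ} (ha : 0 < a) (haN : a ≤ N)
    (hl : 0 < l) (hP : ∀ t ∈ Icc a N, HasDerivAt P (P' t) t)
    (hP' : ∀ t ∈ Icc a N, HasDerivAt P' (P'' t) t) (hc : ContinuousOn P'' (Icc a N))
    (hs : (∀ t ∈ Icc a N, 0 ≤ P'' t) ∨ (∀ t ∈ Icc a N, P'' t ≤ 0))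
    (hlow : ∀ t ∈ Icc a N, l ≤ |P' t|) :
    ‖∫ t in a..N, Complex.exp ((P t : ℂ) * Complex.I) / t‖ ≤ 5 / (a * l) := by
  have hIcc : uIcc a N = Icc a N := uIcc_of_le haN
  have hpos : ∀ t ∈ Icc a N, 0 < t := fun t ht => ha.trans_le ht.1
  have hne : ∀ t ∈ Icc a N, P' t ≠ 0 := fun t ht h => by
    have := hlow t ht; rw [h, abs_zero] at this; linarith
  have hcP' : ContinuousOn P' (Icc a N) := fun t ht => (hP' t ht).continuousAt.continuousWithinAt
  have hcP : ContinuousOn P (Icc a N) := fun t ht => (hP t ht).continuousAt.continuousWithinAt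
  -- the amplitude
  set v : ℝ → ℝ := fun t => (P' t)⁻¹ * t⁻¹ with hv
  set v' : ℝ → ℝ := fun t => -P'' t / (P' t) ^ 2 * t⁻¹ + (P' t)⁻¹ * (-(t ^ 2)⁻¹) with hv'
  have hdv : ∀ t ∈ Icc a N, HasDerivAt v (v' t) t := fun t ht =>
    ((hP' t ht).inv (hne t ht)).mul (hasDerivAt_inv (hpos t ht).ne')
  have hcv' : ContinuousOn v' (Icc a N) := by
    refine ContinuousOn.add (ContinuousOn.mul (hc.neg.div (hcP'.pow 2) fun t ht =>
      pow_ne_zero _ (hne t ht)) (continuousOn_id.inv₀ fun t ht => (hpos t ht).ne'))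
      (ContinuousOn.mul (hcP'.inv₀ hne) (ContinuousOn.neg ((continuousOn_id.pow 2).inv₀ fun t ht =>
      pow_ne_zero _ (hpos t ht).ne')))
  set e : ℝ → ℂ := fun t => Complex.exp ((P t : ℂ) * Complex.I) with he
  have hde : ∀ t ∈ Icc a N, HasDerivAt e (e t * ((P' t : ℂ) * Complex.I)) t := fun t ht =>
    (((hP t ht).ofReal_comp).mul_const Complex.I).cexp
  have hce : ContinuousOn e (Icc a N) := fun t ht => (hde t ht).continuousAt.continuousWithinAt
  have hen : ∀ t, ‖e t‖ = 1 := fun t => Complex.norm_exp_ofReal_mul_I _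
  have hibp := intervalIntegral.integral_mul_deriv_eq_deriv_mul (a := a) (b := N)
    (u := fun t => (v t : ℂ)) (v := e) (u' := fun t => (v' t : ℂ))
    (v' := fun t => e t * ((P' t : ℂ) * Complex.I))
    (fun t ht => (hdv t (hIcc ▸ ht)).ofReal_comp) (fun t ht => hde t (hIcc ▸ ht))
    (ContinuousOn.intervalIntegrable (hIcc ▸ Complex.continuous_ofReal.comp_continuousOn hcv'))
    (ContinuousOn.intervalIntegrable (hIcc ▸ hce.mul
      ((Complex.continuous_ofReal.comp_continuousOn hcP').mul continuousOn_const)))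
  have hmain : ∫ t in a..N, Complex.exp ((P t : ℂ) * Complex.I) / t
      = -Complex.I * (∫ t in a..N, (v t : ℂ) * (e t * ((P' t : ℂ) * Complex.I))) := by
    rw [← intervalIntegral.integral_const_mul]
    refine intervalIntegral.integral_congr fun t ht => ?_
    have h1 : (P' t : ℂ) ≠ 0 := by exact_mod_cast hne t (hIcc ▸ ht)
    have h2 : (t : ℂ) ≠ 0 := by exact_mod_cast (hpos t (hIcc ▸ ht)).ne'
    simp only [hv, he, Complex.ofReal_mul, Complex.ofReal_inv]
    field_simp
    ring_nf
    simp
  have hvb : ∀ t ∈ Icc a N, |v t| ≤ 1 / (a * l) := fun t ht => by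
    simp only [hv, abs_mul, abs_inv, abs_of_pos (hpos t ht)]
    rw [← mul_inv, one_div]
    exact inv_anti₀ (by positivity) (by
      rw [mul_comm]; exact mul_le_mul (hlow t ht) ht.1 ha.le (abs_nonneg _))
  -- total variation of the amplitude
  have hint1 : IntervalIntegrable (fun t => P'' t / (P' t) ^ 2) volume a N :=
    ContinuousOn.intervalIntegrable (hIcc ▸ hc.div (hcP'.pow 2) fun t ht =>
      pow_ne_zero _ (hne t ht))
  have hI1 : ∫ t in a..N, P'' t / (P' t) ^ 2 = (P' a)⁻¹ - (P' N)⁻¹ := by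
    have := intervalIntegral.integral_eq_sub_of_hasDerivAt (a := a) (b := N)
      (f := fun t => -(P' t)⁻¹) (f' := fun t => P'' t / (P' t) ^ 2)
      (fun t ht => by
        have := ((hP' t (hIcc ▸ ht)).inv (hne t (hIcc ▸ ht))).neg
        exact this.congr_deriv (by ring)) hint1
    rw [this]; ring
  have hinvb : ∀ t ∈ Icc a N, |(P' t)⁻¹| ≤ 1 / l := fun t ht => by
    rw [abs_inv, one_div]; exact inv_anti₀ hl (hlow t ht)
  have hI1' : |∫ t in a..N, P'' t / (P' t) ^ 2| ≤ 2 / l := by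
    rw [hI1]
    have h1 := hinvb a ⟨le_rfl, haN⟩
    have h2 := hinvb N ⟨haN, le_rfl⟩
    calc _ ≤ |(P' a)⁻¹| + |(P' N)⁻¹| := abs_sub _ _
      _ ≤ 1 / l + 1 / l := add_le_add h1 h2
      _ = 2 / l := by ring
  have hint1a : IntervalIntegrable (fun t => |P'' t| / (P' t) ^ 2) volume a N :=
    ContinuousOn.intervalIntegrable (hIcc ▸ hc.abs.div (hcP'.pow 2) fun t ht =>
      pow_ne_zero _ (hne t ht))
  -- A constant sign of P'' lets the absolute value leave the integral, which telescopes to the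
  -- boundary values of 1/P'. With the two endpoint terms and the variation of 1/t, the constant is
  -- 1 + 1 + (2 + 1) = 5.
  have hI1a : ∫ t in a..N, |P'' t| / (P' t) ^ 2 ≤ 2 / l := by
    rcases hs with hs | hs
    · rw [intervalIntegral.integral_congr (g := fun t => P'' t / (P' t) ^ 2)]
      · exact (le_abs_self _).trans hI1'
      · intro t ht; simp only; rw [abs_of_nonneg (hs t (hIcc ▸ ht))]
    · rw [intervalIntegral.integral_congr (g := fun t => -(P'' t / (P' t) ^ 2))]
      · rw [intervalIntegral.integral_neg]; exact (neg_le_abs _).trans hI1'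
      · intro t ht; simp only; rw [abs_of_nonpos (hs t (hIcc ▸ ht))]; ring
  have hint2 : IntervalIntegrable (fun t : ℝ => (t ^ 2)⁻¹) volume a N :=
    ContinuousOn.intervalIntegrable (hIcc ▸ (continuousOn_id.pow 2).inv₀ fun t ht =>
      pow_ne_zero _ (hpos t ht).ne')
  have hI2 : ∫ t in a..N, (t ^ 2)⁻¹ ≤ 1 / a := by
    have := intervalIntegral.integral_eq_sub_of_hasDerivAt (a := a) (b := N)
      (f := fun t => -t⁻¹) (f' := fun t => (t ^ 2)⁻¹)
      (fun t ht => by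
        have := (hasDerivAt_inv (hpos t (hIcc ▸ ht)).ne').neg
        exact this.congr_deriv (by ring)) hint2
    rw [this]
    have : 0 < N⁻¹ := inv_pos.2 (ha.trans_le haN)
    rw [one_div]; linarith
  have hvar : ‖∫ t in a..N, (v' t : ℂ) * e t‖ ≤ 3 / (a * l) := by
    calc _ ≤ ∫ t in a..N, (a⁻¹ * (|P'' t| / (P' t) ^ 2) + l⁻¹ * (t ^ 2)⁻¹) := by
          refine intervalIntegral.norm_integral_le_of_norm_le haN (Eventually.of_forall ?_)
            ((hint1a.const_mul _).add (hint2.const_mul _))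
          intro t ht
          have ht' : t ∈ Icc a N := ⟨ht.1.le, ht.2⟩
          rw [norm_mul, hen, mul_one, Complex.norm_real, Real.norm_eq_abs]
          refine (abs_add_le _ _).trans (add_le_add ?_ ?_)
          · rw [abs_mul, abs_div, abs_neg, abs_of_pos (inv_pos.2 (hpos t ht')),
              abs_of_nonneg (sq_nonneg (P' t)), mul_comm]
            exact mul_le_mul_of_nonneg_right (inv_anti₀ ha ht'.1) (by positivity)
          · rw [abs_mul, abs_neg, abs_of_nonneg (a := (t ^ 2)⁻¹) (by positivity)]
            refine mul_le_mul_of_nonneg_right ?_ (by positivity)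
            rw [← one_div l]; exact hinvb t ht'
      _ = a⁻¹ * (∫ t in a..N, |P'' t| / (P' t) ^ 2) + l⁻¹ * ∫ t in a..N, (t ^ 2)⁻¹ := by
          rw [intervalIntegral.integral_add (hint1a.const_mul _) (hint2.const_mul _),
            intervalIntegral.integral_const_mul, intervalIntegral.integral_const_mul]
      _ ≤ a⁻¹ * (2 / l) + l⁻¹ * (1 / a) := by gcongr
      _ = 3 / (a * l) := by field_simp; ring
  rw [hmain, hibp, norm_mul, norm_neg, Complex.norm_I, one_mul]
  have hb : ∀ t ∈ Icc a N, ‖(v t : ℂ) * e t‖ ≤ 1 / (a * l) := fun t ht => by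
    rw [norm_mul, hen, mul_one, Complex.norm_real]; exact hvb t ht
  calc _ ≤ ‖(v N : ℂ) * e N‖ + ‖(v a : ℂ) * e a‖ + ‖∫ t in a..N, (v' t : ℂ) * e t‖ :=
        (norm_sub_le _ _).trans (add_le_add_left (norm_sub_le _ _) _)
    _ ≤ 1 / (a * l) + 1 / (a * l) + 3 / (a * l) :=
        add_le_add (add_le_add (hb N ⟨haN, le_rfl⟩) (hb a ⟨le_rfl, haN⟩)) hvar
    _ = 5 / (a * l) := by ring

/-- The truncated oscillatory integral `∫_a^N e^{i(αt + βt^b)} dt / t`. -/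
def oscInt (b α β a N : ℝ) : ℂ :=
  ∫ t in a..N, Complex.exp (((α * t + β * t ^ b : ℝ) : ℂ) * Complex.I) / t

theorem continuousOn_oscInt (b α β : ℝ) : ContinuousOn
    (fun t : ℝ => Complex.exp (((α * t + β * t ^ b : ℝ) : ℂ) * Complex.I) / t) (Ioi 0) := by
  have h : ContinuousOn (fun t : ℝ => α * t + β * t ^ b) (Ioi 0) :=
    (continuousOn_const.mul continuousOn_id).add (continuousOn_const.mul
      (continuousOn_id.rpow_const fun t ht => Or.inl (ne_of_gt ht)))
  exact ((Complex.continuous_exp.comp_continuousOn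
    ((Complex.continuous_ofReal.comp_continuousOn h).mul continuousOn_const)).div
    Complex.continuous_ofReal.continuousOn fun t ht => by exact_mod_cast (ne_of_gt ht))

theorem uIcc_subset_Ioi {a N : ℝ} (ha : 0 < a) (hN : 0 < N) : uIcc a N ⊆ Ioi 0 := fun _ ht =>
  (lt_min ha hN).trans_le ht.1

theorem intervalIntegrable_oscInt (b α β : ℝ) {a N : ℝ} (ha : 0 < a) (hN : 0 < N) :
    IntervalIntegrable
      (fun t : ℝ => Complex.exp (((α * t + β * t ^ b : ℝ) : ℂ) * Complex.I) / t) volume a N :=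
  ((continuousOn_oscInt b α β).mono (uIcc_subset_Ioi ha hN)).intervalIntegrable

theorem oscInt_add (b α β : ℝ) {a c N : ℝ} (ha : 0 < a) (hc : 0 < c) (hN : 0 < N) :
    oscInt b α β a c + oscInt b α β c N = oscInt b α β a N :=
  intervalIntegral.integral_add_adjacent_intervals (intervalIntegrable_oscInt b α β ha hc)
    (intervalIntegrable_oscInt b α β hc hN)

/-- The second derivative βb(b-1)t^{b-2} has the sign of β, so a lower bound for |P'| is all that
van der Corput needs. -/
theorem norm_oscInt_le_of_deriv {b α β a N l : ℝ} (hb : 1 < b) (ha : 0 < a) (haN : a ≤ N)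
    (hl : 0 < l) (h : ∀ t ∈ Icc a N, l ≤ |α + β * (b * t ^ (b - 1))|) :
    ‖oscInt b α β a N‖ ≤ 5 / (a * l) := by
  have hpos : ∀ t ∈ Icc a N, 0 < t := fun t ht => ha.trans_le ht.1
  refine norm_integral_exp_div_le (P := fun t => α * t + β * t ^ b)
    (P' := fun t => α + β * (b * t ^ (b - 1)))
    (P'' := fun t => β * (b * ((b - 1) * t ^ (b - 1 - 1)))) ha haN hl ?_ ?_ ?_ ?_ h
  · intro t ht
    have h1 := (hasDerivAt_id t).const_mul α
    have h2 := (Real.hasDerivAt_rpow_const (p := b) (Or.inl (hpos t ht).ne')).const_mul β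
    exact (h1.add h2).congr_deriv (by ring)
  · intro t ht
    exact (((Real.hasDerivAt_rpow_const (p := b - 1)
      (Or.inl (hpos t ht).ne')).const_mul b).const_mul β).const_add α
  · exact continuousOn_const.mul (continuousOn_const.mul (continuousOn_const.mul
      (continuousOn_id.rpow_const fun t ht => Or.inl (hpos t ht).ne')))
  · rcases le_total 0 β with hβ | hβ
    · left; intro t ht
      have := rpow_nonneg (hpos t ht).le (b - 1 - 1)
      have : 0 ≤ b - 1 := by linarith
      positivity
    · right; intro t ht
      have := rpow_nonneg (hpos t ht).le (b - 1 - 1)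
      have h2 : 0 ≤ b - 1 := by linarith
      exact mul_nonpos_of_nonpos_of_nonneg hβ (by positivity)

/-- Scaling of the oscillatory integral. -/
theorem oscInt_scale (b α β : ℝ) {a N s : ℝ} (ha : 0 < a) (hN : 0 < N) (hs : 0 < s) :
    oscInt b α β (s * a) (s * N) = oscInt b (α * s) (β * s ^ b) a N := by
  unfold oscInt
  have := intervalIntegral.smul_integral_comp_mul_left (a := a) (b := N)
    (fun t : ℝ => Complex.exp (((α * t + β * t ^ b : ℝ) : ℂ) * Complex.I) / t) s
  rw [← this, ← intervalIntegral.integral_smul]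
  refine intervalIntegral.integral_congr fun t ht => ?_
  have ht0 : 0 < t := uIcc_subset_Ioi ha hN ht
  have h1 : (s : ℂ) ≠ 0 := by exact_mod_cast hs.ne'
  have h2 : (t : ℂ) ≠ 0 := by exact_mod_cast ht0.ne'
  simp only [Real.mul_rpow hs.le ht0.le, Complex.real_smul, Complex.ofReal_mul]
  rw [show α * (s * t) + β * (s ^ b * t ^ b) = α * s * t + β * s ^ b * t ^ b by ring]
  field_simp

/-- Combine bounds for an additive interval function below and above a threshold. -/
theorem norm_le_add_of_split {F : ℝ → ℝ → ℂ} {T c X Y : ℝ} (hX : 0 ≤ X) (hY : 0 ≤ Y)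
    (hF : ∀ a c N : ℝ, 0 < a → 0 < c → 0 < N → F a c + F c N = F a N)
    (h1 : ∀ a N : ℝ, 0 < a → T ≤ a → a ≤ N → N ≤ c → ‖F a N‖ ≤ X)
    (h2 : ∀ a N : ℝ, 0 < a → T ≤ a → c ≤ a → a ≤ N → ‖F a N‖ ≤ Y)
    {a N : ℝ} (ha : 0 < a) (hTa : T ≤ a) (haN : a ≤ N) : ‖F a N‖ ≤ X + Y := by
  rcases le_total c a with hc | hc
  · exact (h2 a N ha hTa hc haN).trans (by linarith)
  rcases le_total N c with hN | hN
  · exact (h1 a N ha hTa haN hN).trans (by linarith)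
  rw [← hF a c N ha (ha.trans_le hc) (ha.trans_le haN)]
  exact (norm_add_le _ _).trans (add_le_add (h1 a c ha hTa hc le_rfl)
    (h2 c N (ha.trans_le hc) (hTa.trans hc) le_rfl hN))

theorem norm_exp_sub_one_le (x : ℝ) : ‖Complex.exp ((x : ℂ) * Complex.I) - 1‖ ≤ |x| := by
  rw [mul_comm]; simpa using Real.norm_exp_I_mul_ofReal_sub_one_le (x := x)

/-- Comparison of two phases on an initial interval. -/
theorem norm_oscInt_sub_le {b α β α' β' a N C : ℝ} (ha : 0 < a) (haN : a ≤ N)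
    (h : ∀ t ∈ Icc a N, |(α - α') * t + (β - β') * t ^ b| ≤ C * t) :
    ‖oscInt b α β a N - oscInt b α' β' a N‖ ≤ C * (N - a) := by
  have hN := ha.trans_le haN
  unfold oscInt
  rw [← intervalIntegral.integral_sub (intervalIntegrable_oscInt b α β ha hN)
    (intervalIntegrable_oscInt b α' β' ha hN)]
  refine (intervalIntegral.norm_integral_le_of_norm_le_const (C := C) fun t ht => ?_).trans_eq
    (by rw [abs_of_nonneg (sub_nonneg.2 haN)])
  rw [uIoc_of_le haN] at ht
  have ht0 : 0 < t := ha.trans ht.1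
  rw [← sub_div, norm_div, Complex.norm_real, Real.norm_of_nonneg ht0.le, div_le_iff₀ ht0]
  refine le_trans ?_ (h t ⟨ht.1.le, ht.2⟩)
  have : Complex.exp (((α * t + β * t ^ b : ℝ) : ℂ) * Complex.I)
      - Complex.exp (((α' * t + β' * t ^ b : ℝ) : ℂ) * Complex.I)
      = Complex.exp (((α' * t + β' * t ^ b : ℝ) : ℂ) * Complex.I)
        * (Complex.exp ((((α - α') * t + (β - β') * t ^ b : ℝ) : ℂ) * Complex.I) - 1) := by
    rw [mul_sub, ← Complex.exp_add, mul_one]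
    congr 2
    push_cast; ring
  rw [this, norm_mul, Complex.norm_exp_ofReal_mul_I, one_mul]
  exact norm_exp_sub_one_le _

/-- If `|β| = 1` and `α` is small, the linear term is negligible. -/
theorem exists_norm_oscInt_sub_le_of_small_linear {ε : ℝ} (hε : 0 < ε) :
    ∃ η > 0, ∀ b α β a N : ℝ, 1 < b → |β| = 1 → |α| ≤ η → 0 < a → a ≤ N →
      ‖oscInt b α β a N - oscInt b 0 β a N‖ ≤ ε := by
  -- Below T the integrands differ by at most |α|, because of the division by t. Above T ≥ 1 the
  -- derivative of βt^b is at least 1 and that of the full phase at least 1/2, so the two tails cost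
  -- 5/(T/2) + 5/T = 15/T.
  set T : ℝ := max 1 (30 / ε) with hT
  have hT1 : 1 ≤ T := le_max_left _ _
  have hT2 : 30 / ε ≤ T := le_max_right _ _
  have hT0 : 0 < T := by linarith
  have hTε : 15 / T ≤ ε / 2 := by
    rw [div_le_iff₀ hε] at hT2; rw [div_le_iff₀ hT0]; linarith
  refine ⟨min (1 / 2) (ε / (2 * T)), by positivity, ?_⟩
  intro b α β a N hb hβ hα ha haN
  have hα1 := hα.trans (min_le_left _ _)
  have hα2 := hα.trans (min_le_right _ _)
  have key := norm_le_add_of_split (F := fun a N => oscInt b α β a N - oscInt b 0 β a N)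
    (T := 0) (c := T) (X := ε / 2) (Y := ε / 2) (by positivity) (by positivity)
    (fun a c N ha hc hN => by
      rw [← oscInt_add b α β ha hc hN, ← oscInt_add b 0 β ha hc hN]; ring)
    ?_ ?_ ha ha.le haN
  · simpa using key
  · intro a N ha _ haN hN
    refine (norm_oscInt_sub_le (C := ε / (2 * T)) ha haN fun t ht => ?_).trans ?_
    · have ht0 : 0 < t := ha.trans_le ht.1
      simp only [sub_zero, sub_self, zero_mul, add_zero]
      rw [abs_mul, abs_of_pos ht0]
      gcongr
    · calc ε / (2 * T) * (N - a) ≤ ε / (2 * T) * T := by gcongr; linarith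
        _ = ε / 2 := by field_simp
  · intro a N ha _ hTa haN
    have hder : ∀ t ∈ Icc a N, 1 ≤ |β * (b * t ^ (b - 1))| := fun t ht => by
      have ht1 : 1 ≤ t := by linarith [ht.1]
      have : 1 ≤ t ^ (b - 1) := Real.one_le_rpow ht1 (by linarith)
      rw [abs_mul, hβ, one_mul, abs_of_nonneg (by positivity)]
      nlinarith
    have e1 : ‖oscInt b α β a N‖ ≤ 5 / (a * (1 / 2)) := by
      refine norm_oscInt_le_of_deriv hb ha haN (by norm_num) fun t ht => ?_
      have := hder t ht
      have h3 := abs_sub_abs_le_abs_sub (β * (b * t ^ (b - 1))) (-α)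
      rw [abs_neg, sub_neg_eq_add, add_comm _ α] at h3
      linarith
    have e2 : ‖oscInt b 0 β a N‖ ≤ 5 / (a * 1) := by
      refine norm_oscInt_le_of_deriv hb ha haN (by norm_num) fun t ht => ?_
      rw [zero_add]; exact hder t ht
    calc _ ≤ 5 / (a * (1 / 2)) + 5 / (a * 1) := (norm_sub_le _ _).trans (add_le_add e1 e2)
      _ = 15 / a := by field_simp; norm_num
      _ ≤ 15 / T := by gcongr
      _ ≤ _ := hTε

/-- The trivial bound, used on a short window around a stationary point. -/
theorem norm_oscInt_le_of_length {b α β a N : ℝ} (ha : 0 < a) (haN : a ≤ N) :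
    ‖oscInt b α β a N‖ ≤ (N - a) / a := by
  refine (intervalIntegral.norm_integral_le_of_norm_le_const (C := 1 / a) fun t ht => ?_).trans_eq
    (by rw [abs_of_nonneg (sub_nonneg.2 haN)]; ring)
  rw [uIoc_of_le haN] at ht
  rw [norm_div, Complex.norm_exp_ofReal_mul_I, Complex.norm_real,
    Real.norm_of_nonneg (ha.trans ht.1).le]
  exact one_div_le_one_div_of_le ha ht.1.le

/-- Uniform decay of the oscillatory integral near infinity, stationary points included. -/
theorem exists_norm_oscInt_tail_le {b₀ : ℝ} (hb₀ : 1 < b₀) {ε : ℝ} (hε : 0 < ε) :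
    ∃ T ≥ 1, ∀ b α β a N : ℝ, b₀ ≤ b → |α| = 1 → T ≤ a → a ≤ N → ‖oscInt b α β a N‖ ≤ ε := by
  -- The window from (1 - h)t₀ to t₀/(1 - h) around the stationary point t₀ has relative length O(h)
  -- and is estimated trivially. Outside it |P'| ≥ l; defining l with b₀ in place of b makes it
  -- uniform in b.
  set h : ℝ := min (1 / 2) (ε / 24) with hh
  have hh0 : 0 < h := by positivity
  have hh2 : h ≤ 1 / 2 := min_le_left _ _
  have hhε : h ≤ ε / 24 := min_le_right _ _
  set l : ℝ := 1 - (1 - h) ^ (b₀ - 1) with hl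
  have hl0 : 0 < l := by
    have : (1 - h) ^ (b₀ - 1) < 1 := Real.rpow_lt_one (by linarith) (by linarith) (by linarith)
    linarith
  have hl1 : l ≤ 1 := by
    have : 0 ≤ (1 - h) ^ (b₀ - 1) := Real.rpow_nonneg (by linarith) _
    linarith
  set T : ℝ := max 1 (15 / (ε * l)) with hT
  have hT1 : 1 ≤ T := le_max_left _ _
  have hT2 : 15 / (ε * l) ≤ T := le_max_right _ _
  have hTl : 5 / (T * l) ≤ ε / 3 := by
    rw [div_le_iff₀ (by positivity)] at hT2 ⊢; linarith
  have hdec : ∀ a : ℝ, T ≤ a → 5 / (a * l) ≤ ε / 3 := fun a ha =>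
    le_trans (by gcongr) hTl
  refine ⟨T, hT1, fun b α β a N hb hα hTa haN => ?_⟩
  have hb1 : 1 < b := hb₀.trans_le hb
  have ha : 0 < a := by linarith
  rcases le_or_gt 0 (α * β) with hs | hs
  · -- no stationary point
    refine (norm_oscInt_le_of_deriv hb1 ha haN hl0 fun t ht => ?_).trans
      ((hdec a hTa).trans (by linarith))
    have ht0 : 0 < t := ha.trans_le ht.1
    refine hl1.trans ?_
    have hx : 0 ≤ b * t ^ (b - 1) := by positivity
    have : |α| * |α + β * (b * t ^ (b - 1))| = |1 + α * β * (b * t ^ (b - 1))| := by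
      rw [← abs_mul]
      have : α * α = 1 := by rw [← abs_mul_abs_self, hα]; norm_num
      congr 1; linear_combination this
    rw [hα, one_mul] at this
    rw [this, abs_of_nonneg (by positivity)]
    have : 0 ≤ α * β * (b * t ^ (b - 1)) := by positivity
    linarith
  -- the stationary point `t₀`
  set t₀ : ℝ := (b * |β|) ^ (-(1 / (b - 1))) with ht₀
  have hβ : 0 < |β| := abs_pos.2 fun h => by simp [h] at hs
  have hbβ : 0 < b * |β| := by positivity
  have ht₀0 : 0 < t₀ := Real.rpow_pos_of_pos hbβ _
  have hb1' : 0 < b - 1 := by linarith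
  have ht₀p : b * |β| * t₀ ^ (b - 1) = 1 := by
    rw [ht₀, ← Real.rpow_mul hbβ.le,
      show -(1 / (b - 1)) * (b - 1) = -1 by field_simp, Real.rpow_neg_one,
      mul_inv_cancel₀ hbβ.ne']
  have hder : ∀ t : ℝ, 0 < t → |α + β * (b * t ^ (b - 1))| = |1 - (t / t₀) ^ (b - 1)| := by
    intro t ht
    have h1 : |α| * |α + β * (b * t ^ (b - 1))| = |1 + α * β * (b * t ^ (b - 1))| := by
      rw [← abs_mul]
      have : α * α = 1 := by rw [← abs_mul_abs_self, hα]; norm_num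
      congr 1; linear_combination this
    rw [hα, one_mul] at h1
    have h2 : α * β = -|β| := by
      have := abs_of_neg hs
      rw [abs_mul, hα, one_mul] at this; linarith
    have h3 : (t / t₀) ^ (b - 1) = b * |β| * t ^ (b - 1) := by
      rw [Real.div_rpow ht.le ht₀0.le, div_eq_iff (Real.rpow_pos_of_pos ht₀0 _).ne']
      calc t ^ (b - 1) = t ^ (b - 1) * (b * |β| * t₀ ^ (b - 1)) := by rw [ht₀p, mul_one]
        _ = _ := by ring
    rw [h1, h2, h3]; congr 1; ring
  have hh1 : (1 - h) ^ (b - 1) ≤ (1 - h) ^ (b₀ - 1) :=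
    Real.rpow_le_rpow_of_exponent_ge (by linarith) (by linarith) (by linarith)
  have hlow : ∀ t : ℝ, 0 < t → t ≤ (1 - h) * t₀ → l ≤ |α + β * (b * t ^ (b - 1))| := by
    intro t ht ht2
    rw [hder t ht]
    have : (t / t₀) ^ (b - 1) ≤ (1 - h) ^ (b - 1) :=
      Real.rpow_le_rpow (by positivity) ((div_le_iff₀ ht₀0).2 ht2) hb1'.le
    exact le_trans (by linarith) (le_abs_self _)
  have hhigh : ∀ t : ℝ, 0 < t → t₀ / (1 - h) ≤ t → l ≤ |α + β * (b * t ^ (b - 1))| := by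
    intro t ht ht2
    rw [hder t ht, abs_sub_comm]
    have h1 : ((1 - h)⁻¹) ^ (b - 1) ≤ (t / t₀) ^ (b - 1) := by
      refine Real.rpow_le_rpow (inv_nonneg.2 (by linarith)) ?_ hb1'.le
      rw [le_div_iff₀ ht₀0]
      calc _ = t₀ / (1 - h) := by ring
        _ ≤ t := ht2
    rw [Real.inv_rpow (by linarith)] at h1
    have hy0 : 0 < (1 - h) ^ (b - 1) := Real.rpow_pos_of_pos (by linarith) _
    -- Since 1/y - 1 ≥ 1 - y, the lower bound l found below the window also holds above it.
    have hy : 2 - (1 - h) ^ (b - 1) ≤ ((1 - h) ^ (b - 1))⁻¹ := by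
      rw [le_inv_comm₀ (by linarith) hy0, inv_eq_one_div, le_div_iff₀ (by linarith)]
      nlinarith [sq_nonneg ((1 - h) ^ (b - 1) - 1)]
    exact le_trans (by linarith) (le_abs_self _)
  have hadd := fun (a c N : ℝ) (ha : 0 < a) (hc : 0 < c) (hN : 0 < N) =>
    oscInt_add b α β ha hc hN
  have key : ‖oscInt b α β a N‖ ≤ ε / 3 + (ε / 3 + ε / 3) := by
    refine norm_le_add_of_split (F := oscInt b α β) (T := T) (c := (1 - h) * t₀)
      (by positivity) (by positivity) hadd ?_ ?_ ha hTa haN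
    · intro a N ha hTa haN hN
      exact (norm_oscInt_le_of_deriv hb1 ha haN hl0 fun t ht =>
        hlow t (ha.trans_le ht.1) (ht.2.trans hN)).trans (hdec a hTa)
    · intro a N ha hTa hc haN
      refine norm_le_add_of_split (F := oscInt b α β) (T := max T ((1 - h) * t₀))
        (c := t₀ / (1 - h)) (by positivity) (by positivity) hadd ?_ ?_ ha (max_le hTa hc) haN
      · intro a N ha hTa haN hN
        refine (norm_oscInt_le_of_length ha haN).trans ?_
        have h1 : (1 - h) * t₀ ≤ a := (le_max_right _ _).trans hTa
        rw [div_le_iff₀ ha]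
        have h2 : N ≤ t₀ * (1 + 2 * h) := hN.trans (by
          rw [div_le_iff₀ (by linarith)]
          nlinarith [mul_nonneg ht₀0.le (mul_nonneg hh0.le (by linarith : 0 ≤ 1 - 2 * h))])
        nlinarith [mul_nonneg ht₀0.le (by linarith : (0:ℝ) ≤ ε - 24 * h)]
      · intro a N ha hTa hc haN
        exact (norm_oscInt_le_of_deriv hb1 ha haN hl0 fun t ht =>
          hhigh t (ha.trans_le ht.1) (hc.trans ht.1)).trans
          (hdec a ((le_max_left _ _).trans hTa))
  linarith

/-- If `|α| = 1` and `β` is small, the term of degree `b` is negligible. -/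
theorem exists_norm_oscInt_sub_le_of_small_power {b₀ : ℝ} (b₁ : ℝ) (hb₀ : 1 < b₀) {ε : ℝ}
    (hε : 0 < ε) :
    ∃ η > 0, ∀ b α β a N : ℝ, b₀ ≤ b → b ≤ b₁ → |α| = 1 → |β| ≤ η → 0 < a → a ≤ N →
      ‖oscInt b α β a N - oscInt b α 0 a N‖ ≤ ε := by
  -- Here the perturbation βt^b can overtake the linear term far out and create a stationary point,
  -- so the tail needs the estimate that tolerates one.
  obtain ⟨T, hT1, hT⟩ := exists_norm_oscInt_tail_le hb₀ (ε := ε / 4) (by positivity)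
  have hT0 : 0 < T := by linarith
  have hTb : 0 < T ^ b₁ := Real.rpow_pos_of_pos hT0 _
  refine ⟨ε / (2 * T ^ b₁), by positivity, ?_⟩
  intro b α β a N hb hb' hα hβ ha haN
  have key := norm_le_add_of_split (F := fun a N => oscInt b α β a N - oscInt b α 0 a N)
    (T := 0) (c := T) (X := ε / 2) (Y := ε / 2) (by positivity) (by positivity)
    (fun a c N ha hc hN => by
      rw [← oscInt_add b α β ha hc hN, ← oscInt_add b α 0 ha hc hN]; ring)
    ?_ ?_ ha ha.le haN
  · simpa using key
  · intro a N ha _ haN hN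
    refine (norm_oscInt_sub_le (C := ε / (2 * T)) ha haN fun t ht => ?_).trans ?_
    · have ht0 : 0 < t := ha.trans_le ht.1
      have htT : t ≤ T := ht.2.trans hN
      simp only [sub_zero, sub_self, zero_mul, zero_add]
      rw [abs_mul, abs_of_nonneg (Real.rpow_nonneg ht0.le b)]
      have h1 : t ^ b = t ^ (b - 1) * t := by
        rw [← Real.rpow_add_one ht0.ne']; congr 1; ring
      have h2 : t ^ (b - 1) ≤ T ^ (b₁ - 1) :=
        (Real.rpow_le_rpow ht0.le htT (by linarith)).trans
          (Real.rpow_le_rpow_of_exponent_le hT1 (by linarith))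
      have h3 : T ^ b₁ = T ^ (b₁ - 1) * T := by
        rw [← Real.rpow_add_one hT0.ne']; congr 1; ring
      have hp : 0 < T ^ (b₁ - 1) := Real.rpow_pos_of_pos hT0 _
      rw [h1, ← mul_assoc]
      refine mul_le_mul_of_nonneg_right ?_ ht0.le
      calc |β| * t ^ (b - 1) ≤ ε / (2 * T ^ b₁) * T ^ (b₁ - 1) := by gcongr
        _ = ε / (2 * T) := by rw [h3]; field_simp
    · calc ε / (2 * T) * (N - a) ≤ ε / (2 * T) * T := by gcongr; linarith
        _ = ε / 2 := by field_simp
  · intro a N ha _ hTa haN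
    calc _ ≤ ε / 4 + ε / 4 := (norm_sub_le _ _).trans
          (add_le_add (hT b α β a N hb hα hTa haN) (hT b α 0 a N hb hα hTa haN))
      _ = ε / 2 := by ring

/-! ### Monomial phases: comparison with them, sine and cosine integrals. -/

/-- The sine integral. -/
def sinInt (x : ℝ) : ℝ := ∫ t in (0 : ℝ)..x, Real.sinc t

theorem hasDerivAt_sinInt (x : ℝ) : HasDerivAt sinInt (Real.sinc x) x :=
  intervalIntegral.integral_hasDerivAt_right (Real.continuous_sinc.intervalIntegrable _ _)
    Real.continuous_sinc.stronglyMeasurable.stronglyMeasurableAtFilter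
    Real.continuous_sinc.continuousAt

theorem continuous_sinInt : Continuous sinInt :=
  continuous_iff_continuousAt.2 fun x => (hasDerivAt_sinInt x).continuousAt

theorem sinInt_zero : sinInt 0 = 0 := by simp [sinInt]

theorem sinInt_neg (x : ℝ) : sinInt (-x) = -sinInt x := by
  have := intervalIntegral.integral_comp_neg (a := 0) (b := x) Real.sinc
  simp only [Real.sinc_neg, neg_zero] at this
  rw [sinInt, sinInt, this, intervalIntegral.integral_symm]

/-- The imaginary part of a monomial oscillatory integral. -/
theorem integral_sin_mul_div (α : ℝ) {a N : ℝ} (ha : 0 < a) (hN : 0 < N) :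
    ∫ t in a..N, Real.sin (α * t) / t = sinInt (α * N) - sinInt (α * a) := by
  refine intervalIntegral.integral_eq_sub_of_hasDerivAt (f := fun t => sinInt (α * t)) ?_ ?_
  · intro t ht
    have ht0 : 0 < t := uIcc_subset_Ioi ha hN ht
    have := (hasDerivAt_sinInt (α * t)).comp t ((hasDerivAt_id t).const_mul α)
    refine this.congr_deriv ?_
    rcases eq_or_ne α 0 with rfl | hα
    · simp
    · rw [Real.sinc_of_ne_zero (by positivity)]; field_simp
  · refine ContinuousOn.intervalIntegrable (ContinuousOn.div (by fun_prop) continuousOn_id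
      fun t ht => (uIcc_subset_Ioi ha hN ht).ne')

/-- Uniform comparison of the oscillatory integral with a monomial one, when one of the two
terms of the phase dominates. -/
theorem exists_threshold_norm_oscInt_sub_le {b₀ : ℝ} (b₁ : ℝ) (hb₀ : 1 < b₀) {ε : ℝ} (hε : 0 < ε) :
    ∃ H ≥ 1, ∀ b α β a N : ℝ, b₀ ≤ b → b ≤ b₁ → α ≠ 0 → β ≠ 0 → 0 < a → a ≤ N →
      (H * |β| ≤ |α| ^ b → ‖oscInt b α β a N - oscInt b α 0 a N‖ ≤ ε) ∧
      (H * |α| ^ b ≤ |β| → ‖oscInt b α β a N - oscInt b 0 β a N‖ ≤ ε) := by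
  obtain ⟨η₁, hη₁, h1⟩ := exists_norm_oscInt_sub_le_of_small_power b₁ hb₀ hε
  obtain ⟨η₂, hη₂, h2⟩ := exists_norm_oscInt_sub_le_of_small_linear hε
  set η := min η₂ 1 with hη
  have hη0 : 0 < η := by positivity
  have hη1 : η ≤ 1 := min_le_right _ _
  -- The measure dt/t is scale invariant, so a dilation by |α|⁻¹ or |β|^{-1/b} makes the dominant
  -- coefficient unimodular. The domination by H then says that the other coefficient is at most η₁
  -- or η; the exponent b₁ covers every b ≤ b₁, as η ≤ 1.
  refine ⟨max 1 (max η₁⁻¹ (η⁻¹ ^ b₁)), le_max_left _ _, ?_⟩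
  intro b α β a N hb hb' hα hβ ha haN
  have hb1 : 1 < b := hb₀.trans_le hb
  have hN : 0 < N := ha.trans_le haN
  have hα0 : 0 < |α| := abs_pos.2 hα
  have hβ0 : 0 < |β| := abs_pos.2 hβ
  have hscale : ∀ s : ℝ, 0 < s → ∀ α' β' : ℝ,
      oscInt b α' β' a N = oscInt b (α' * s) (β' * s ^ b) (a / s) (N / s) := by
    intro s hs α' β'
    rw [← oscInt_scale b α' β' (div_pos ha hs) (div_pos hN hs) hs, mul_div_cancel₀ _ hs.ne',
      mul_div_cancel₀ _ hs.ne']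
  constructor
  · intro h
    have h3 : |β| ≤ η₁ * |α| ^ b := by
      have : η₁⁻¹ * |β| ≤ |α| ^ b := le_trans (by gcongr; simp) h
      rwa [inv_mul_le_iff₀ hη₁] at this
    have hs : 0 < |α|⁻¹ := inv_pos.2 hα0
    rw [hscale _ hs α β, hscale _ hs α 0, zero_mul]
    refine h1 b _ _ _ _ hb hb' ?_ ?_ (div_pos ha hs) (by gcongr)
    · rw [abs_mul, abs_of_pos hs, mul_inv_cancel₀ hα0.ne']
    · rw [abs_mul, Real.inv_rpow hα0.le, abs_of_pos (a := (|α| ^ b)⁻¹) (by positivity),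
        ← div_eq_mul_inv, div_le_iff₀ (by positivity)]
      exact h3
  · intro h
    have h3 : (|α| * η⁻¹) ^ b ≤ |β| := by
      rw [Real.mul_rpow hα0.le (by positivity), mul_comm]
      refine le_trans ?_ h
      gcongr
      refine (Real.rpow_le_rpow_of_exponent_le (one_le_inv₀ hη0 |>.2 hη1) hb').trans ?_
      simp
    set s := |β| ^ (-(1 / b)) with hsdef
    have hs : 0 < s := Real.rpow_pos_of_pos hβ0 _
    have hsb : |β| * s ^ b = 1 := by
      rw [hsdef, ← Real.rpow_mul hβ0.le, show -(1 / b) * b = -1 by field_simp, Real.rpow_neg_one,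
        mul_inv_cancel₀ hβ0.ne']
    rw [hscale _ hs α β, hscale _ hs 0 β, zero_mul]
    refine h2 b _ _ _ _ hb1 ?_ ?_ (div_pos ha hs) (by gcongr)
    · rw [abs_mul, abs_of_pos (a := s ^ b) (by positivity), hsb]
    · refine le_trans ?_ (min_le_left η₂ 1)
      rw [abs_mul, abs_of_pos hs]
      have h4 : (|α| * η⁻¹ * s) ^ b ≤ 1 := by
        rw [Real.mul_rpow (by positivity) hs.le, ← hsb]; gcongr
      have h5 : |α| * η⁻¹ * s ≤ 1 := by
        by_contra hcon
        exact absurd h4 (not_le.2 (Real.one_lt_rpow (not_le.1 hcon) (by linarith)))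
      calc |α| * s = η * (|α| * η⁻¹ * s) := by field_simp
        _ ≤ η * 1 := by gcongr
        _ = η := mul_one _

/-- The cosine integral, normalised to vanish at `1`. -/
def cosInt (x : ℝ) : ℝ := ∫ t in (1 : ℝ)..x, Real.cos t / t

theorem continuousOn_cos_div : ContinuousOn (fun t : ℝ => Real.cos t / t) (Ioi 0) :=
  ContinuousOn.div (by fun_prop) continuousOn_id fun _ ht => ne_of_gt ht

theorem intervalIntegrable_cos_div {a N : ℝ} (ha : 0 < a) (hN : 0 < N) :
    IntervalIntegrable (fun t : ℝ => Real.cos t / t) volume a N :=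
  (continuousOn_cos_div.mono (uIcc_subset_Ioi ha hN)).intervalIntegrable

theorem hasDerivAt_cosInt {x : ℝ} (hx : 0 < x) : HasDerivAt cosInt (Real.cos x / x) x :=
  intervalIntegral.integral_hasDerivAt_right (intervalIntegrable_cos_div one_pos hx)
    (continuousOn_cos_div.stronglyMeasurableAtFilter isOpen_Ioi x hx)
    (continuousOn_cos_div.continuousAt (Ioi_mem_nhds hx))

theorem cosInt_sub {x y : ℝ} (hx : 0 < x) (hy : 0 < y) :
    cosInt y - cosInt x = ∫ t in x..y, Real.cos t / t :=
  intervalIntegral.integral_interval_sub_left (intervalIntegrable_cos_div one_pos hy)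
    (intervalIntegrable_cos_div one_pos hx)

/-- Evaluation of the oscillatory integral with a monomial phase of degree `b`. -/
theorem oscInt_zero_left {b β a N : ℝ} (hb : 0 < b) (hβ : β ≠ 0) (ha : 0 < a) (hN : 0 < N) :
    oscInt b 0 β a N =
      (((cosInt (|β| * N ^ b) - cosInt (|β| * a ^ b)) / b : ℝ) : ℂ) +
      (((sinInt (β * N ^ b) - sinInt (β * a ^ b)) / b : ℝ) : ℂ) * Complex.I := by
  have hβ0 : 0 < |β| := abs_pos.2 hβ
  have := intervalIntegral.integral_eq_sub_of_hasDerivAt (a := a) (b := N)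
    (f := fun t : ℝ => ((cosInt (|β| * t ^ b) / b : ℝ) : ℂ) +
      ((sinInt (β * t ^ b) / b : ℝ) : ℂ) * Complex.I)
    (f' := fun t : ℝ => Complex.exp (((0 * t + β * t ^ b : ℝ) : ℂ) * Complex.I) / t)
    (fun t ht => by
      have ht0 : 0 < t := uIcc_subset_Ioi ha hN ht
      have htb : 0 < t ^ b := Real.rpow_pos_of_pos ht0 _
      have htb1 : t ^ b = t ^ (b - 1) * t := by
        rw [← Real.rpow_add_one ht0.ne']; congr 1; ring
      have hp : 0 < t ^ (b - 1) := Real.rpow_pos_of_pos ht0 _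
      have hd := Real.hasDerivAt_rpow_const (x := t) (p := b) (Or.inl ht0.ne')
      have h1 := (((hasDerivAt_cosInt (x := |β| * t ^ b) (by positivity)).comp t
        (hd.const_mul |β|)).div_const b).ofReal_comp
      have h2 := (((hasDerivAt_sinInt (β * t ^ b)).comp t
        (hd.const_mul β)).div_const b).ofReal_comp.mul_const Complex.I
      refine (h1.add h2).congr_deriv ?_
      have e1 : Real.cos (|β| * t ^ b) / (|β| * t ^ b) * (|β| * (b * t ^ (b - 1))) / b
          = Real.cos (β * t ^ b) / t := by
        rw [show Real.cos (|β| * t ^ b) = Real.cos (β * t ^ b) by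
          rw [← Real.cos_abs (β * t ^ b), abs_mul, abs_of_pos htb], htb1]
        field_simp
      have e2 : Real.sinc (β * t ^ b) * (β * (b * t ^ (b - 1))) / b
          = Real.sin (β * t ^ b) / t := by
        rw [Real.sinc_of_ne_zero (by positivity), htb1]
        field_simp
      rw [e1, e2, zero_mul, zero_add, Complex.exp_mul_I, ← Complex.ofReal_cos, ← Complex.ofReal_sin,
        Complex.ofReal_div, Complex.ofReal_div]
      ring)
    (intervalIntegrable_oscInt b 0 β ha hN)
  rw [oscInt, this]
  push_cast
  ring

/-- Evaluation of the difference of the oscillatory integrals with opposite linear phases. -/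
theorem oscInt_linear_sub {b α a N : ℝ} (ha : 0 < a) (hN : 0 < N) :
    oscInt b α 0 a N - oscInt b (-α) 0 a N =
      ((2 * (sinInt (α * N) - sinInt (α * a)) : ℝ) : ℂ) * Complex.I := by
  unfold oscInt
  rw [← intervalIntegral.integral_sub (intervalIntegrable_oscInt b α 0 ha hN)
    (intervalIntegrable_oscInt b (-α) 0 ha hN), ← integral_sin_mul_div α ha hN, Complex.ofReal_mul,
    ← intervalIntegral.integral_ofReal, mul_right_comm, mul_comm _ (∫ _ in _.._, _),
    ← intervalIntegral.integral_mul_const]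
  refine intervalIntegral.integral_congr fun t ht => ?_
  simp only [zero_mul, add_zero, Complex.exp_mul_I, ← Complex.ofReal_cos, ← Complex.ofReal_sin,
    neg_mul, Real.cos_neg, Real.sin_neg]
  push_cast
  ring

/-- The exponent 2 is a dummy, its coefficient being 0. The formula transfers the van der Corput
bound to the sine and cosine integrals, giving the Cauchy criterion at infinity. -/
theorem oscInt_one_zero {a N : ℝ} (ha : 0 < a) (hN : 0 < N) :
    oscInt 2 1 0 a N = ((cosInt N - cosInt a : ℝ) : ℂ) + ((sinInt N - sinInt a : ℝ) : ℂ) * Complex.I := by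
  have := intervalIntegral.integral_eq_sub_of_hasDerivAt (a := a) (b := N)
    (f := fun t : ℝ => ((cosInt t : ℝ) : ℂ) + ((sinInt t : ℝ) : ℂ) * Complex.I)
    (f' := fun t : ℝ => Complex.exp (((1 * t + 0 * t ^ (2 : ℝ) : ℝ) : ℂ) * Complex.I) / t)
    (fun t ht => by
      have ht0 : 0 < t := uIcc_subset_Ioi ha hN ht
      refine ((hasDerivAt_cosInt ht0).ofReal_comp.add
        ((hasDerivAt_sinInt t).ofReal_comp.mul_const Complex.I)).congr_deriv ?_
      rw [Real.sinc_of_ne_zero ht0.ne', zero_mul, add_zero, one_mul, Complex.exp_mul_I]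
      push_cast
      ring)
    (intervalIntegrable_oscInt 2 1 0 ha hN)
  rw [oscInt, this]
  push_cast
  ring

theorem abs_sinInt_cosInt_sub_le {a N : ℝ} (ha : 0 < a) (haN : a ≤ N) :
    |sinInt N - sinInt a| ≤ 5 / a ∧ |cosInt N - cosInt a| ≤ 5 / a := by
  have h : ‖oscInt 2 1 0 a N‖ ≤ 5 / (a * 1) :=
    norm_oscInt_le_of_deriv (by norm_num) ha haN one_pos fun t _ => by simp
  rw [oscInt_one_zero ha (ha.trans_le haN), mul_one] at h
  refine ⟨le_trans ?_ h, le_trans ?_ h⟩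
  · simpa using Complex.abs_im_le_norm
      (((cosInt N - cosInt a : ℝ) : ℂ) + ((sinInt N - sinInt a : ℝ) : ℂ) * Complex.I)
  · simpa using Complex.abs_re_le_norm
      (((cosInt N - cosInt a : ℝ) : ℂ) + ((sinInt N - sinInt a : ℝ) : ℂ) * Complex.I)

theorem exists_tendsto_atTop_of_abs_sub_le {F : ℝ → ℝ}
    (hF : ∀ a N : ℝ, 0 < a → a ≤ N → |F N - F a| ≤ 5 / a) : ∃ D, Tendsto F atTop (𝓝 D) := by
  refine cauchy_map_iff_exists_tendsto.1 (Metric.cauchy_iff.2 ⟨inferInstance, fun ε hε => ?_⟩)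
  refine ⟨F '' Ici (20 / ε), image_mem_map (Ici_mem_atTop _), ?_⟩
  have hT : 0 < 20 / ε := by positivity
  rintro _ ⟨x, hx, rfl⟩ _ ⟨y, hy, rfl⟩
  have h1 := hF _ _ hT hx
  have h2 := hF _ _ hT hy
  have h3 : 5 / (20 / ε) = ε / 4 := by field_simp; norm_num
  rw [h3] at h1 h2
  rw [Real.dist_eq]
  rw [abs_le] at h1 h2
  rw [abs_lt]
  constructor <;> linarith [h1.1, h1.2, h2.1, h2.2]

/-- The limit of the sine integral at infinity. -/
theorem exists_tendsto_sinInt : ∃ D, Tendsto sinInt atTop (𝓝 D) :=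
  exists_tendsto_atTop_of_abs_sub_le fun _ _ ha haN => (abs_sinInt_cosInt_sub_le ha haN).1

theorem exists_tendsto_cosInt : ∃ D, Tendsto cosInt atTop (𝓝 D) :=
  exists_tendsto_atTop_of_abs_sub_le fun _ _ ha haN => (abs_sinInt_cosInt_sub_le ha haN).2

theorem sinInt_one_ge : 3 / 4 ≤ sinInt 1 := by
  have : ∫ _ in (0:ℝ)..1, (3 / 4 : ℝ) ≤ sinInt 1 := by
    refine intervalIntegral.integral_mono_on zero_le_one (by simp)
      (Real.continuous_sinc.intervalIntegrable _ _) fun t ht => ?_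
    rcases eq_or_lt_of_le ht.1 with h | h
    · rw [← h, Real.sinc_zero]; norm_num
    · rw [Real.sinc_of_ne_zero h.ne', le_div_iff₀ h]
      have := Real.sin_gt_sub_cube h
      have h2 : t ^ 3 ≤ t := by nlinarith [pow_le_one₀ h.le ht.2 (n := 2), ht.2]
      linarith
  simpa using this

/-- Integrate by parts with the primitive 1 - cos t of sin t: the remaining integrand (1 - cos t)/t²
is nonnegative, so at most 1 - cos 1 ≤ 1/2 is lost from the value at 1. Only the positivity of the
Dirichlet integral is needed later, not its value. -/
theorem sinInt_ge {N : ℝ} (hN : 1 ≤ N) : 1 / 4 ≤ sinInt N := by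
  have hpos : ∀ t ∈ uIcc 1 N, 0 < t := fun t ht => uIcc_subset_Ioi one_pos (by linarith) ht
  have hint : IntervalIntegrable (fun t : ℝ => (1 - Real.cos t) / t ^ 2) volume 1 N :=
    (ContinuousOn.div (by fun_prop) (by fun_prop) fun t ht =>
      pow_ne_zero _ (hpos t ht).ne').intervalIntegrable
  have h := intervalIntegral.integral_eq_sub_of_hasDerivAt (a := 1) (b := N)
    (f := fun t : ℝ => sinInt t - (1 - Real.cos t) / t)
    (f' := fun t : ℝ => (1 - Real.cos t) / t ^ 2)
    (fun t ht => by
      have ht0 := hpos t ht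
      have h1 := ((Real.hasDerivAt_cos t).const_sub 1).div (hasDerivAt_id t) ht0.ne'
      refine ((hasDerivAt_sinInt t).sub h1).congr_deriv ?_
      rw [Real.sinc_of_ne_zero ht0.ne']
      simp only [id]
      field_simp
      ring) hint
  have h0 : 0 ≤ ∫ t in (1:ℝ)..N, (1 - Real.cos t) / t ^ 2 :=
    intervalIntegral.integral_nonneg hN fun t ht =>
      div_nonneg (by linarith [Real.cos_le_one t]) (by positivity)
  rw [h] at h0
  have h2 : 0 ≤ (1 - Real.cos N) / N := div_nonneg (by linarith [Real.cos_le_one N]) (by linarith)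
  have h3 := Real.one_sub_sq_div_two_le_cos (x := 1)
  have h4 := sinInt_one_ge
  simp only [div_one] at h0
  linarith

/-- The value of the Dirichlet integral `∫_0^∞ sin t / t dt`. -/
def dirichletConst : ℝ := exists_tendsto_sinInt.choose

theorem tendsto_sinInt : Tendsto sinInt atTop (𝓝 dirichletConst) :=
  exists_tendsto_sinInt.choose_spec

theorem dirichletConst_pos : 0 < dirichletConst :=
  lt_of_lt_of_le (by norm_num : (0:ℝ) < 1 / 4)
    (ge_of_tendsto tendsto_sinInt ((eventually_ge_atTop 1).mono fun _ h => sinInt_ge h))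

theorem tendsto_sinInt_atBot : Tendsto sinInt atBot (𝓝 (-dirichletConst)) := by
  have := (tendsto_sinInt.comp tendsto_neg_atBot_atTop).neg
  refine this.congr fun x => ?_
  simp [sinInt_neg]

/-- The Frullani limit for the cosine integral. -/
theorem tendsto_cosInt_sub {p q : ℝ} (hp : 0 < p) (hq : 0 < q) :
    Tendsto (fun x => cosInt (p * x) - cosInt (q * x)) (𝓝[>] 0) (𝓝 (Real.log (p / q))) := by
  have hb : ∀ᶠ x in 𝓝[>] (0:ℝ), ‖cosInt (p * x) - cosInt (q * x) - Real.log (p / q)‖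
      ≤ |p - q| * x := by
    filter_upwards [self_mem_nhdsWithin] with x hx
    have hx0 : (0:ℝ) < x := hx
    have hpx : 0 < p * x := by positivity
    have hqx : 0 < q * x := by positivity
    have h1 : Real.log (p / q) = ∫ t in (q * x)..(p * x), t⁻¹ := by
      rw [integral_inv_of_pos hqx hpx]; congr 1; field_simp
    rw [cosInt_sub hqx hpx, h1, ← intervalIntegral.integral_sub
      (intervalIntegrable_cos_div hqx hpx)
      (intervalIntegral.intervalIntegrable_inv (fun t ht => (uIcc_subset_Ioi hqx hpx ht).ne')
        continuousOn_id : IntervalIntegrable (fun t : ℝ => t⁻¹) volume (q * x) (p * x))]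
    refine (intervalIntegral.norm_integral_le_of_norm_le_const (C := 1) fun t ht => ?_).trans_eq ?_
    · have ht0 : 0 < t := uIcc_subset_Ioi hqx hpx (uIoc_subset_uIcc ht)
      rw [div_eq_mul_inv, ← sub_one_mul, norm_mul, norm_inv, Real.norm_of_nonneg ht0.le,
        ← div_eq_mul_inv, div_le_one ht0, Real.norm_eq_abs]
      have := Complex.abs_re_le_norm (Complex.exp ((t : ℂ) * Complex.I) - 1)
      rw [Complex.sub_re, Complex.exp_ofReal_mul_I_re, Complex.one_re] at this
      exact this.trans ((norm_exp_sub_one_le t).trans_eq (abs_of_pos ht0))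
    · rw [← sub_mul, abs_mul, abs_of_pos hx0, one_mul]
  rw [tendsto_iff_norm_sub_tendsto_zero]
  refine squeeze_zero' (Eventually.of_forall fun _ => norm_nonneg _) hb ?_
  have : Tendsto (fun x : ℝ => |p - q| * x) (𝓝 0) (𝓝 (|p - q| * 0)) :=
    tendsto_id.const_mul _
  rw [mul_zero] at this
  exact this.mono_left nhdsWithin_le_nhds

/-! ### The truncated multiplier and its two limiting values. -/

/-- The two half-line oscillatory integrals that make up the truncated multiplier. -/
def oscKernel (b ρ p m a N : ℝ) : ℂ := oscInt b (-ρ) (-p) a N - oscInt b ρ (-m) a N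

/-- The value of the multiplier where the linear term of the phase dominates. -/
def linearValue : ℂ := ((-(2 * dirichletConst) : ℝ) : ℂ) * Complex.I

/-- The value of the multiplier where the term of degree `b` dominates. -/
def powerValue (b cp cm : ℝ) : ℂ :=
  ((Real.log (|cm| / |cp|) / b : ℝ) : ℂ) +
    ((-(dirichletConst * (Real.sign cp - Real.sign cm)) / b : ℝ) : ℂ) * Complex.I

theorem tendsto_sinInt_mul {c : ℝ} (hc : c ≠ 0) :
    Tendsto (fun y => sinInt (c * y)) atTop (𝓝 (dirichletConst * Real.sign c)) := by
  rcases lt_or_gt_of_ne hc with h | h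
  · rw [Real.sign_of_neg h, mul_neg_one]
    exact tendsto_sinInt_atBot.comp (tendsto_id.const_mul_atTop_of_neg h)
  · rw [Real.sign_of_pos h, mul_one]
    exact tendsto_sinInt.comp (tendsto_id.const_mul_atTop h)

/-- Both cosine integrals tend to the same limit and cancel; the logarithm and the signs of the sine
integrals survive. -/
theorem tendsto_oscKernel_monomial_atTop {b cp cm : ℝ} (hp : cp ≠ 0) (hm : cm ≠ 0) :
    Tendsto (fun y : ℝ =>
      (((cosInt (|cp| * y) - cosInt (|cm| * y) + Real.log (|cm| / |cp|)) / b : ℝ) : ℂ) +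
      (((sinInt (-cp * y) - sinInt (-cm * y)) / b : ℝ) : ℂ) * Complex.I) atTop
      (𝓝 (powerValue b cp cm)) := by
  obtain ⟨G, hG⟩ := exists_tendsto_cosInt
  have h1 := hG.comp (tendsto_id.const_mul_atTop (abs_pos.2 hp))
  have h2 := hG.comp (tendsto_id.const_mul_atTop (abs_pos.2 hm))
  have h3 := tendsto_sinInt_mul (neg_ne_zero.2 hp)
  have h4 := tendsto_sinInt_mul (neg_ne_zero.2 hm)
  have h5 := ((h1.sub h2).add_const (Real.log (|cm| / |cp|))).div_const b
  have h6 := (h3.sub h4).div_const b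
  have h7 := ((Complex.continuous_ofReal.tendsto _).comp h5).add
    (((Complex.continuous_ofReal.tendsto _).comp h6).mul_const Complex.I)
  have h8 : powerValue b cp cm = (((G - G + Real.log (|cm| / |cp|)) / b : ℝ) : ℂ) +
      (((dirichletConst * Real.sign (-cp) - dirichletConst * Real.sign (-cm)) / b : ℝ) : ℂ)
        * Complex.I := by
    rw [powerValue, sub_self, zero_add, Real.sign_neg, Real.sign_neg]
    congr 4; ring
  rw [h8]
  exact h7

/-- Each cosine integral diverges logarithmically as a → 0, but their difference converges to the
Frullani value log(|c₋|/|c₊|). -/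
theorem tendsto_oscKernel_monomial_zero {b cp cm σ N : ℝ} (hb : 0 < b) (hp : cp ≠ 0) (hm : cm ≠ 0)
    (hσ : 0 < σ) (hN : 0 < N) :
    Tendsto (fun a => oscKernel b 0 (σ * cp) (σ * cm) a N) (𝓝[>] 0)
      (𝓝 ((((cosInt (|cp| * (σ * N ^ b)) - cosInt (|cm| * (σ * N ^ b))
          + Real.log (|cm| / |cp|)) / b : ℝ) : ℂ) +
      (((sinInt (-cp * (σ * N ^ b)) - sinInt (-cm * (σ * N ^ b))) / b : ℝ) : ℂ)
        * Complex.I)) := by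
  have ht : Tendsto (fun a : ℝ => σ * a ^ b) (𝓝[>] 0) (𝓝[>] 0) := by
    refine tendsto_nhdsWithin_iff.2 ⟨?_, ?_⟩
    · have : Tendsto (fun a : ℝ => σ * a ^ b) (𝓝 0) (𝓝 (σ * 0 ^ b)) :=
        ((Real.continuous_rpow_const hb.le).const_mul σ).tendsto 0
      rw [Real.zero_rpow hb.ne', mul_zero] at this
      exact this.mono_left nhdsWithin_le_nhds
    · filter_upwards [self_mem_nhdsWithin] with a ha
      exact mul_pos hσ (Real.rpow_pos_of_pos ha _)
  have h1 := (tendsto_cosInt_sub (abs_pos.2 hm) (abs_pos.2 hp)).comp ht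
  have hs : ∀ c : ℝ, Tendsto (fun a : ℝ => sinInt (c * (σ * a ^ b))) (𝓝[>] 0) (𝓝 0) := by
    intro c
    have := (continuous_sinInt.comp (continuous_const_mul c)).tendsto 0
    simp only [Function.comp, mul_zero, sinInt_zero] at this
    exact this.comp (ht.mono_right nhdsWithin_le_nhds)
  have h2 := (h1.const_add (cosInt (|cp| * (σ * N ^ b)) - cosInt (|cm| * (σ * N ^ b)))).div_const b
  have h3 := (((hs (-cp)).sub (hs (-cm))).const_sub
    (sinInt (-cp * (σ * N ^ b)) - sinInt (-cm * (σ * N ^ b)))).div_const b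
  simp only [sub_zero] at h3
  have h4 := ((Complex.continuous_ofReal.tendsto _).comp h2).add
    (((Complex.continuous_ofReal.tendsto _).comp h3).mul_const Complex.I)
  refine h4.congr' ?_
  filter_upwards [self_mem_nhdsWithin] with a ha
  have ha0 : (0:ℝ) < a := ha
  rw [oscKernel, neg_zero, oscInt_zero_left hb (neg_ne_zero.2 (mul_ne_zero hσ.ne' hp)) ha0 hN,
    oscInt_zero_left hb (neg_ne_zero.2 (mul_ne_zero hσ.ne' hm)) ha0 hN]
  simp only [Function.comp, abs_neg, abs_mul, abs_of_pos hσ]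
  rw [show ∀ x y : ℝ, σ * x * y = x * (σ * y) from fun x y => by ring,
    show ∀ x y : ℝ, σ * x * y = x * (σ * y) from fun x y => by ring,
    show ∀ x y : ℝ, σ * x * y = x * (σ * y) from fun x y => by ring,
    show ∀ x y : ℝ, σ * x * y = x * (σ * y) from fun x y => by ring]
  simp only [show ∀ x y : ℝ, -(σ * x) * y = -x * (σ * y) from fun x y => by ring]
  push_cast
  ring

/-- For the linear phase the two half lines differ by t ↦ -t, so the cosines cancel and only twice
the sine integral is left. -/
theorem tendsto_oscKernel_linear_zero {b ρ N : ℝ} (hN : 0 < N) :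
    Tendsto (fun a => oscKernel b ρ 0 0 a N) (𝓝[>] 0)
      (𝓝 (((-(2 * sinInt (ρ * N)) : ℝ) : ℂ) * Complex.I)) := by
  have h0 := (continuous_sinInt.comp (continuous_const_mul ρ)).tendsto 0
  simp only [Function.comp, mul_zero, sinInt_zero] at h0
  have h1 : Tendsto (fun a => ((-(2 * (sinInt (ρ * N) - sinInt (ρ * a))) : ℝ) : ℂ) * Complex.I)
      (𝓝[>] 0) (𝓝 (((-(2 * (sinInt (ρ * N) - 0)) : ℝ) : ℂ) * Complex.I)) :=
    (((Complex.continuous_ofReal.tendsto _).comp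
      (((h0.const_sub _).const_mul 2).neg)).mul_const _).mono_left nhdsWithin_le_nhds
  rw [sub_zero] at h1
  refine h1.congr' ?_
  filter_upwards [self_mem_nhdsWithin] with a ha
  have := oscInt_linear_sub (b := b) (α := -ρ) (a := a) (N := N) ha hN
  rw [oscKernel, neg_zero, ← neg_neg ρ, neg_neg (-ρ), this]
  simp only [neg_mul, sinInt_neg, neg_neg]
  congr 2; ring

/-- Uniform description of the truncated multiplier in the two asymptotic regimes. -/
theorem exists_threshold_oscKernel {b₀ : ℝ} (b₁ : ℝ) (hb₀ : 1 < b₀) {ε : ℝ} (hε : 0 < ε) :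
    ∃ H ≥ 1, ∀ b cp cm : ℝ, b₀ ≤ b → b ≤ b₁ → cp ≠ 0 → cm ≠ 0 → ∀ δ > 0, ∃ X : ℝ,
      ∀ ρ σ N : ℝ, 0 < ρ → 0 < σ → 0 < N → X ≤ ρ * N → X ≤ σ * N ^ b →
      ((H * (σ * |cp|) ≤ ρ ^ b → H * (σ * |cm|) ≤ ρ ^ b →
        ∀ᶠ a in 𝓝[>] 0, ‖oscKernel b ρ (σ * cp) (σ * cm) a N - linearValue‖ ≤ ε + δ) ∧
      (H * ρ ^ b ≤ σ * |cp| → H * ρ ^ b ≤ σ * |cm| →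
        ∀ᶠ a in 𝓝[>] 0, ‖oscKernel b ρ (σ * cp) (σ * cm) a N - powerValue b cp cm‖
          ≤ ε + δ)) := by
  obtain ⟨H, hH, h⟩ := exists_threshold_norm_oscInt_sub_le b₁ hb₀ (ε := ε / 2) (by positivity)
  refine ⟨H, hH, fun b cp cm hb hb' hp hm δ hδ => ?_⟩
  have hb1 : 0 < b := by linarith
  have e1 : ∀ᶠ y in atTop, |sinInt y - dirichletConst| < δ / 2 := by
    have := (tendsto_sinInt.sub_const dirichletConst).abs
    rw [sub_self, abs_zero] at this
    exact this.eventually (gt_mem_nhds (by positivity))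
  have e2 := (tendsto_iff_norm_sub_tendsto_zero.1
    (tendsto_oscKernel_monomial_atTop (b := b) hp hm)).eventually (gt_mem_nhds hδ)
  -- Unlike H, the threshold X depends on the coefficients and on δ. This is harmless: it only
  -- prescribes how large the modulation R must be.
  obtain ⟨X, hX⟩ := eventually_atTop.1 (e1.and e2)
  refine ⟨X, fun ρ σ N hρ hσ hN hX1 hX2 => ⟨fun h1 h2 => ?_, fun h1 h2 => ?_⟩⟩
  · have hlim := ((tendsto_oscKernel_linear_zero (b := b) (ρ := ρ) hN).sub_const
      linearValue).norm
    have hlt : ‖((-(2 * sinInt (ρ * N)) : ℝ) : ℂ) * Complex.I - linearValue‖ < δ := by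
      rw [linearValue, ← sub_mul, ← Complex.ofReal_sub, norm_mul, Complex.norm_I, mul_one,
        Complex.norm_real, Real.norm_eq_abs,
        show -(2 * sinInt (ρ * N)) - -(2 * dirichletConst)
          = -2 * (sinInt (ρ * N) - dirichletConst) by ring, abs_mul, abs_neg, abs_two]
      linarith [(hX _ hX1).1]
    filter_upwards [hlim.eventually (gt_mem_nhds hlt), self_mem_nhdsWithin,
      mem_nhdsWithin_of_mem_nhds (Iio_mem_nhds hN)] with a ha ha0 haN
    have k1 := (h b (-ρ) (-(σ * cp)) a N hb hb' (neg_ne_zero.2 hρ.ne')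
      (neg_ne_zero.2 (mul_ne_zero hσ.ne' hp)) ha0 (le_of_lt haN)).1
      (by rwa [abs_neg, abs_neg, abs_mul, abs_of_pos hσ, abs_of_pos hρ])
    have k2 := (h b ρ (-(σ * cm)) a N hb hb' hρ.ne'
      (neg_ne_zero.2 (mul_ne_zero hσ.ne' hm)) ha0 (le_of_lt haN)).1
      (by rwa [abs_neg, abs_mul, abs_of_pos hσ, abs_of_pos hρ])
    have : oscKernel b ρ (σ * cp) (σ * cm) a N - linearValue =
        (oscInt b (-ρ) (-(σ * cp)) a N - oscInt b (-ρ) 0 a N)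
        - (oscInt b ρ (-(σ * cm)) a N - oscInt b ρ 0 a N)
        + (oscKernel b ρ 0 0 a N - linearValue) := by
      simp only [oscKernel, neg_zero]; ring
    rw [this]
    refine (norm_add_le _ _).trans (add_le_add ((norm_sub_le _ _).trans ?_) ha.le)
    linarith
  · have hlim := ((tendsto_oscKernel_monomial_zero hb1 hp hm hσ hN).sub_const
      (powerValue b cp cm)).norm
    filter_upwards [hlim.eventually (gt_mem_nhds (hX _ hX2).2), self_mem_nhdsWithin,
      mem_nhdsWithin_of_mem_nhds (Iio_mem_nhds hN)] with a ha ha0 haN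
    have k1 := (h b (-ρ) (-(σ * cp)) a N hb hb' (neg_ne_zero.2 hρ.ne')
      (neg_ne_zero.2 (mul_ne_zero hσ.ne' hp)) ha0 (le_of_lt haN)).2
      (by rwa [abs_neg, abs_neg, abs_mul, abs_of_pos hσ, abs_of_pos hρ])
    have k2 := (h b ρ (-(σ * cm)) a N hb hb' hρ.ne'
      (neg_ne_zero.2 (mul_ne_zero hσ.ne' hm)) ha0 (le_of_lt haN)).2
      (by rwa [abs_neg, abs_mul, abs_of_pos hσ, abs_of_pos hρ])
    have : oscKernel b ρ (σ * cp) (σ * cm) a N - powerValue b cp cm =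
        (oscInt b (-ρ) (-(σ * cp)) a N - oscInt b 0 (-(σ * cp)) a N)
        - (oscInt b ρ (-(σ * cm)) a N - oscInt b 0 (-(σ * cm)) a N)
        + (oscKernel b 0 (σ * cp) (σ * cm) a N - powerValue b cp cm) := by
      simp only [oscKernel, neg_zero]; ring
    rw [this]
    refine (norm_add_le _ _).trans (add_le_add ((norm_sub_le _ _).trans ?_) ha.le)
    linarith

theorem norm_linearValue : ‖linearValue‖ = 2 * dirichletConst := by
  rw [linearValue, norm_mul, Complex.norm_I, mul_one, Complex.norm_real, Real.norm_eq_abs, abs_neg,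
    abs_of_pos (by have := dirichletConst_pos; positivity)]

theorem abs_sign_sub_sign_le (x y : ℝ) : |Real.sign x - Real.sign y| ≤ 2 := by
  rcases Real.sign_apply_eq x with h | h | h <;> rcases Real.sign_apply_eq y with h' | h' | h' <;>
    rw [h, h'] <;> norm_num

/-- Compare imaginary parts: -2D against a number of modulus at most 2D/b. The strict inequality b >
1 creates the gap. -/
theorem le_norm_linearValue_sub_powerValue {b₀ b cp cm : ℝ} (hb₀ : 1 < b₀) (hb : b₀ ≤ b) :
    2 * dirichletConst * (1 - 1 / b₀) ≤ ‖linearValue - powerValue b cp cm‖ := by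
  have hD := dirichletConst_pos
  have hb0 : 0 < b := by linarith
  refine le_trans ?_ (Complex.abs_im_le_norm _)
  have : (linearValue - powerValue b cp cm).im
      = -(2 * dirichletConst) + dirichletConst * (Real.sign cp - Real.sign cm) / b := by
    simp [linearValue, powerValue]; ring
  rw [this]
  have h1 : dirichletConst * (Real.sign cp - Real.sign cm) / b ≤ 2 * dirichletConst * (1 / b₀) := by
    rw [div_le_iff₀ hb0]
    have h2 := (abs_le.1 (abs_sign_sub_sign_le cp cm)).2
    have h3 : 1 ≤ 1 / b₀ * b := by rw [div_mul_eq_mul_div, one_mul, le_div_iff₀ (by linarith)]; linarith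
    calc _ ≤ dirichletConst * 2 := by gcongr
      _ ≤ dirichletConst * 2 * (1 / b₀ * b) := le_mul_of_one_le_right (by positivity) h3
      _ = _ := by ring
  refine le_trans ?_ (neg_le_abs _)
  linarith

theorem norm_powerValue_le {b r₀ r₁ cp cm : ℝ} (hb : 1 < b) (hr₀ : 0 < r₀)
    (hr : |cp / cm| ∈ Icc r₀ r₁) :
    ‖powerValue b cp cm‖ ≤ |Real.log r₀| + |Real.log r₁| + 2 * dirichletConst := by
  have hD := dirichletConst_pos
  have hb0 : 0 < b := by linarith
  have hdiv : ∀ x : ℝ, |x / b| ≤ |x| := fun x => by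
    rw [abs_div, abs_of_pos hb0]; exact div_le_self (abs_nonneg _) hb.le
  refine (norm_add_le _ _).trans (add_le_add ?_ ?_)
  · rw [Complex.norm_real, Real.norm_eq_abs]
    refine (hdiv _).trans ?_
    rw [← abs_div, ← inv_div, abs_inv, Real.log_inv, abs_neg]
    have h0 : 0 < |cp / cm| := hr₀.trans_le hr.1
    have h1 := Real.log_le_log hr₀ hr.1
    have h2 := Real.log_le_log h0 hr.2
    refine abs_le.2 ⟨?_, ?_⟩
    · linarith [neg_abs_le (Real.log r₀), abs_nonneg (Real.log r₁)]
    · linarith [le_abs_self (Real.log r₁), abs_nonneg (Real.log r₀)]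
  · rw [norm_mul, Complex.norm_I, mul_one, Complex.norm_real, Real.norm_eq_abs]
    refine (hdiv _).trans ?_
    rw [abs_neg, abs_mul, abs_of_pos hD, mul_comm]
    exact mul_le_mul_of_nonneg_right (abs_sign_sub_sign_le _ _) hD.le

/-! ### Existence and linearity of the principal value. -/

/-- The curve `t ↦ (x₁ - t, x₂ - u γ_b(t))`. -/
def curvePoint (b cp cm u : ℝ) (x : Plane) (t : ℝ) : Plane :=
  !₂[x 0 - t, x 1 - u * homGamma b cp cm t]

theorem homGamma_eq {b : ℝ} (hb : 0 < b) (cp cm t : ℝ) :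
    homGamma b cp cm t = cp * (max t 0) ^ b + cm * (max (-t) 0) ^ b := by
  unfold homGamma
  split_ifs with h
  · rw [max_eq_left h.le, max_eq_right (by linarith), Real.zero_rpow hb.ne', mul_zero, add_zero]
  · rw [max_eq_right (by linarith), max_eq_left (by linarith), Real.zero_rpow hb.ne', mul_zero,
      zero_add]

theorem continuous_homGamma {b : ℝ} (hb : 0 < b) (cp cm : ℝ) : Continuous (homGamma b cp cm) := by
  rw [show homGamma b cp cm = fun t => cp * (max t 0) ^ b + cm * (max (-t) 0) ^ b from
    funext (homGamma_eq hb cp cm)]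
  exact (((Real.continuous_rpow_const hb.le).comp (continuous_id.max continuous_const)).const_mul
    _).add (((Real.continuous_rpow_const hb.le).comp
      (continuous_neg.max continuous_const)).const_mul _)

theorem continuous_curvePoint {b : ℝ} (hb : 0 < b) (cp cm u : ℝ) (x : Plane) :
    Continuous (curvePoint b cp cm u x) := by
  have := continuous_homGamma hb cp cm
  unfold curvePoint
  refine (PiLp.continuous_toLp 2 _).comp (continuous_pi fun i => ?_)
  fin_cases i
  · exact continuous_const.sub continuous_id
  · exact continuous_const.sub (this.const_mul u)

theorem abs_homGamma_le {b cp cm t : ℝ} (hb : 1 < b) (ht : |t| ≤ 1) :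
    |homGamma b cp cm t| ≤ (|cp| + |cm|) * |t| := by
  have h : ∀ s : ℝ, 0 ≤ s → s ≤ 1 → s ^ b ≤ s := fun s h0 h1 => by
    simpa using Real.rpow_le_rpow_of_exponent_ge' h0 h1 zero_le_one hb.le
  unfold homGamma
  split_ifs with h0
  · rw [abs_mul, abs_of_nonneg (a := t ^ b) (by positivity), abs_of_pos h0]
    rw [abs_of_pos h0] at ht
    exact mul_le_mul (by linarith [abs_nonneg cm]) (h t h0.le ht) (by positivity) (by positivity)
  · have h0' : 0 ≤ -t := by linarith
    rw [← abs_neg t, abs_of_nonneg h0'] at ht ⊢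
    rw [abs_mul, abs_of_nonneg (a := (-t) ^ b) (by positivity)]
    exact mul_le_mul (by linarith [abs_nonneg cp]) (h _ h0' ht) (by positivity) (by positivity)

theorem norm_plane_le (a c : ℝ) : ‖(!₂[a, c] : Plane)‖ ≤ |a| + |c| := by
  rw [EuclideanSpace.norm_eq, Fin.sum_univ_two]
  refine Real.sqrt_le_iff.2 ⟨by positivity, ?_⟩
  simp only [Real.norm_eq_abs, Matrix.cons_val_zero, Matrix.cons_val_one]
  nlinarith [mul_nonneg (abs_nonneg a) (abs_nonneg c)]

theorem norm_curvePoint_sub_le {b cp cm u t : ℝ} (hb : 1 < b) (hu : 0 < u) (x : Plane)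
    (ht : |t| ≤ 1) :
    ‖curvePoint b cp cm u x t - x‖ ≤ (1 + u * (|cp| + |cm|)) * |t| := by
  have : curvePoint b cp cm u x t - x = !₂[-t, -(u * homGamma b cp cm t)] := by
    ext i; fin_cases i <;> simp [curvePoint]
  rw [this]
  refine (norm_plane_le _ _).trans ?_
  rw [abs_neg, abs_neg, abs_mul, abs_of_pos hu, add_mul, one_mul, mul_assoc]
  gcongr
  exact abs_homGamma_le hb ht

theorem abs_apply_le_norm (y : Plane) (i : Fin 2) : |y i| ≤ ‖y‖ := by
  simpa using PiLp.norm_apply_le y i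

/-- Decay in the first coordinate suffices for integrability along the curve, because that
coordinate is x₁ - t. -/
theorem SchwartzMap.exists_decay_fst (f : 𝓢(Plane, ℂ)) :
    ∃ C ≥ 0, ∀ y, ‖f y‖ ≤ C * (1 + (y 0) ^ 2)⁻¹ := by
  obtain ⟨C₀, hC0, h₀⟩ := f.decay 0 0
  obtain ⟨C₂, hC2, h₂⟩ := f.decay 2 0
  refine ⟨C₀ + C₂, by positivity, fun y => ?_⟩
  have e0 := h₀ y
  have e2 := h₂ y
  simp only [norm_iteratedFDeriv_zero, pow_zero, one_mul] at e0 e2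
  rw [← div_eq_mul_inv, le_div_iff₀ (by positivity)]
  have : (y 0) ^ 2 ≤ ‖y‖ ^ 2 := sq_le_sq.2 (by rw [abs_norm]; exact abs_apply_le_norm y 0)
  nlinarith [norm_nonneg (f y)]

theorem SchwartzMap.exists_lipschitz (f : 𝓢(Plane, ℂ)) :
    ∃ L ≥ 0, ∀ x y, ‖f y - f x‖ ≤ L * ‖y - x‖ := by
  obtain ⟨C, hC, h⟩ := f.decay 0 1
  refine ⟨C, hC.le, fun x y => Convex.norm_image_sub_le_of_norm_fderiv_le (𝕜 := ℝ) (s := univ)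
    (fun z _ => f.differentiableAt) (fun z _ => ?_) convex_univ (mem_univ _) (mem_univ _)⟩
  have := h z
  rwa [pow_zero, one_mul, norm_iteratedFDeriv_one] at this

theorem integrable_inv_one_add_sub_sq (a : ℝ) :
    Integrable (fun t : ℝ => (1 + (a - t) ^ 2)⁻¹) :=
  integrable_inv_one_add_sq.comp_sub_left a

theorem measurableSet_truncation (ε : ℝ) : MeasurableSet {t : ℝ | ε < |t|} :=
  (isOpen_lt continuous_const continuous_abs).measurableSet

theorem measurable_hilbertIntegrand {b : ℝ} (hb : 0 < b) (cp cm u : ℝ) (f : 𝓢(Plane, ℂ))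
    (x : Plane) : Measurable (hilbertIntegrand b cp cm u f x) :=
  ((f.continuous.comp (continuous_curvePoint hb cp cm u x)).measurable).div
    Complex.measurable_ofReal

theorem integrableOn_hilbertIntegrand {b : ℝ} (hb : 0 < b) (cp cm u : ℝ) (f : 𝓢(Plane, ℂ))
    (x : Plane) {ε : ℝ} (hε : 0 < ε) :
    IntegrableOn (hilbertIntegrand b cp cm u f x) {t : ℝ | ε < |t|} := by
  obtain ⟨C, hC0, hC⟩ := f.exists_decay_fst
  refine Integrable.mono' (((integrable_inv_one_add_sub_sq (x 0)).const_mul (C / ε)).integrableOn)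
    (measurable_hilbertIntegrand hb cp cm u f x).aestronglyMeasurable ?_
  refine (ae_restrict_iff' (measurableSet_truncation ε)).2 (Eventually.of_forall fun t ht => ?_)
  have ht' : ε < |t| := ht
  have h1 := hC (curvePoint b cp cm u x t)
  have h2 : (curvePoint b cp cm u x t) 0 = x 0 - t := by simp [curvePoint]
  rw [h2] at h1
  have h3 : hilbertIntegrand b cp cm u f x t = f (curvePoint b cp cm u x t) / t := rfl
  rw [h3, norm_div, Complex.norm_real, Real.norm_eq_abs]
  calc _ ≤ C * (1 + (x 0 - t) ^ 2)⁻¹ / ε := by gcongr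
    _ = _ := by ring

/-- The regularised integrand, which is absolutely integrable. -/
def regularIntegrand (b cp cm u : ℝ) (f : 𝓢(Plane, ℂ)) (x : Plane) (t : ℝ) : ℂ :=
  hilbertIntegrand b cp cm u f x t - (Icc (-1 : ℝ) 1).indicator (fun t : ℝ => f x / (t : ℂ)) t

theorem integrable_regularIntegrand {b : ℝ} (hb : 1 < b) (cp cm : ℝ) {u : ℝ} (hu : 0 < u)
    (f : 𝓢(Plane, ℂ)) (x : Plane) : Integrable (regularIntegrand b cp cm u f x) := by
  obtain ⟨C, hC0, hC⟩ := f.exists_decay_fst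
  obtain ⟨L, hL0, hL⟩ := f.exists_lipschitz
  set D := L * (1 + u * (|cp| + |cm|)) with hD
  have hD0 : 0 ≤ D := by positivity
  have hind : Integrable ((Icc (-1 : ℝ) 1).indicator fun _ => D) :=
    (integrable_indicator_iff measurableSet_Icc).2 (integrableOn_const (by simp) (by simp))
  refine Integrable.mono' (hind.add ((integrable_inv_one_add_sub_sq (x 0)).const_mul C))
    ((measurable_hilbertIntegrand (by linarith) cp cm u f x).sub
      ((measurable_const.div Complex.measurable_ofReal).indicator
        measurableSet_Icc)).aestronglyMeasurable (Eventually.of_forall fun t => ?_)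
  have h3 : hilbertIntegrand b cp cm u f x t = f (curvePoint b cp cm u x t) / t := rfl
  by_cases ht : t ∈ Icc (-1 : ℝ) 1
  · simp only [regularIntegrand, Pi.add_apply, indicator_of_mem ht, h3]
    rw [← sub_div, norm_div, Complex.norm_real, Real.norm_eq_abs]
    have h4 : ‖f (curvePoint b cp cm u x t) - f x‖ / |t| ≤ D := by
      refine div_le_of_le_mul₀ (abs_nonneg _) hD0 ((hL _ _).trans ?_)
      rw [hD, mul_assoc]
      gcongr
      exact norm_curvePoint_sub_le hb hu x (abs_le.2 ht)
    have : 0 ≤ C * (1 + (x 0 - t) ^ 2)⁻¹ := by positivity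
    linarith
  · simp only [regularIntegrand, Pi.add_apply, indicator_of_notMem ht, h3, sub_zero, zero_add]
    have ht1 : 1 ≤ |t| := by
      by_contra hcon
      exact ht (abs_le.1 (not_le.1 hcon).le)
    have h1 := hC (curvePoint b cp cm u x t)
    have h2 : (curvePoint b cp cm u x t) 0 = x 0 - t := by simp [curvePoint]
    rw [h2] at h1
    rw [norm_div, Complex.norm_real, Real.norm_eq_abs]
    exact (div_le_self (norm_nonneg _) ht1).trans h1

/-- The subtracted term f(x)/t on [-1, 1] is odd, so it integrates to zero over every symmetric
truncation; the limit ε → 0 then follows by dominated convergence. -/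
theorem truncatedHilbert_eq {b : ℝ} (hb : 1 < b) (cp cm : ℝ) {u : ℝ} (hu : 0 < u)
    (f : 𝓢(Plane, ℂ)) (x : Plane) {ε : ℝ} (hε : 0 < ε) :
    truncatedHilbert b cp cm u f x ε = ∫ t in {t : ℝ | ε < |t|}, regularIntegrand b cp cm u f x t := by
  have h1 := integrableOn_hilbertIntegrand (by linarith : 0 < b) cp cm u f x hε
  have h2 := (integrable_regularIntegrand hb cp cm hu f x).integrableOn (s := {t : ℝ | ε < |t|})
  have h3 : ∫ t in {t : ℝ | ε < |t|}, (Icc (-1 : ℝ) 1).indicator (fun t : ℝ => f x / (t : ℂ)) t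
      = 0 := by
    rw [← integral_indicator (measurableSet_truncation ε)]
    set g := {t : ℝ | ε < |t|}.indicator ((Icc (-1 : ℝ) 1).indicator fun t : ℝ => f x / (t : ℂ))
    have hodd : ∀ t, g (-t) = -g t := fun t => by
      have : -t ∈ Icc (-1 : ℝ) 1 ↔ t ∈ Icc (-1 : ℝ) 1 := by
        rw [mem_Icc, mem_Icc, ← abs_le, ← abs_le, abs_neg]
      simp only [g, indicator_apply, mem_ofPred_eq, abs_neg, this, Complex.ofReal_neg, div_neg]
      split_ifs <;> simp
    have := integral_neg_eq_self g volume
    simp only [hodd, integral_neg] at this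
    exact self_eq_neg.1 this.symm
  have h4 : regularIntegrand b cp cm u f x = fun t => hilbertIntegrand b cp cm u f x t -
    (Icc (-1 : ℝ) 1).indicator (fun t : ℝ => f x / (t : ℂ)) t := rfl
  rw [h4, integral_sub h1 ?_, h3, sub_zero, truncatedHilbert]
  have h5 := h1.sub h2
  refine h5.congr (Eventually.of_forall fun t => ?_)
  simp [regularIntegrand]

theorem tendsto_truncatedHilbert {b : ℝ} (hb : 1 < b) (cp cm : ℝ) {u : ℝ} (hu : 0 < u)
    (f : 𝓢(Plane, ℂ)) (x : Plane) :
    Tendsto (truncatedHilbert b cp cm u f x) (𝓝[>] (0 : ℝ)) (𝓝 (curveHilbert b cp cm u f x)) := by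
  refine tendsto_nhds_limUnder ⟨∫ t, regularIntegrand b cp cm u f x t, ?_⟩
  have hi := integrable_regularIntegrand hb cp cm hu f x
  have : Tendsto (fun ε : ℝ => ∫ t, {t : ℝ | ε < |t|}.indicator (regularIntegrand b cp cm u f x) t)
      (𝓝[>] 0) (𝓝 (∫ t, regularIntegrand b cp cm u f x t)) := by
    refine tendsto_integral_filter_of_dominated_convergence
      (fun t => ‖regularIntegrand b cp cm u f x t‖) (Eventually.of_forall fun ε =>
        hi.aestronglyMeasurable.indicator (measurableSet_truncation ε))
      (Eventually.of_forall fun ε => Eventually.of_forall fun t =>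
        norm_indicator_le_norm_self _ _) hi.norm ?_
    have h0 : ∀ᵐ t : ℝ, t ≠ 0 := by simp [ae_iff]
    filter_upwards [h0] with t ht
    refine tendsto_const_nhds.congr' ?_
    filter_upwards [mem_nhdsWithin_of_mem_nhds (Iio_mem_nhds (abs_pos.2 ht))] with ε hε
    rw [indicator_of_mem (show t ∈ {t : ℝ | ε < |t|} from hε)]
  refine this.congr' ?_
  filter_upwards [self_mem_nhdsWithin] with ε hε
  rw [integral_indicator (measurableSet_truncation ε), truncatedHilbert_eq hb cp cm hu f x hε]

theorem curveHilbert_add {b : ℝ} (hb : 1 < b) (cp cm : ℝ) {u : ℝ} (hu : 0 < u)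
    (f g : 𝓢(Plane, ℂ)) (x : Plane) :
    curveHilbert b cp cm u (f + g) x = curveHilbert b cp cm u f x + curveHilbert b cp cm u g x := by
  refine tendsto_nhds_unique (tendsto_truncatedHilbert hb cp cm hu (f + g) x) ?_
  refine ((tendsto_truncatedHilbert hb cp cm hu f x).add
    (tendsto_truncatedHilbert hb cp cm hu g x)).congr' ?_
  filter_upwards [self_mem_nhdsWithin] with ε hε
  have hb0 : 0 < b := by linarith
  rw [truncatedHilbert, truncatedHilbert, truncatedHilbert,
    ← integral_add (integrableOn_hilbertIntegrand hb0 cp cm u f x hε)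
      (integrableOn_hilbertIntegrand hb0 cp cm u g x hε)]
  congr 1; ext t
  simp [hilbertIntegrand, add_div]

theorem curveHilbert_smul {b : ℝ} (hb : 1 < b) (cp cm : ℝ) {u : ℝ} (hu : 0 < u)
    (c : ℂ) (f : 𝓢(Plane, ℂ)) (x : Plane) :
    curveHilbert b cp cm u (c • f) x = c * curveHilbert b cp cm u f x := by
  refine tendsto_nhds_unique (tendsto_truncatedHilbert hb cp cm hu (c • f) x) ?_
  refine ((tendsto_truncatedHilbert hb cp cm hu f x).const_mul c).congr' ?_
  filter_upwards with ε
  rw [truncatedHilbert, truncatedHilbert, ← integral_const_mul]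
  congr 1; ext t
  simp [hilbertIntegrand, mul_div_assoc]

/-! ### Action of the operators on highly modulated functions. -/

/-- Oscillatory integral with an amplitude: only the value of the amplitude at the origin matters
if the phase oscillates rapidly away from the origin. -/
theorem norm_integral_amplitude_sub_le {b α β a τ N L κ : ℝ} {F F' : ℝ → ℂ} {z : ℂ}
    (ha : 0 < a) (haτ : a ≤ τ) (hτN : τ ≤ N) (hκ : 0 ≤ κ) (hL : 0 ≤ L)
    (hF1 : ∀ t ∈ Ioc 0 N, ‖F t‖ ≤ 1) (hFz : ∀ t ∈ Ioc 0 N, ‖F t - z‖ ≤ L * t)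
    (hFc : ContinuousOn F (Ioc 0 N))
    (hd : ∀ t ∈ Icc τ N, HasDerivAt F (F' t) t) (hF' : ∀ t ∈ Icc τ N, ‖F' t‖ ≤ L)
    (hF'c : ContinuousOn F' (Icc τ N))
    (hosc : ∀ s ∈ Icc τ N, ‖oscInt b α β τ s‖ ≤ κ) :
    ‖(∫ t in a..N, F t * (Complex.exp (((α * t + β * t ^ b : ℝ) : ℂ) * Complex.I) / t))
        - z * oscInt b α β a τ‖ ≤ L * τ + κ * (1 + L * N) := by
  have hτ : 0 < τ := ha.trans_le haτ
  have hN : 0 < N := hτ.trans_le hτN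
  set e : ℝ → ℂ := fun t => Complex.exp (((α * t + β * t ^ b : ℝ) : ℂ) * Complex.I) / t with he
  have hec : ContinuousOn e (Ioi 0) := continuousOn_oscInt b α β
  have hi : ∀ c d : ℝ, 0 < c → c ≤ d → d ≤ N → IntervalIntegrable (fun t => F t * e t) volume c d :=
    fun c d hc hcd hd => by
      refine ContinuousOn.intervalIntegrable ?_
      rw [uIcc_of_le hcd]
      exact (hFc.mono fun t ht => ⟨hc.trans_le ht.1, ht.2.trans hd⟩).mul
        (hec.mono fun t ht => hc.trans_le ht.1)
  rw [← intervalIntegral.integral_add_adjacent_intervals (hi a τ ha haτ hτN) (hi τ N hτ hτN le_rfl)]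
  -- On [a, τ] the amplitude is frozen at z, and the Lipschitz bound cancels the 1/t, at cost Lτ. On
  -- [τ, N] one integrates by parts against the primitive of the oscillating factor, which is
  -- bounded by κ.
  have e1 : (∫ t in a..τ, F t * e t) - z * oscInt b α β a τ = ∫ t in a..τ, (F t - z) * e t := by
    rw [oscInt, ← intervalIntegral.integral_const_mul, ← intervalIntegral.integral_sub
      (hi a τ ha haτ hτN) ((intervalIntegrable_oscInt b α β ha hτ).const_mul z)]
    refine intervalIntegral.integral_congr fun t _ => ?_
    simp only [he]; ring
  have b1 : ‖∫ t in a..τ, (F t - z) * e t‖ ≤ L * τ := by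
    refine (intervalIntegral.norm_integral_le_of_norm_le_const (C := L) fun t ht => ?_).trans ?_
    · rw [uIoc_of_le haτ] at ht
      have ht0 : 0 < t := ha.trans ht.1
      rw [norm_mul, he, norm_div, Complex.norm_exp_ofReal_mul_I, Complex.norm_real,
        Real.norm_of_nonneg ht0.le, mul_one_div, div_le_iff₀ ht0]
      exact hFz t ⟨ht0, ht.2.trans hτN⟩
    · rw [abs_of_nonneg (sub_nonneg.2 haτ)]
      gcongr; linarith
  have hId : ∀ t ∈ uIcc τ N, HasDerivAt (fun s => oscInt b α β τ s) (e t) t := fun t ht => by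
    have ht0 : 0 < t := uIcc_subset_Ioi hτ hN ht
    exact intervalIntegral.integral_hasDerivAt_right (intervalIntegrable_oscInt b α β hτ ht0)
      (hec.stronglyMeasurableAtFilter isOpen_Ioi t ht0) (hec.continuousAt (Ioi_mem_nhds ht0))
  have hib := intervalIntegral.integral_mul_deriv_eq_deriv_mul (a := τ) (b := N) (u := F)
    (v := fun s => oscInt b α β τ s) (u' := F') (v' := e)
    (fun t ht => hd t (uIcc_of_le hτN ▸ ht)) hId
    (ContinuousOn.intervalIntegrable (uIcc_of_le hτN ▸ hF'c))
    ((intervalIntegrable_oscInt b α β hτ hN))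
  have h0 : oscInt b α β τ τ = 0 := intervalIntegral.integral_same
  simp only [h0, mul_zero, sub_zero] at hib
  have b2 : ‖∫ t in τ..N, F t * e t‖ ≤ κ * (1 + L * N) := by
    rw [hib]
    have c1 : ‖F N * oscInt b α β τ N‖ ≤ 1 * κ := by
      rw [norm_mul]
      exact mul_le_mul (hF1 N ⟨hN, le_rfl⟩) (hosc N ⟨hτN, le_rfl⟩) (norm_nonneg _) zero_le_one
    have c2 : ‖∫ t in τ..N, F' t * oscInt b α β τ t‖ ≤ L * κ * N := by
      refine (intervalIntegral.norm_integral_le_of_norm_le_const (C := L * κ)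
        fun t ht => ?_).trans ?_
      · rw [uIoc_of_le hτN] at ht
        have ht' : t ∈ Icc τ N := ⟨ht.1.le, ht.2⟩
        rw [norm_mul]
        exact mul_le_mul (hF' t ht') (hosc t ht') (norm_nonneg _) hL
      · rw [abs_of_nonneg (sub_nonneg.2 hτN)]
        gcongr; linarith
    calc _ ≤ 1 * κ + L * κ * N := (norm_sub_le _ _).trans (add_le_add c1 c2)
      _ = _ := by ring
  calc _ = ‖(∫ t in a..τ, (F t - z) * e t) + ∫ t in τ..N, F t * e t‖ := by rw [← e1]; congr 1; ring
    _ ≤ _ := (norm_add_le _ _).trans (add_le_add b1 b2)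

/-- The half curve `t ↦ (x₁ + s t, x₂ - v t ^ b)`. -/
def halfCurve (b s v : ℝ) (x : Plane) (t : ℝ) : Plane := !₂[x 0 + s * t, x 1 - v * t ^ b]

theorem halfCurve_eq (b s v : ℝ) (x : Plane) (t : ℝ) :
    halfCurve b s v x t = x + (s * t) • (!₂[1, 0] : Plane) + (-(v * t ^ b)) • (!₂[0, 1] : Plane) := by
  ext i; fin_cases i <;> simp [halfCurve, sub_eq_add_neg]

/-- For ‖x‖ ≤ r and |t| > 2r the first coordinate of the curve has left the support of f, which cuts
the integral at N. The substitution t ↦ -t turns the negative half line into the second term, with a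
sign from 1/t. -/
theorem truncatedHilbert_eq_halfCurve {b cp cm u r N : ℝ} (hb : 0 < b) (f : 𝓢(Plane, ℂ))
    {x : Plane} (hf : ∀ y, r < ‖y‖ → f y = 0) (hx : ‖x‖ ≤ r) (hN : 2 * r ≤ N) {ε : ℝ}
    (hε : 0 < ε) (hεN : ε ≤ N) :
    truncatedHilbert b cp cm u f x ε = (∫ t in ε..N, f (halfCurve b (-1) (u * cp) x t) / (t : ℂ))
      - ∫ t in ε..N, f (halfCurve b 1 (u * cm) x t) / (t : ℂ) := by
  set h := hilbertIntegrand b cp cm u f x with hh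
  have hset : {t : ℝ | ε < |t|} = Iio (-ε) ∪ Ioi ε := by
    ext t; simp only [mem_ofPred_eq, lt_abs, mem_union, mem_Iio, mem_Ioi]
    rw [or_comm, lt_neg]
  have hint := integrableOn_hilbertIntegrand hb cp cm u f x hε
  rw [hset] at hint
  have hfar : ∀ s v t : ℝ, |s| = 1 → N < t → f (halfCurve b s v x t) = 0 := by
    intro s v t hs ht
    refine hf _ (lt_of_lt_of_le ?_ (abs_apply_le_norm _ 0))
    have h1 : (halfCurve b s v x t) 0 = s * t - -x 0 := by simp [halfCurve]; ring
    have hr : 0 ≤ r := (norm_nonneg _).trans hx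
    have h2 := abs_sub_abs_le_abs_sub (s * t) (-x 0)
    rw [abs_neg, abs_mul, hs, one_mul, abs_of_pos (by linarith)] at h2
    rw [h1]
    have := (abs_apply_le_norm x 0).trans hx
    linarith
  have key : ∀ s v : ℝ, |s| = 1 → ∫ t in Ioi ε, f (halfCurve b s v x t) / (t : ℂ) =
      ∫ t in ε..N, f (halfCurve b s v x t) / (t : ℂ) := by
    intro s v hs
    rw [intervalIntegral.integral_of_le hεN]
    refine (setIntegral_eq_of_subset_of_forall_sdiff_eq_zero measurableSet_Ioi
      Ioc_subset_Ioi_self fun t ht => ?_)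
    have : N < t := by
      by_contra hcon
      exact ht.2 ⟨ht.1, not_lt.1 hcon⟩
    rw [hfar s v t hs this, zero_div]
  have hdisj : Disjoint (Iio (-ε)) (Ioi ε) := by
    rw [Set.disjoint_left]; intro t ht ht2
    simp only [mem_Iio, mem_Ioi] at ht ht2; linarith
  have hpos : ∀ t ∈ Ioi ε, h t = f (halfCurve b (-1) (u * cp) x t) / (t : ℂ) := by
    intro t ht
    have ht0 : 0 < t := hε.trans ht
    simp only [hh, hilbertIntegrand, halfCurve, homGamma, if_pos ht0]
    rw [show x 0 + -1 * t = x 0 - t by ring, mul_assoc]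
  have hneg : ∀ t ∈ Ioi ε, h (-t) = -(f (halfCurve b 1 (u * cm) x t) / (t : ℂ)) := by
    intro t ht
    have ht0 : 0 < t := hε.trans ht
    simp only [hh, hilbertIntegrand, halfCurve, homGamma, if_neg (not_lt.2 (neg_nonpos.2 ht0.le)),
      neg_neg, sub_neg_eq_add, one_mul]
    rw [mul_assoc, Complex.ofReal_neg, div_neg]
  rw [truncatedHilbert, hset, setIntegral_union hdisj measurableSet_Ioi
    (hint.mono_set subset_union_left) (hint.mono_set subset_union_right),
    setIntegral_congr_fun measurableSet_Ioi hpos, key _ _ (by simp), ← integral_Iic_eq_integral_Iio,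
    ← integral_comp_neg_Ioi, setIntegral_congr_fun measurableSet_Ioi hneg, integral_neg,
    key _ _ (by simp)]
  ring

/-- The modulated amplitude along a half curve. -/
theorem norm_integral_halfCurve_sub_le {b s v ρ σ a τ N L M κ : ℝ} (hb : 1 < b) (hs : |s| = 1)
    {G : Plane → ℝ} (hG : ContDiff ℝ 1 G) (hG1 : ∀ y, ‖G y‖ ≤ 1) (hM : 0 ≤ M)
    (hGM : ∀ y, ‖fderiv ℝ G y‖ ≤ M)
    {f : 𝓢(Plane, ℂ)} (hf : ∀ y, f y =
      G y * Complex.exp (((ρ * y 0 + σ * y 1 : ℝ) : ℂ) * Complex.I))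
    (x : Plane) (ha : 0 < a) (haτ : a ≤ τ) (hτN : τ ≤ N) (hκ : 0 ≤ κ)
    (hL : M * (1 + |v| * (b * N ^ (b - 1))) ≤ L)
    (hosc : ∀ t ∈ Icc τ N, ‖oscInt b (s * ρ) (-(σ * v)) τ t‖ ≤ κ) :
    ‖(∫ t in a..N, f (halfCurve b s v x t) / (t : ℂ)) - f x * oscInt b (s * ρ) (-(σ * v)) a τ‖
      ≤ L * τ + κ * (1 + L * N) := by
  have hτ : 0 < τ := ha.trans_le haτ
  have hN : 0 < N := hτ.trans_le hτN
  have hb0 : 0 < b := by linarith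
  have hL0 : 0 ≤ L := le_trans (by positivity) hL
  set c := Complex.exp (((ρ * x 0 + σ * x 1 : ℝ) : ℂ) * Complex.I) with hc
  have hcn : ‖c‖ = 1 := Complex.norm_exp_ofReal_mul_I _
  set F : ℝ → ℂ := fun t => (G (halfCurve b s v x t) : ℂ) with hF
  set w : ℝ → Plane := fun t => s • (!₂[1, 0] : Plane) + (-(v * (b * t ^ (b - 1)))) • (!₂[0, 1] : Plane)
    with hw
  have he0 : ‖(!₂[1, 0] : Plane)‖ ≤ 1 := by simpa using norm_plane_le 1 0
  have he1 : ‖(!₂[0, 1] : Plane)‖ ≤ 1 := by simpa using norm_plane_le 0 1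
  have hpow : ∀ t ∈ Ioc 0 N, t ^ (b - 1) ≤ N ^ (b - 1) := fun t ht =>
    Real.rpow_le_rpow ht.1.le ht.2 (by linarith)
  have hwn : ∀ t ∈ Ioc 0 N, ‖w t‖ ≤ 1 + |v| * (b * N ^ (b - 1)) := by
    intro t ht
    refine (norm_add_le _ _).trans (add_le_add ?_ ?_)
    · rw [norm_smul, Real.norm_eq_abs, hs, one_mul]; exact he0
    · rw [norm_smul, norm_neg, norm_mul, Real.norm_eq_abs v,
        Real.norm_of_nonneg (mul_nonneg hb0.le (Real.rpow_nonneg ht.1.le _))]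
      have := hpow t ht
      have h3 : 0 ≤ b * t ^ (b - 1) := mul_nonneg hb0.le (Real.rpow_nonneg ht.1.le _)
      calc _ ≤ |v| * (b * t ^ (b - 1)) * 1 := by gcongr
        _ ≤ _ := by rw [mul_one]; gcongr
  have hcd : ∀ t : ℝ, 0 < t → HasDerivAt (halfCurve b s v x) (w t) t := by
    intro t ht
    rw [show halfCurve b s v x = fun t => x + (s * t) • (!₂[1, 0] : Plane)
      + (-(v * t ^ b)) • (!₂[0, 1] : Plane) from funext (halfCurve_eq b s v x)]
    have h1 := (((hasDerivAt_id t).const_mul s).smul_const (!₂[1, 0] : Plane)).const_add x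
    have h2 := (((Real.hasDerivAt_rpow_const (p := b) (Or.inl ht.ne')).const_mul v).neg).smul_const
      (!₂[0, 1] : Plane)
    refine (h1.add h2).congr_deriv ?_
    simp only [hw, mul_one]
  have hGd : Differentiable ℝ G := hG.differentiable (by norm_num)
  set F' : ℝ → ℂ := fun t => ((fderiv ℝ G (halfCurve b s v x t) (w t) : ℝ) : ℂ) with hF'
  have hFd : ∀ t : ℝ, 0 < t → HasDerivAt F (F' t) t := fun t ht =>
    ((hGd _).hasFDerivAt.comp_hasDerivAt t (hcd t ht)).ofReal_comp
  have hcc : ContinuousOn (halfCurve b s v x) (Ioi 0) := fun t ht =>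
    (hcd t ht).continuousAt.continuousWithinAt
  have hwc : ContinuousOn w (Ioi 0) := by
    refine continuousOn_const.add (ContinuousOn.smul (ContinuousOn.neg (continuousOn_const.mul
      (continuousOn_const.mul (continuousOn_id.rpow_const fun t ht => Or.inl (ne_of_gt ht)))))
      continuousOn_const)
  have hmain := norm_integral_amplitude_sub_le (b := b) (α := s * ρ) (β := -(σ * v)) (L := L)
    (F := F) (F' := F') (z := (G x : ℂ)) ha haτ hτN hκ hL0 ?_ ?_ ?_ ?_ ?_ ?_ hosc
  · have e1 : (∫ t in a..N, f (halfCurve b s v x t) / (t : ℂ)) =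
        c * ∫ t in a..N, F t * (Complex.exp (((s * ρ * t + -(σ * v) * t ^ b : ℝ) : ℂ) * Complex.I)
          / t) := by
      rw [← intervalIntegral.integral_const_mul]
      refine intervalIntegral.integral_congr fun t _ => ?_
      have : Complex.exp (((ρ * (halfCurve b s v x t) 0 + σ * (halfCurve b s v x t) 1 : ℝ) : ℂ)
          * Complex.I) = c * Complex.exp (((s * ρ * t + -(σ * v) * t ^ b : ℝ) : ℂ) * Complex.I) := by
        rw [hc, ← Complex.exp_add, ← add_mul, ← Complex.ofReal_add]
        congr 3
        simp [halfCurve]; ring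
      simp only [hf, this, hF]
      ring
    have e2 : f x = c * (G x : ℂ) := by rw [hf x, mul_comm]
    rw [e1, e2, mul_assoc, ← mul_sub, norm_mul, hcn, one_mul]
    exact hmain
  · intro t _
    rw [hF, Complex.norm_real]; exact hG1 _
  · intro t ht
    have h1 : ‖G (halfCurve b s v x t) - G x‖ ≤ M * ‖halfCurve b s v x t - x‖ :=
      Convex.norm_image_sub_le_of_norm_fderiv_le (𝕜 := ℝ) (s := univ) (fun z _ => hGd z)
        (fun z _ => hGM z) convex_univ (mem_univ _) (mem_univ _)
    have h2 : ‖halfCurve b s v x t - x‖ ≤ (1 + |v| * (b * N ^ (b - 1))) * t := by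
      rw [halfCurve_eq, add_assoc, add_sub_cancel_left]
      have hpos : 0 ≤ t ^ b := Real.rpow_nonneg ht.1.le _
      have hp1 : 0 ≤ t ^ (b - 1) := Real.rpow_nonneg ht.1.le _
      have htb : t ^ b = t ^ (b - 1) * t := by
        rw [← Real.rpow_add_one ht.1.ne']; congr 1; ring
      refine (norm_add_le _ _).trans ?_
      rw [norm_smul, norm_smul, norm_neg, norm_mul, norm_mul, Real.norm_eq_abs s, hs, one_mul,
        Real.norm_of_nonneg ht.1.le, Real.norm_of_nonneg hpos, Real.norm_eq_abs v, htb, add_mul]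
      have := hpow t ht
      refine add_le_add (by nlinarith [ht.1]) ?_
      have h5 : t ^ (b - 1) ≤ b * N ^ (b - 1) := by nlinarith
      have ht0 := ht.1.le
      calc _ ≤ |v| * (t ^ (b - 1) * t) * 1 := by gcongr
        _ = |v| * t ^ (b - 1) * t := by ring
        _ ≤ _ := by gcongr
    rw [hF, ← Complex.ofReal_sub, Complex.norm_real]
    calc _ ≤ M * ((1 + |v| * (b * N ^ (b - 1))) * t) := h1.trans (by gcongr)
      _ = M * (1 + |v| * (b * N ^ (b - 1))) * t := by ring
      _ ≤ L * t := mul_le_mul_of_nonneg_right hL ht.1.le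
  · exact fun t ht => (hFd t ht.1).continuousAt.continuousWithinAt
  · exact fun t ht => hFd t (hτ.trans_le ht.1)
  · intro t ht
    rw [hF', Complex.norm_real]
    refine (ContinuousLinearMap.le_opNorm _ _).trans (le_trans ?_ hL)
    exact mul_le_mul (hGM _) (hwn t ⟨hτ.trans_le ht.1, ht.2⟩) (norm_nonneg _) hM
  · have hsub : Icc τ N ⊆ Ioi 0 := fun t ht => hτ.trans_le ht.1
    exact Complex.continuous_ofReal.comp_continuousOn
      (((hG.continuous_fderiv (by norm_num)).comp_continuousOn (hcc.mono hsub)).clm_apply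
        (hwc.mono hsub))

/-- The derivative of the phase is ±R plus a term of order R^b τ^{b-1} or larger. As b > 1 the
latter wins on t ≥ τ whichever term dominates the multiplier: any stationary point lies at distance
of order 1/R from the origin. -/
theorem eventually_norm_oscInt_le {b s c τ κ : ℝ} (hb : 1 < b) (hs : 0 < s) (hc : c ≠ 0)
    (hτ : 0 < τ) (hκ : 0 < κ) :
    ∀ᶠ R in atTop, ∀ e t : ℝ, |e| = 1 → τ ≤ t → ‖oscInt b (e * R) (-(R ^ b * s * c)) τ t‖ ≤ κ := by
  have hc0 : 0 < |c| := abs_pos.2 hc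
  have hb0 : 0 < b := by linarith
  set q := s * |c| * (b * τ ^ (b - 1)) with hq
  have hq0 : 0 < q := by positivity
  set Y := 5 / (τ * κ) with hY
  have hY0 : 0 < Y := by positivity
  filter_upwards [(tendsto_rpow_atTop (by linarith : 0 < b - 1)).eventually_ge_atTop (2 / q),
    eventually_ge_atTop Y] with R hR1 hR2 e t he ht
  have hR0 : 0 < R := hY0.trans_le hR2
  have hRb : R ^ b = R ^ (b - 1) * R := by rw [← Real.rpow_add_one hR0.ne']; congr 1; ring
  have h2 : 2 * R ≤ R ^ b * q := by
    rw [div_le_iff₀ hq0] at hR1; rw [hRb]; nlinarith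
  refine (norm_oscInt_le_of_deriv (l := Y) hb hτ ht hY0 fun x hx => ?_).trans_eq ?_
  · have h3 : R ^ b * q ≤ |-(R ^ b * s * c) * (b * x ^ (b - 1))| := by
      have hx0 : 0 < x := hτ.trans_le hx.1
      rw [abs_mul, abs_neg, abs_mul, abs_of_pos (a := R ^ b * s) (by positivity),
        abs_of_pos (a := b * x ^ (b - 1)) (by positivity), hq]
      have : τ ^ (b - 1) ≤ x ^ (b - 1) := Real.rpow_le_rpow hτ.le hx.1 (by linarith)
      calc _ = R ^ b * s * |c| * (b * τ ^ (b - 1)) := by ring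
        _ ≤ _ := by gcongr
    have h4 := abs_sub_abs_le_abs_sub (-(R ^ b * s * c) * (b * x ^ (b - 1))) (-(e * R))
    rw [abs_neg (e * R), abs_mul e, he, one_mul, abs_of_pos hR0, sub_neg_eq_add,
      add_comm _ (e * R)] at h4
    linarith
  · rw [hY]; field_simp

/-- Asymptotics of the Hilbert transform of a highly modulated function, where one of the two terms
of the phase dominates. -/
theorem exists_threshold_curveHilbert {b₀ : ℝ} (b₁ : ℝ) (hb₀ : 1 < b₀) {ε : ℝ} (hε : 0 < ε) :
    ∃ H ≥ 1, ∀ b cp cm : ℝ, b₀ ≤ b → b ≤ b₁ → cp ≠ 0 → cm ≠ 0 → ∀ u s r : ℝ, 0 < u → 0 < s →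
      ∀ G : Plane → ℝ, ContDiff ℝ 1 G → (∀ y, 0 ≤ G y) → (∀ y, G y ≤ 1) →
      (∀ y, r < ‖y‖ → G y = 0) → ∀ δ > 0, ∀ᶠ R in atTop, ∀ f : 𝓢(Plane, ℂ),
      (∀ y, f y = G y * Complex.exp (((R * y 0 + R ^ b * s * y 1 : ℝ) : ℂ) * Complex.I)) →
      ∀ x, ‖x‖ ≤ r →
        ((H * (s * u * |cp|) ≤ 1 → H * (s * u * |cm|) ≤ 1 →
          ‖curveHilbert b cp cm u f x - linearValue * f x‖ ≤ ε * G x + δ) ∧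
        (H ≤ s * u * |cp| → H ≤ s * u * |cm| →
          ‖curveHilbert b cp cm u f x - powerValue b cp cm * f x‖ ≤ ε * G x + δ)) := by
  obtain ⟨H, hH, h⟩ := exists_threshold_oscKernel b₁ hb₀ hε
  refine ⟨H, hH, fun b cp cm hb hb' hp hm u s r hu hs G hG hG0 hG1 hGr δ hδ => ?_⟩
  have hb1 : 1 < b := hb₀.trans_le hb
  have hb0 : 0 < b := by linarith
  have hcs : HasCompactSupport G := HasCompactSupport.intro (isCompact_closedBall (0 : Plane) r)
    fun y hy => hGr y (by simpa using hy)
  obtain ⟨M', hM'⟩ := (hG.continuous_fderiv (by norm_num)).bounded_above_of_compact_support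
    (hcs.fderiv ℝ)
  set M := max M' 0 with hM
  have hM0 : 0 ≤ M := le_max_right _ _
  have hGM : ∀ y, ‖fderiv ℝ G y‖ ≤ M := fun y => (hM' y).trans (le_max_left _ _)
  set N := max (2 * r) 1 with hN
  have hN1 : 1 ≤ N := le_max_right _ _
  have hN2 : 2 * r ≤ N := le_max_left _ _
  have hN0 : 0 < N := by linarith
  set V := max |u * cp| |u * cm| with hV
  set L := M * (1 + V * (b * N ^ (b - 1))) with hL
  have hNb : 0 ≤ b * N ^ (b - 1) := by positivity
  have hV0 : 0 ≤ V := le_max_of_le_left (abs_nonneg _)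
  have hL0 : 0 ≤ L := by positivity
  obtain ⟨X, hX⟩ := h b cp cm hb hb' hp hm (δ / 3) (by positivity)
  -- First τ makes Lτ ≤ δ/6, then κ makes κ(1 + LN) = δ/6. The two half curves together cost 2δ/3,
  -- and the multiplier on [a, τ] accounts for the rest.
  set τ := min 1 (δ / (6 * (L + 1))) with hτ
  have hτ0 : 0 < τ := by positivity
  have hτN : τ ≤ N := (min_le_left _ _).trans hN1
  have hLτ : L * τ ≤ δ / 6 := by
    calc L * τ ≤ (L + 1) * (δ / (6 * (L + 1))) :=
          mul_le_mul (by linarith) (min_le_right _ _) hτ0.le (by linarith)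
      _ = δ / 6 := by field_simp
  set κ := δ / (6 * (1 + L * N)) with hκ
  have hκ0 : 0 < κ := by positivity
  have hκL : κ * (1 + L * N) = δ / 6 := by rw [hκ]; field_simp
  have t1 : Tendsto (fun R : ℝ => R * τ) atTop atTop := tendsto_id.atTop_mul_const hτ0
  have t2 : Tendsto (fun R : ℝ => R ^ b * (s * u * τ ^ b)) atTop atTop :=
    (tendsto_rpow_atTop hb0).atTop_mul_const (by positivity)
  filter_upwards [eventually_norm_oscInt_le hb1 hs (mul_ne_zero hu.ne' hp) hτ0 hκ0,
    eventually_norm_oscInt_le hb1 hs (mul_ne_zero hu.ne' hm) hτ0 hκ0,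
    t1.eventually_ge_atTop X, t2.eventually_ge_atTop X, eventually_gt_atTop 0]
    with R hR1 hR2 hR3 hR4 hR0 f hf x hx
  have hRb : 0 < R ^ b := Real.rpow_pos_of_pos hR0 _
  have hσ : 0 < R ^ b * (s * u) := by positivity
  have hker := hX R (R ^ b * (s * u)) τ hR0 hσ hτ0 hR3 (by rw [mul_assoc]; exact hR4)
  have hfz : ∀ y, r < ‖y‖ → f y = 0 := fun y hy => by rw [hf, hGr y hy]; simp
  have hfn : ‖f x‖ = G x := by
    rw [hf x, norm_mul, Complex.norm_exp_ofReal_mul_I, mul_one, Complex.norm_real,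
      Real.norm_of_nonneg (hG0 x)]
  have hG1' : ∀ y, ‖G y‖ ≤ 1 := fun y => by rw [Real.norm_of_nonneg (hG0 y)]; exact hG1 y
  -- comparison of the truncated integral with the truncated multiplier
  have hcomp : ∀ a : ℝ, 0 < a → a < τ → ‖truncatedHilbert b cp cm u f x a -
      f x * oscKernel b R (R ^ b * (s * u) * cp) (R ^ b * (s * u) * cm) a τ‖ ≤ 2 * (δ / 3) := by
    intro a ha haτ
    have i1 := norm_integral_halfCurve_sub_le (b := b) (s := -1) (v := u * cp) (ρ := R)
      (σ := R ^ b * s) (L := L) (κ := κ) hb1 (by simp) hG hG1' hM0 hGM hf x ha haτ.le hτN hκ0.le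
      (by rw [hL]; gcongr; exact le_max_left _ _) (fun t ht => hR1 (-1) t (by simp) ht.1)
    have i2 := norm_integral_halfCurve_sub_le (b := b) (s := 1) (v := u * cm) (ρ := R)
      (σ := R ^ b * s) (L := L) (κ := κ) hb1 (by simp) hG hG1' hM0 hGM hf x ha haτ.le hτN hκ0.le
      (by rw [hL]; gcongr; exact le_max_right _ _) (fun t ht => hR2 1 t (by simp) ht.1)
    rw [truncatedHilbert_eq_halfCurve hb0 f hfz hx hN2 ha (haτ.le.trans hτN)]
    rw [neg_one_mul] at i1
    rw [one_mul] at i2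
    have e : ∀ c : ℝ, R ^ b * (s * u) * c = R ^ b * s * (u * c) := fun c => by ring
    rw [oscKernel, e, e, mul_sub]
    rw [hκL] at i1 i2
    rw [sub_sub_sub_comm]
    refine (norm_sub_le _ _).trans ?_
    linarith
  have hfin : ∀ Z : ℂ, (∀ᶠ a in 𝓝[>] 0,
      ‖oscKernel b R (R ^ b * (s * u) * cp) (R ^ b * (s * u) * cm) a τ - Z‖ ≤ ε + δ / 3) →
      ‖curveHilbert b cp cm u f x - Z * f x‖ ≤ ε * G x + δ := by
    intro Z hZ
    have hlim := ((tendsto_truncatedHilbert hb1 cp cm hu f x).sub_const (Z * f x)).norm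
    refine le_of_tendsto hlim ?_
    filter_upwards [hZ, self_mem_nhdsWithin, mem_nhdsWithin_of_mem_nhds (Iio_mem_nhds hτ0)]
      with a ha ha0 haτ
    set Q := oscKernel b R (R ^ b * (s * u) * cp) (R ^ b * (s * u) * cm) a τ with hQ
    have e : truncatedHilbert b cp cm u f x a - Z * f x =
        (truncatedHilbert b cp cm u f x a - f x * Q) + f x * (Q - Z) := by ring
    rw [e]
    refine (norm_add_le _ _).trans ((add_le_add (hcomp a ha0 haτ) ?_).trans (b := 2 * (δ / 3) +
      G x * (ε + δ / 3)) ?_)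
    · rw [norm_mul, hfn]
      exact mul_le_mul_of_nonneg_left ha (hG0 x)
    · nlinarith [hG0 x, hG1 x]
  -- The factor R^b cancels from the domination conditions, so the regime depends only on su|c_±|.
  refine ⟨fun h1 h2 => hfin _ (hker.1 ?_ ?_), fun h1 h2 => hfin _ (hker.2 ?_ ?_)⟩
  · calc H * (R ^ b * (s * u) * |cp|) = R ^ b * (H * (s * u * |cp|)) := by ring
      _ ≤ R ^ b * 1 := by gcongr
      _ = R ^ b := mul_one _
  · calc H * (R ^ b * (s * u) * |cm|) = R ^ b * (H * (s * u * |cm|)) := by ring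
      _ ≤ R ^ b * 1 := by gcongr
      _ = R ^ b := mul_one _
  · calc H * R ^ b ≤ s * u * |cp| * R ^ b := by gcongr
      _ = _ := by ring
  · calc H * R ^ b ≤ s * u * |cm| * R ^ b := by gcongr
      _ = _ := by ring

/-! ### Averaging of periodic factors, and cutoffs to the set where the cosine is positive. -/

theorem integrable_of_forall_norm_gt {E : Type*} [NormedAddCommGroup E] {F : Plane → E} {r : ℝ}
    (hF : Continuous F) (hr : ∀ y, r < ‖y‖ → F y = 0) : Integrable F :=
  hF.integrable_of_hasCompactSupport (HasCompactSupport.intro (isCompact_closedBall (0 : Plane) r)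
    fun y hy => hr y (by simpa using hy))

theorem exists_bound_of_periodic {g : ℝ → ℂ} (hg : Continuous g)
    (hgp : Function.Periodic g (2 * π)) : ∃ C ≥ 0, ∀ y, ‖g y‖ ≤ C := by
  obtain ⟨C, hC⟩ := (isCompact_Icc (a := (0:ℝ)) (b := 2 * π)).exists_bound_of_continuousOn
    hg.continuousOn
  refine ⟨max C 0, le_max_right _ _, fun y => ?_⟩
  obtain ⟨z, hz, hyz⟩ := hgp.exists_mem_Ico₀ (by positivity) y
  rw [hyz]
  exact (hC z ⟨hz.1, hz.2.le⟩).trans (le_max_left _ _)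

/-- Riemann-Lebesgue lemma for periodic functions: high-frequency oscillations are averaged. -/
theorem tendsto_integral_mul_periodic {h : Plane → ℂ} (hh : ContDiff ℝ 1 h) {r : ℝ}
    (hr : ∀ y, r < ‖y‖ → h y = 0) {g : ℝ → ℂ} (hg : Continuous g)
    (hgp : Function.Periodic g (2 * π)) (σ : ℝ → ℝ) :
    Tendsto (fun R : ℝ => ∫ x, h x * g (R * x 0 + σ R * x 1)) atTop
      (𝓝 ((∫ x, h x) * ((∫ y in (0 : ℝ)..(2 * π), g y) / (2 * π)))) := by
  have hπ : (0:ℝ) < 2 * π := by positivity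
  have hcs : HasCompactSupport h := HasCompactSupport.intro (isCompact_closedBall (0 : Plane) r)
    fun y hy => hr y (by simpa using hy)
  obtain ⟨Λ, hΛ⟩ := hh.lipschitzWith_of_hasCompactSupport hcs (by norm_num)
  obtain ⟨C, hC0, hC⟩ := exists_bound_of_periodic hg hgp
  have hint := integrable_of_forall_norm_gt hh.continuous hr
  set vol := (volume (Metric.closedBall (0 : Plane) (r + 2 * π))).toReal with hvol
  have hxc : ∀ i : Fin 2, Continuous fun x : Plane => x i := fun i => by fun_prop
  -- translation by one period
  have hshift : ∀ R : ℝ, 1 ≤ R → ∀ s ∈ Ioc 0 (2 * π),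
      ‖(∫ x, h x * g (R * x 0 + σ R * x 1 + s)) - ∫ x, h x * g (R * x 0 + σ R * x 1)‖
        ≤ Λ * (2 * π / R) * C * vol := by
    intro R hR s hs
    have hR0 : 0 < R := by linarith
    -- Moving x₁ by s/R advances the phase by exactly s and changes h by only O(1/R). Averaging over
    -- s in one period replaces g by its mean; the second frequency may be arbitrary because x₂ is
    -- not moved.
    set a : Plane := (s / R) • (!₂[1, 0] : Plane) with ha
    have han : ‖a‖ ≤ 2 * π / R := by
      rw [ha, norm_smul, Real.norm_of_nonneg (div_nonneg hs.1.le hR0.le)]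
      have : ‖(!₂[1, 0] : Plane)‖ ≤ 1 := by simpa using norm_plane_le 1 0
      calc _ ≤ s / R * 1 := mul_le_mul_of_nonneg_left this (div_nonneg hs.1.le hR0.le)
        _ ≤ 2 * π / R := by rw [mul_one]; gcongr; exact hs.2
    have han' : ‖a‖ ≤ 2 * π := han.trans (div_le_self hπ.le hR)
    have hgl : Continuous fun x : Plane => g (R * x 0 + σ R * x 1) := by
      have := hxc 0; have := hxc 1
      fun_prop
    have e1 : ∫ x, h x * g (R * x 0 + σ R * x 1 + s) =
        ∫ x, h (x - a) * g (R * x 0 + σ R * x 1) := by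
      rw [← integral_sub_right_eq_self _ a]
      refine integral_congr_ae (Eventually.of_forall fun x => ?_)
      have : R * (x - a) 0 + σ R * (x - a) 1 + s = R * x 0 + σ R * x 1 := by
        simp [ha]; field_simp; ring
      simp only [this]
    have hr' : ∀ y, r + 2 * π < ‖y‖ → h (y - a) - h y = 0 := fun y hy => by
      have h3 := norm_sub_norm_le y a
      rw [hr y (by linarith), hr (y - a) (by linarith), sub_zero]
    have i1 : Integrable fun x => (h (x - a) - h x) * g (R * x 0 + σ R * x 1) :=
      integrable_of_forall_norm_gt (r := r + 2 * π)
        (((hh.continuous.comp (continuous_id.sub continuous_const)).sub hh.continuous).mul hgl)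
        fun y hy => by rw [hr' y hy, zero_mul]
    have i2 : Integrable fun x => h x * g (R * x 0 + σ R * x 1) :=
      integrable_of_forall_norm_gt (hh.continuous.mul hgl) fun y hy => by rw [hr y hy, zero_mul]
    have e2 : (∫ x, h x * g (R * x 0 + σ R * x 1 + s)) - ∫ x, h x * g (R * x 0 + σ R * x 1) =
        ∫ x, (h (x - a) - h x) * g (R * x 0 + σ R * x 1) := by
      rw [e1, sub_eq_iff_eq_add, ← integral_add i1 i2]
      refine integral_congr_ae (Eventually.of_forall fun x => ?_)
      simp only; ring
    rw [e2, ← setIntegral_eq_integral_of_forall_compl_eq_zero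
      (s := Metric.closedBall (0 : Plane) (r + 2 * π)) fun y hy => by
        rw [hr' y (by simpa using hy), zero_mul]]
    refine norm_setIntegral_le_of_norm_le_const measure_closedBall_lt_top fun x _ => ?_
    rw [norm_mul]
    refine mul_le_mul ?_ (hC _) (norm_nonneg _) (by positivity)
    have := hΛ.norm_sub_le (x - a) x
    rw [sub_sub_cancel_left, norm_neg] at this
    exact this.trans (by gcongr)
  -- averaging over a period
  have havg : ∀ R : ℝ, ∫ s in (0:ℝ)..(2 * π), ∫ x, h x * g (R * x 0 + σ R * x 1 + s) =
      (∫ x, h x) * ∫ y in (0 : ℝ)..(2 * π), g y := by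
    intro R
    rw [intervalIntegral_integral_swap]
    · rw [← integral_mul_const]
      refine integral_congr_ae (Eventually.of_forall fun x => ?_)
      simp only
      rw [intervalIntegral.integral_const_mul, intervalIntegral.integral_comp_add_left g,
        add_zero, hgp.intervalIntegral_add_eq _ 0, zero_add]
    · have hi : Integrable (fun z : ℝ × Plane => (1 : ℂ) * h z.2)
          ((volume.restrict (uIoc 0 (2 * π))).prod volume) :=
        Integrable.mul_prod (f := fun _ : ℝ => (1 : ℂ)) (g := h)
          (integrableOn_const (by rw [uIoc_of_le hπ.le]; exact measure_Ioc_lt_top.ne) (by simp)) hint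
      have := hi.mul_bdd (c := C) (g := fun z : ℝ × Plane => g (R * z.2 0 + σ R * z.2 1 + z.1))
        (Continuous.aestronglyMeasurable (by
          have := hxc 0; have := hxc 1
          have h0 : Continuous fun z : ℝ × Plane => z.2 0 := (hxc 0).comp continuous_snd
          have h1 : Continuous fun z : ℝ × Plane => z.2 1 := (hxc 1).comp continuous_snd
          exact hg.comp (((h0.const_mul R).add (h1.const_mul (σ R))).add continuous_fst)))
        (Eventually.of_forall fun z => hC _)
      simpa [Function.uncurry_def] using this
  have hcont : ∀ R : ℝ, IntervalIntegrable
      (fun s => ∫ x, h x * g (R * x 0 + σ R * x 1 + s)) volume 0 (2 * π) := by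
    intro R
    refine (continuous_of_dominated (bound := fun x => ‖h x‖ * C) ?_ ?_ (hint.norm.mul_const C)
      ?_).intervalIntegrable _ _
    · intro s
      refine Continuous.aestronglyMeasurable (hh.continuous.mul (hg.comp ?_))
      exact (((hxc 0).const_mul R).add ((hxc 1).const_mul (σ R))).add continuous_const
    · exact fun s => Eventually.of_forall fun x => by
        rw [norm_mul]; exact mul_le_mul_of_nonneg_left (hC _) (norm_nonneg _)
    · exact Eventually.of_forall fun x => continuous_const.mul (hg.comp (by fun_prop))
  rw [tendsto_iff_norm_sub_tendsto_zero]
  have hlim : Tendsto (fun R : ℝ => Λ * (2 * π) * C * vol * R⁻¹) atTop (𝓝 0) := by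
    simpa using tendsto_inv_atTop_zero.const_mul (Λ * (2 * π) * C * vol)
  refine squeeze_zero' (Eventually.of_forall fun _ => norm_nonneg _) ?_ hlim
  filter_upwards [eventually_ge_atTop 1] with R hR
  set I₀ := ∫ x, h x * g (R * x 0 + σ R * x 1) with hI₀
  have e3 : ∫ s in (0:ℝ)..(2 * π), ((∫ x, h x * g (R * x 0 + σ R * x 1 + s)) - I₀) =
      (∫ x, h x) * (∫ y in (0 : ℝ)..(2 * π), g y) - (2 * π) * I₀ := by
    rw [intervalIntegral.integral_sub (hcont R) intervalIntegrable_const, havg,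
      intervalIntegral.integral_const, sub_zero, Complex.real_smul]
    push_cast; ring
  have e4 := intervalIntegral.norm_integral_le_of_norm_le_const (a := (0:ℝ)) (b := 2 * π)
    (f := fun s => (∫ x, h x * g (R * x 0 + σ R * x 1 + s)) - I₀)
    (C := Λ * (2 * π / R) * C * vol) fun s hs => hshift R hR s (by rwa [uIoc_of_le hπ.le] at hs)
  rw [e3, sub_zero, abs_of_pos hπ] at e4
  have e5 : I₀ - (∫ x, h x) * ((∫ y in (0 : ℝ)..(2 * π), g y) / (2 * π)) =
      -(((2 * π : ℝ) : ℂ))⁻¹ *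
        ((∫ x, h x) * (∫ y in (0 : ℝ)..(2 * π), g y) - (2 * π) * I₀) := by
    have : (π : ℂ) ≠ 0 := by exact_mod_cast Real.pi_ne_zero
    push_cast
    field_simp
    ring
  rw [e5, norm_mul, norm_neg, norm_inv, Complex.norm_real, Real.norm_of_nonneg hπ.le,
    inv_mul_le_iff₀ hπ]
  exact e4.trans_eq (by rw [div_eq_mul_inv]; ring)

/-- Real-valued version of `tendsto_integral_mul_periodic`. -/
theorem tendsto_integral_mul_periodic_real {h : Plane → ℝ} (hh : ContDiff ℝ 1 h) {r : ℝ}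
    (hr : ∀ y, r < ‖y‖ → h y = 0) {g : ℝ → ℝ} (hg : Continuous g)
    (hgp : Function.Periodic g (2 * π)) (σ : ℝ → ℝ) :
    Tendsto (fun R : ℝ => ∫ x, h x * g (R * x 0 + σ R * x 1)) atTop
      (𝓝 ((∫ x, h x) * ((∫ y in (0 : ℝ)..(2 * π), g y) / (2 * π)))) := by
  have := tendsto_integral_mul_periodic (r := r) (h := fun x => (h x : ℂ)) (g := fun y => (g y : ℂ))
    (Complex.ofRealCLM.contDiff.comp hh) (fun y hy => by simp [hr y hy])
    (Complex.continuous_ofReal.comp hg) (fun y => by simp [hgp y]) σ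
  have h2 := (Complex.continuous_re.tendsto _).comp this
  have e : ∀ R : ℝ, ((∫ x, (h x : ℂ) * (g (R * x 0 + σ R * x 1) : ℂ))).re =
      ∫ x, h x * g (R * x 0 + σ R * x 1) := fun R => by
    rw [← Complex.ofReal_re (∫ x, h x * g (R * x 0 + σ R * x 1)), ← integral_complex_ofReal]
    simp
  refine (h2.congr e).trans_eq ?_
  rw [integral_complex_ofReal, intervalIntegral.integral_ofReal]
  congr 1
  rw [← Complex.ofReal_re ((∫ x, h x) * ((∫ y in (0 : ℝ)..(2 * π), g y) / (2 * π)))]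
  push_cast; rfl

/-- A smooth periodic cutoff to the set where the cosine is positive. -/
structure IsCosCutoff (ψ : ℝ → ℝ) (q κ : ℝ) : Prop where
  contDiff : ContDiff ℝ (⊤ : ℕ∞) ψ
  periodic : Function.Periodic ψ (2 * π)
  nonneg : ∀ y, 0 ≤ ψ y
  le_one : ∀ y, ψ y ≤ 1
  eq_zero : ∀ y, Real.cos y ≤ 0 → ψ y = 0
  mean : (∫ y in (0 : ℝ)..(2 * π), ψ y) / (2 * π) = q / 2
  mean_cos : (∫ y in (0 : ℝ)..(2 * π), ψ y * Real.cos y) / (2 * π) = κ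

/-- A smooth step applied to (k + 1) cos y tends to the indicator of {cos y > 0}. Together with its
translate by π it has mean close to 1, hence q close to 1. -/
theorem exists_isCosCutoff {η : ℝ} (hη : 0 < η) :
    ∃ ψ q κ, IsCosCutoff ψ q κ ∧ 1 - η ≤ q ∧ q ≤ 1 ∧ 1 / 4 - η / 2 ≤ κ := by
  have hπ : (0:ℝ) < 2 * π := by positivity
  set Ψ : ℕ → ℝ → ℝ := fun k y => Real.smoothTransition (Real.cos y * (k + 1)) with hΨ
  have hsm : ∀ k, ContDiff ℝ (⊤ : ℕ∞) (Ψ k) := fun k =>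
    Real.smoothTransition.contDiff.comp (Real.contDiff_cos.mul contDiff_const)
  have h0 : ∀ k y, 0 ≤ Ψ k y := fun k y => Real.smoothTransition.nonneg _
  have h1 : ∀ k y, Ψ k y ≤ 1 := fun k y => Real.smoothTransition.le_one _
  have hz : ∀ k y, Real.cos y ≤ 0 → Ψ k y = 0 := fun k y hy =>
    Real.smoothTransition.zero_of_nonpos (mul_nonpos_of_nonpos_of_nonneg hy (by positivity))
  have hper : ∀ k, Function.Periodic (Ψ k) (2 * π) := fun k y => by simp [hΨ]
  set Θ : ℕ → ℝ → ℝ := fun k y => Ψ k y + Ψ k (y + π) with hΘ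
  have hΘc : ∀ k, Continuous (Θ k) := fun k => (hsm k).continuous.add
    ((hsm k).continuous.comp (continuous_id.add continuous_const))
  have hΘ0 : ∀ k y, 0 ≤ Θ k y := fun k y => add_nonneg (h0 _ _) (h0 _ _)
  have hΘ1 : ∀ k y, Θ k y ≤ 1 := fun k y => by
    rcases le_total (Real.cos y) 0 with h | h
    · simp only [hΘ, hz k y h, zero_add]; exact h1 _ _
    · have := hz k (y + π) (by rw [Real.cos_add_pi]; linarith)
      simp only [hΘ, this, add_zero]; exact h1 _ _
  have hlim : Tendsto (fun k => ∫ y in (0:ℝ)..(2 * π), Θ k y) atTop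
      (𝓝 (∫ _ in (0:ℝ)..(2 * π), (1:ℝ))) := by
    refine intervalIntegral.tendsto_integral_filter_of_dominated_convergence (fun _ => 1)
      (Eventually.of_forall fun k => (hΘc k).aestronglyMeasurable)
      (Eventually.of_forall fun k => Eventually.of_forall fun y _ => by
        rw [Real.norm_of_nonneg (hΘ0 k y)]; exact hΘ1 k y) intervalIntegrable_const ?_
    have hnull : ∀ᵐ y : ℝ, Real.cos y ≠ 0 := by
      have : {y : ℝ | Real.cos y = 0}.Countable := by
        have hsub : {y : ℝ | Real.cos y = 0} ⊆ range fun k : ℤ => (2 * k + 1) * π / 2 := by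
          intro y hy
          obtain ⟨k, hk⟩ := Real.cos_eq_zero_iff.1 hy
          exact ⟨k, hk.symm⟩
        exact (countable_range _).mono hsub
      simpa [ae_iff] using this.measure_zero volume
    filter_upwards [hnull] with y hy _
    have hbig : ∀ c : ℝ, 0 < c → ∀ᶠ k : ℕ in atTop, 1 ≤ c * (k + 1) := fun c hc => by
      have := (tendsto_natCast_atTop_atTop (R := ℝ)).eventually_ge_atTop c⁻¹
      filter_upwards [this] with k hk
      rw [inv_le_iff_one_le_mul₀ hc] at hk
      nlinarith
    refine tendsto_const_nhds.congr' ?_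
    rcases lt_or_gt_of_ne hy with h | h
    · filter_upwards [hbig (-Real.cos y) (by linarith)] with k hk
      have : Ψ k (y + π) = 1 := Real.smoothTransition.one_of_one_le (by rwa [Real.cos_add_pi])
      simp only [hΘ, this, hz k y h.le, zero_add]
    · filter_upwards [hbig (Real.cos y) h] with k hk
      have : Ψ k y = 1 := Real.smoothTransition.one_of_one_le hk
      simp only [hΘ, this, hz k (y + π) (by rw [Real.cos_add_pi]; linarith), add_zero]
  rw [intervalIntegral.integral_const, smul_eq_mul, mul_one, sub_zero] at hlim
  obtain ⟨k, hk⟩ := (hlim.eventually (lt_mem_nhds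
    (show 2 * π * (1 - η) < 2 * π by nlinarith))).exists
  have hii : ∀ F : ℝ → ℝ, Continuous F → IntervalIntegrable F volume 0 (2 * π) :=
    fun F hF => hF.intervalIntegrable _ _
  have hΨc := (hsm k).continuous
  have hsh : Continuous fun y => Ψ k (y + π) := hΨc.comp (continuous_id.add continuous_const)
  have hsplit : ∫ y in (0:ℝ)..(2 * π), Θ k y = 2 * ∫ y in (0:ℝ)..(2 * π), Ψ k y := by
    have : ∫ y in (0:ℝ)..(2 * π), Ψ k (y + π) = ∫ y in (0:ℝ)..(2 * π), Ψ k y := by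
      rw [intervalIntegral.integral_comp_add_right, zero_add, add_comm,
        (hper k).intervalIntegral_add_eq π 0, zero_add]
    simp only [hΘ]
    rw [intervalIntegral.integral_add (hii _ hΨc) (hii _ hsh), this]
    ring
  have hΘle : ∫ y in (0:ℝ)..(2 * π), Θ k y ≤ 2 * π := by
    have := intervalIntegral.integral_mono hπ.le (hii _ (hΘc k)) intervalIntegrable_const
      (g := fun _ => (1:ℝ)) (hΘ1 k)
    simpa using this
  have hcos : ∫ y in (0:ℝ)..(2 * π), Real.cos y ^ 2 = π := by
    rw [integral_cos_sq]; simp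
  have hcperm : ∫ y in (0:ℝ)..(2 * π), Ψ k y * Real.cos y =
      ∫ y in (0:ℝ)..(2 * π), Ψ k (y + π) * Real.cos (y + π) := by
    have hp : Function.Periodic (fun y => Ψ k y * Real.cos y) (2 * π) := fun y => by
      simp only [hper k y, Real.cos_add_two_pi]
    rw [intervalIntegral.integral_comp_add_right (fun y => Ψ k y * Real.cos y), zero_add, add_comm,
      hp.intervalIntegral_add_eq π 0, zero_add]
  -- For 0 ≤ Ψ ≤ 1 one has Ψ|cos| ≥ cos² - (1 - Ψ) where the cosine has the right sign. Adding the
  -- translate by π bounds 2∫Ψ cos from below by ∫cos² minus the defect ∫(1 - Θ).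
  have hκ : π - 2 * π * η ≤ 2 * ∫ y in (0:ℝ)..(2 * π), Ψ k y * Real.cos y := by
    have c1 : Continuous fun y => Ψ k y * Real.cos y := hΨc.mul Real.continuous_cos
    have c2 : Continuous fun y => Ψ k (y + π) * Real.cos (y + π) :=
      c1.comp (continuous_id.add continuous_const)
    have c3 : Continuous fun y => Real.cos y ^ 2 := by fun_prop
    calc π - 2 * π * η ≤ π - (2 * π - ∫ y in (0:ℝ)..(2 * π), Θ k y) := by linarith
      _ = ∫ y in (0:ℝ)..(2 * π), (Real.cos y ^ 2 - (1 - Θ k y)) := by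
          rw [intervalIntegral.integral_sub (hii _ c3) (hii (fun y => 1 - Θ k y)
            (continuous_const.sub (hΘc k))), intervalIntegral.integral_sub intervalIntegrable_const (hii _ (hΘc k)), hcos]
          simp
      _ ≤ ∫ y in (0:ℝ)..(2 * π), (Ψ k y * Real.cos y + Ψ k (y + π) * Real.cos (y + π)) := by
          refine intervalIntegral.integral_mono hπ.le
            (hii _ (c3.sub (continuous_const.sub (hΘc k)))) (hii _ (c1.add c2)) fun y => ?_
          have hc1 := Real.cos_le_one y
          have hc2 := Real.neg_one_le_cos y
          have hc3 := hΘ1 k y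
          have p0 := h0 k y
          have p1 := h0 k (y + π)
          simp only [hΘ] at hc3 ⊢
          rw [Real.cos_add_pi]
          rcases le_total (Real.cos y) 0 with h | h
          · rw [hz k y h] at hc3 ⊢
            nlinarith [mul_nonneg p1 (by nlinarith : (0:ℝ) ≤ -Real.cos y - Real.cos y ^ 2),
              mul_nonneg (by linarith : (0:ℝ) ≤ 1 - Ψ k (y + π))
                (by nlinarith : (0:ℝ) ≤ 1 - Real.cos y ^ 2)]
          · rw [hz k (y + π) (by rw [Real.cos_add_pi]; linarith)] at hc3 ⊢
            nlinarith [mul_nonneg p0 (by nlinarith : (0:ℝ) ≤ Real.cos y - Real.cos y ^ 2),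
              mul_nonneg (by linarith : (0:ℝ) ≤ 1 - Ψ k y)
                (by nlinarith : (0:ℝ) ≤ 1 - Real.cos y ^ 2)]
      _ = _ := by
          rw [intervalIntegral.integral_add (hii _ c1) (hii _ c2), ← hcperm]; ring
  refine ⟨Ψ k, 2 * ((∫ y in (0:ℝ)..(2 * π), Ψ k y) / (2 * π)), _,
    ⟨hsm k, hper k, h0 k, h1 k, hz k, by ring, rfl⟩, ?_, ?_, ?_⟩
  · rw [← mul_div_assoc, ← hsplit, le_div_iff₀ hπ]; linarith
  · rw [← mul_div_assoc, ← hsplit, div_le_one hπ]; exact hΘle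
  · rw [le_div_iff₀ hπ]; linarith

/-! ### The tree construction. -/

/-- The modulation `x ↦ e^{i(R x₁ + R^b s x₂)}`. -/
def modulation (b s R : ℝ) (x : Plane) : ℂ :=
  Complex.exp (((R * x 0 + R ^ b * s * x 1 : ℝ) : ℂ) * Complex.I)

theorem contDiff_planePhase (α β : ℝ) {n : WithTop ℕ∞} :
    ContDiff ℝ n fun x : Plane => α * x 0 + β * x 1 := by
  fun_prop

theorem contDiff_modulation (b s R : ℝ) {n : WithTop ℕ∞} : ContDiff ℝ n (modulation b s R) :=
  Complex.contDiff_exp.comp ((Complex.ofRealCLM.contDiff.comp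
    (contDiff_planePhase R (R ^ b * s))).mul contDiff_const)

theorem norm_modulation (b s R : ℝ) (x : Plane) : ‖modulation b s R x‖ = 1 :=
  Complex.norm_exp_ofReal_mul_I _

theorem exists_schwartz_modulated {w : Plane → ℝ} (hw : ContDiff ℝ (⊤ : ℕ∞) w) {r : ℝ}
    (hr : ∀ y, r < ‖y‖ → w y = 0) (b s R : ℝ) :
    ∃ f : 𝓢(Plane, ℂ), ∀ y, f y = w y * modulation b s R y := by
  have h1 : ContDiff ℝ (⊤ : ℕ∞) fun y => (w y : ℂ) * modulation b s R y :=
    (Complex.ofRealCLM.contDiff.comp hw).mul (contDiff_modulation b s R)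
  have h2 : HasCompactSupport fun y => (w y : ℂ) * modulation b s R y :=
    HasCompactSupport.intro (isCompact_closedBall (0 : Plane) r)
      fun y hy => by simp [hr y (by simpa using hy)]
  exact ⟨h2.toSchwartzMap h1, fun y => rfl⟩

/-- A family of operators on Schwartz functions which multiplies highly modulated functions, up to
small errors, by `A` or `B`, depending on the relative position of the index of the operator and of
the index of the modulation. -/
structure IsOrderedMultiplier (T : ℕ → 𝓢(Plane, ℂ) → Plane → ℂ) (J : ℕ) (A B : ℂ) (b r ε : ℝ)
    (s : ℕ → ℝ) : Prop where
  add : ∀ j < J, ∀ f g x, T j (f + g) x = T j f x + T j g x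
  asymp : ∀ k, k + 1 < J → ∀ G : Plane → ℝ, ContDiff ℝ 1 G → (∀ y, 0 ≤ G y) → (∀ y, G y ≤ 1) →
    (∀ y, r < ‖y‖ → G y = 0) → ∀ δ > 0, ∀ᶠ R in atTop, ∀ f : 𝓢(Plane, ℂ),
    (∀ y, f y = G y * modulation b (s k) R y) → ∀ x, ‖x‖ ≤ r → ∀ j < J,
      (j ≤ k → ‖T j f x - A * f x‖ ≤ ε * G x + δ) ∧
      (k < j → ‖T j f x - B * f x‖ ≤ ε * G x + δ)

/-- The function produced at depth `n` of the tree construction: its energy is of order `n`, but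
suitable partial sums, selected by the operators `T j` with `a ≤ j < a + 2 ^ n`, have size `n`. -/
structure IsTreeFunction (T : ℕ → 𝓢(Plane, ℂ) → Plane → ℂ) (J : ℕ) (A B : ℂ) (r ε q κ : ℝ)
    (n a : ℕ) (w : Plane → ℝ) (𝒢 : Set (Plane → ℂ)) (δ : ℝ) (f : 𝓢(Plane, ℂ)) (S : Plane → ℝ) :
    Prop where
  continuous : Continuous S
  zero : ∀ x, w x = 0 → f x = 0 ∧ S x = 0
  -- The set `𝒢` collects the conjugates of the functions at ancestor nodes; near orthogonality to
  -- them removes the cross terms from the energy.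
  orth : ∀ g ∈ 𝒢, ‖∫ x, g x * f x‖ ≤ δ
  energy : ∫ x, ‖f x‖ ^ 2 ≤ n * (∫ x, w x) + δ
  -- Each level contributes about κ times the mass it still carries, and the cutoffs retain the
  -- fraction q of the mass from one level to the next.
  lower : κ * n * q ^ n * (∫ x, w x) - δ ≤ ∫ x, S x
  outer : ∀ x, ‖x‖ ≤ r → ∀ j < J, (j < a → ‖T j f x - A * f x‖ ≤ n * ε * w x + δ) ∧
    (a + 2 ^ n ≤ j → ‖T j f x - B * f x‖ ≤ n * ε * w x + δ)
  -- The number z is the part of f(x) which the selected operator multiplies by A instead of B.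
  inner : ∀ x, ‖x‖ ≤ r → ∃ j, a ≤ j ∧ j < a + 2 ^ n ∧ ∃ z : ℂ, S x ≤ z.re ∧
    ‖T j f x - B * f x - (A - B) * z‖ ≤ n * ε * w x + δ

theorem IsOrderedMultiplier.map_zero {T : ℕ → 𝓢(Plane, ℂ) → Plane → ℂ} {J : ℕ} {A B : ℂ} {b r ε : ℝ}
    {s : ℕ → ℝ} (hT : IsOrderedMultiplier T J A B b r ε s) {j : ℕ} (hj : j < J) (x : Plane) :
    T j 0 x = 0 := by
  have := hT.add j hj 0 0 x
  rwa [add_zero, left_eq_add] at this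

theorem integral_add_three {E : Type*} [NormedAddCommGroup E] [NormedSpace ℝ E] {F G H : Plane → E}
    (hF : Integrable F) (hG : Integrable G) (hH : Integrable H) :
    ∫ x, (F x + G x + H x) = (∫ x, F x) + (∫ x, G x) + ∫ x, H x :=
  (integral_add (f := fun x => F x + G x) (hF.add hG) hH).trans (by rw [integral_add hF hG])

theorem norm_add_sq_of_disjoint {z l m : ℂ} (h : l = 0 ∨ m = 0) :
    ‖z + l + m‖ ^ 2 = ‖z‖ ^ 2 + ‖l‖ ^ 2 + ‖m‖ ^ 2 + 2 * ((starRingEnd ℂ) z * l).re +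
      2 * ((starRingEnd ℂ) z * m).re := by
  simp only [← Complex.normSq_eq_norm_sq, Complex.normSq_apply, Complex.mul_re, Complex.conj_re,
    Complex.conj_im, Complex.add_re, Complex.add_im]
  rcases h with rfl | rfl <;> simp <;> ring

theorem integral_modulation_period :
    ∫ y in (0 : ℝ)..(2 * π), Complex.exp ((y : ℂ) * Complex.I) = 0 := by
  simp_rw [mul_comm _ Complex.I]
  rw [integral_exp_mul_complex Complex.I_ne_zero]
  have : Complex.I * ((2 * π : ℝ) : ℂ) = 2 * π * Complex.I := by push_cast; ring
  rw [this, Complex.exp_two_pi_mul_I]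
  simp

/-- All the frequency conditions needed to start the two branches of the tree. -/
theorem exists_modulation {T : ℕ → 𝓢(Plane, ℂ) → Plane → ℂ} {J : ℕ} {A B : ℂ} {b r ε q κ : ℝ}
    {s : ℕ → ℝ} {ψ : ℝ → ℝ} (hT : IsOrderedMultiplier T J A B b r ε s) (hψ : IsCosCutoff ψ q κ)
    {k : ℕ} (hk : k + 1 < J) {w : Plane → ℝ} (hw : ContDiff ℝ (⊤ : ℕ∞) w) (hw0 : ∀ y, 0 ≤ w y)
    (hw1 : ∀ y, w y ≤ 1) (hwr : ∀ y, r < ‖y‖ → w y = 0) {𝒢 : Set (Plane → ℂ)} (h𝒢 : 𝒢.Finite)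
    (h𝒢d : ∀ g ∈ 𝒢, ContDiff ℝ 1 g) {δ : ℝ} (hδ : 0 < δ) :
    ∃ R : ℝ, ∃ f : 𝓢(Plane, ℂ), (∀ y, f y = w y * modulation b (s k) R y) ∧
      (∀ x, ‖x‖ ≤ r → ∀ j < J, (j ≤ k → ‖T j f x - A * f x‖ ≤ ε * w x + δ) ∧
        (k < j → ‖T j f x - B * f x‖ ≤ ε * w x + δ)) ∧
      (∀ g ∈ 𝒢, ‖∫ x, g x * f x‖ ≤ δ) ∧
      q / 2 * (∫ x, w x) - δ ≤ ∫ x, w x * ψ (R * x 0 + R ^ b * s k * x 1) ∧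
      q / 2 * (∫ x, w x) - δ ≤ ∫ x, w x * ψ (R * x 0 + R ^ b * s k * x 1 + π) ∧
      κ * (∫ x, w x) - δ ≤ ∫ x, w x * (ψ (R * x 0 + R ^ b * s k * x 1) *
        Real.cos (R * x 0 + R ^ b * s k * x 1)) := by
  have hw' : ContDiff ℝ 1 w := hw.of_le (by exact_mod_cast le_top)
  have hψc := hψ.contDiff.continuous
  have t1 := tendsto_integral_mul_periodic_real hw' hwr hψc hψ.periodic fun R => R ^ b * s k
  have t2 := tendsto_integral_mul_periodic_real hw' hwr (g := fun y => ψ (y + π))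
    (hψc.comp (continuous_id.add continuous_const))
    (fun y => by simp only; rw [add_right_comm]; exact hψ.periodic _) fun R => R ^ b * s k
  have t3 := tendsto_integral_mul_periodic_real hw' hwr (g := fun y => ψ y * Real.cos y)
    (hψc.mul Real.continuous_cos)
    (fun y => by simp only [hψ.periodic y, Real.cos_add_two_pi]) fun R => R ^ b * s k
  have hm : ∫ y in (0:ℝ)..(2 * π), ψ (y + π) = ∫ y in (0:ℝ)..(2 * π), ψ y := by
    rw [intervalIntegral.integral_comp_add_right, zero_add, add_comm,
      hψ.periodic.intervalIntegral_add_eq π 0, zero_add]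
  simp only [hm] at t2
  rw [hψ.mean, mul_comm _ (q / 2)] at t1 t2
  rw [hψ.mean_cos, mul_comm _ κ] at t3
  have t4 : ∀ᶠ R in atTop, ∀ g ∈ 𝒢, ‖∫ x, g x * (w x * modulation b (s k) R x)‖ < δ := by
    rw [eventually_all_finite h𝒢]
    intro g hg
    have := tendsto_integral_mul_periodic (h := fun x => g x * w x) (r := r)
      ((h𝒢d g hg).mul (Complex.ofRealCLM.contDiff.comp hw')) (fun y hy => by simp [hwr y hy])
      (g := fun y : ℝ => Complex.exp ((y : ℂ) * Complex.I)) (by fun_prop)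
      (fun y => by
        push_cast; rw [add_mul, Complex.exp_add, Complex.exp_two_pi_mul_I, mul_one])
      fun R => R ^ b * s k
    rw [integral_modulation_period, zero_div, mul_zero] at this
    have h2 := this.norm
    rw [norm_zero] at h2
    filter_upwards [h2.eventually (gt_mem_nhds hδ)] with R hR
    simpa only [modulation, mul_assoc] using hR
  -- Every requirement holds for all large R, so one R meets them all.
  obtain ⟨R, hR1, hR2, hR3, hR4, hR5⟩ :=
    ((t1.eventually (lt_mem_nhds (sub_lt_self _ hδ))).and
    ((t2.eventually (lt_mem_nhds (sub_lt_self _ hδ))).and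
    ((t3.eventually (lt_mem_nhds (sub_lt_self _ hδ))).and
    (t4.and (hT.asymp k hk w hw' hw0 hw1 hwr δ hδ))))).exists
  obtain ⟨f, hf⟩ := exists_schwartz_modulated hw hwr b (s k) R
  refine ⟨R, f, hf, hR5 f hf, fun g hg => ?_, hR1.le, hR2.le, hR3.le⟩
  simp only [hf]
  exact (hR4 g hg).le

/-- Induction on the depth: f = f₀ + f_l + f_r, where f₀ is w modulated at the middle index, and the
children have weights wψ(ℓ), wψ(ℓ + π) and the two halves of the index block. The children have
disjoint supports and are almost orthogonal to f₀, so each level adds at most ∫w² ≤ ∫w to the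
energy. On the left the selected operator multiplies f₀ by A and enlarges z by f₀; on the right it
multiplies f₀ by B and leaves z alone. -/
theorem IsOrderedMultiplier.exists_isTreeFunction {T : ℕ → 𝓢(Plane, ℂ) → Plane → ℂ} {J : ℕ}
    {A B : ℂ} {b r ε q κ : ℝ} {s : ℕ → ℝ} {ψ : ℝ → ℝ} (hT : IsOrderedMultiplier T J A B b r ε s)
    (hψ : IsCosCutoff ψ q κ) (hε : 0 ≤ ε) (hq0 : 0 ≤ q) (hq1 : q ≤ 1) (hκ : 0 ≤ κ) (n : ℕ) :
    ∀ a, a + 2 ^ n ≤ J → ∀ w : Plane → ℝ, ContDiff ℝ (⊤ : ℕ∞) w → (∀ y, 0 ≤ w y) →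
      (∀ y, w y ≤ 1) → (∀ y, r < ‖y‖ → w y = 0) → ∀ 𝒢 : Set (Plane → ℂ), 𝒢.Finite →
      (∀ g ∈ 𝒢, ContDiff ℝ 1 g) → ∀ δ > 0,
      ∃ f S, IsTreeFunction T J A B r ε q κ n a w 𝒢 δ f S := by
  induction n with
  | zero =>
    intro a ha w _ _ _ _ 𝒢 _ _ δ hδ
    have h0 := fun j (hj : j < J) x => hT.map_zero hj x
    refine ⟨0, 0, ⟨continuous_zero, fun x _ => ⟨rfl, rfl⟩, ?_, ?_, ?_, ?_, ?_⟩⟩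
    · intro g _; simpa using hδ.le
    · simpa using hδ.le
    · simpa using hδ.le
    · intro x _ j hj; simp [h0 j hj, hδ.le]
    · intro x _
      exact ⟨a, le_rfl, by simp, 0, by simp, by simp [h0 a (by omega), hδ.le]⟩
  | succ n ih =>
    intro a ha w hw hw0 hw1 hwr 𝒢 h𝒢 h𝒢d δ hδ
    have hpow : 2 ^ (n + 1) = 2 ^ n + 2 ^ n := by ring
    have hp1 : 1 ≤ 2 ^ n := Nat.one_le_two_pow
    set k := a + 2 ^ n - 1 with hk
    have hk1 : k + 1 = a + 2 ^ n := by omega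
    -- The error η in the masses of the children is multiplied by κn in the lower bound, so it must
    -- be small relative to κn + 1.
    set η := δ / (8 * (κ * n + 1)) with hη
    have hη0 : 0 < η := by positivity
    have hηδ : η ≤ δ / 8 := by
      rw [hη]
      exact div_le_div_of_nonneg_left hδ.le (by norm_num)
        (by nlinarith [mul_nonneg hκ (Nat.cast_nonneg (α := ℝ) n)])
    have hηκ : κ * n * η ≤ δ / 8 := by
      have : (κ * n + 1) * η = δ / 8 := by rw [hη]; field_simp
      nlinarith
    obtain ⟨R, f₀, hf₀, has, horth, hm1, hm2, hm3⟩ :=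
      exists_modulation hT hψ (k := k) (by omega) hw hw0 hw1 hwr h𝒢 h𝒢d hη0
    set ℓ : Plane → ℝ := fun x => R * x 0 + R ^ b * s k * x 1 with hℓ
    have hℓd : ContDiff ℝ (⊤ : ℕ∞) ℓ := contDiff_planePhase _ _
    set wl : Plane → ℝ := fun x => w x * ψ (ℓ x) with hwl
    set wr : Plane → ℝ := fun x => w x * ψ (ℓ x + π) with hwr'
    have hwld : ContDiff ℝ (⊤ : ℕ∞) wl := hw.mul (hψ.contDiff.comp hℓd)
    have hwrd : ContDiff ℝ (⊤ : ℕ∞) wr := hw.mul (hψ.contDiff.comp (hℓd.add contDiff_const))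
    have hdisj : ∀ y, ψ y = 0 ∨ ψ (y + π) = 0 := fun y => by
      rcases le_total (Real.cos y) 0 with h | h
      · exact Or.inl (hψ.eq_zero y h)
      · exact Or.inr (hψ.eq_zero _ (by rw [Real.cos_add_pi]; linarith))
    have hwl0 : ∀ y, 0 ≤ wl y := fun y => mul_nonneg (hw0 y) (hψ.nonneg _)
    have hwr0 : ∀ y, 0 ≤ wr y := fun y => mul_nonneg (hw0 y) (hψ.nonneg _)
    have hsum : ∀ y, wl y + wr y ≤ w y := fun y => by
      simp only [hwl, hwr']
      rcases hdisj (ℓ y) with h | h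
      · rw [h]; nlinarith [hw0 y, hψ.le_one (ℓ y + π)]
      · rw [h]; nlinarith [hw0 y, hψ.le_one (ℓ y)]
    have hwlw : ∀ y, wl y ≤ w y := fun y => by linarith [hsum y, hwr0 y]
    have hwrw : ∀ y, wr y ≤ w y := fun y => by linarith [hsum y, hwl0 y]
    have hdisjw : ∀ y, wl y = 0 ∨ wr y = 0 := fun y => by
      rcases hdisj (ℓ y) with h | h
      · left; simp [hwl, h]
      · right; simp [hwr', h]
    have hwlr : ∀ y, r < ‖y‖ → wl y = 0 := fun y hy => by simp [hwl, hwr y hy]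
    have hwrr : ∀ y, r < ‖y‖ → wr y = 0 := fun y hy => by simp [hwr', hwr y hy]
    -- the new test function
    set g₀ : Plane → ℂ := fun x => (starRingEnd ℂ) (w x * modulation b (s k) R x) with hg₀
    have hg₀d : ContDiff ℝ 1 g₀ := by
      have h1 : ContDiff ℝ 1 fun x => (w x : ℂ) * modulation b (s k) R x :=
        (Complex.ofRealCLM.contDiff.comp (hw.of_le (by exact_mod_cast le_top))).mul
          (contDiff_modulation b (s k) R)
      exact Complex.conjCLE.contDiff.comp h1
    have h𝒢' : (insert g₀ 𝒢).Finite := h𝒢.insert _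
    have h𝒢d' : ∀ g ∈ insert g₀ 𝒢, ContDiff ℝ 1 g := by
      rintro g (rfl | hg)
      · exact hg₀d
      · exact h𝒢d g hg
    obtain ⟨fl, Sl, hl⟩ := ih a (by omega) wl hwld hwl0 (fun y => (hwlw y).trans (hw1 y)) hwlr
      _ h𝒢' h𝒢d' (δ / 8) (by positivity)
    obtain ⟨fr, Sr, hr⟩ := ih (a + 2 ^ n) (by omega) wr hwrd hwr0 (fun y => (hwrw y).trans (hw1 y))
      hwrr _ h𝒢' h𝒢d' (δ / 8) (by positivity)
    -- supports and integrability
    have hf₀r : ∀ y, r < ‖y‖ → f₀ y = 0 := fun y hy => by simp [hf₀, hwr y hy]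
    have hflr : ∀ y, r < ‖y‖ → fl y = 0 := fun y hy => (hl.zero y (hwlr y hy)).1
    have hfrr : ∀ y, r < ‖y‖ → fr y = 0 := fun y hy => (hr.zero y (hwrr y hy)).1
    have hdisjf : ∀ y, fl y = 0 ∨ fr y = 0 := fun y =>
      (hdisjw y).imp (fun h => (hl.zero y h).1) fun h => (hr.zero y h).1
    have hfn : ∀ y, ‖f₀ y‖ = w y := fun y => by
      rw [hf₀, norm_mul, norm_modulation, mul_one, Complex.norm_real, Real.norm_of_nonneg (hw0 y)]
    have iw : Integrable w := integrable_of_forall_norm_gt hw.continuous hwr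
    have iwl : Integrable wl := integrable_of_forall_norm_gt hwld.continuous hwlr
    have iwr : Integrable wr := integrable_of_forall_norm_gt hwrd.continuous hwrr
    have igf : ∀ g : Plane → ℂ, ContDiff ℝ 1 g → ∀ f : 𝓢(Plane, ℂ), (∀ y, r < ‖y‖ → f y = 0) →
        Integrable fun x => g x * f x := fun g hg f hf =>
      integrable_of_forall_norm_gt (r := r) (hg.continuous.mul f.continuous) fun y hy => by
        simp [hf y hy]
    have isq : ∀ f : 𝓢(Plane, ℂ), (∀ y, r < ‖y‖ → f y = 0) → Integrable fun x => ‖f x‖ ^ 2 :=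
      fun f hf => integrable_of_forall_norm_gt (r := r) (f.continuous.norm.pow 2) fun y hy => by
        simp [hf y hy]
    set C : Plane → ℝ := fun x => w x * (ψ (ℓ x) * Real.cos (ℓ x)) with hC
    have hCc : Continuous C := hw.continuous.mul ((hψ.contDiff.continuous.comp
      hℓd.continuous).mul (Real.continuous_cos.comp hℓd.continuous))
    have iC : Integrable C := integrable_of_forall_norm_gt (r := r) hCc fun y hy => by simp [hC, hwr y hy]
    have iSl : Integrable Sl := integrable_of_forall_norm_gt (r := r) hl.continuous fun y hy =>
      (hl.zero y (hwlr y hy)).2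
    have iSr : Integrable Sr := integrable_of_forall_norm_gt (r := r) hr.continuous fun y hy =>
      (hr.zero y (hwrr y hy)).2
    have hIw0 : 0 ≤ ∫ x, w x := integral_nonneg hw0
    have hIsum : (∫ x, wl x) + (∫ x, wr x) ≤ ∫ x, w x := by
      rw [← integral_add iwl iwr]; exact integral_mono (iwl.add iwr) iw hsum
    have hTadd : ∀ j < J, ∀ x, T j (f₀ + fl + fr) x = T j f₀ x + T j fl x + T j fr x :=
      fun j hj x => by rw [hT.add j hj, hT.add j hj]
    refine ⟨f₀ + fl + fr, fun x => Sl x + Sr x + C x,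
      ⟨(hl.continuous.add hr.continuous).add hCc, ?_, ?_, ?_, ?_, ?_, ?_⟩⟩
    · intro x hx
      have h1 : wl x = 0 := by simp [hwl, hx]
      have h2 : wr x = 0 := by simp [hwr', hx]
      simp [(hl.zero x h1).1, (hl.zero x h1).2, (hr.zero x h2).1, (hr.zero x h2).2, hf₀, hC, hx]
    · intro g hg
      have hgd := h𝒢d g hg
      have e : ∫ x, g x * (f₀ + fl + fr) x =
          (∫ x, g x * f₀ x) + (∫ x, g x * fl x) + ∫ x, g x * fr x := by
        rw [← integral_add_three (igf g hgd f₀ hf₀r) (igf g hgd fl hflr) (igf g hgd fr hfrr)]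
        refine integral_congr_ae (Eventually.of_forall fun x => ?_)
        simp only [add_apply]; ring
      rw [e]
      refine norm_add₃_le.trans ?_
      have h1 := horth g hg
      have h2 := hl.orth g (mem_insert_of_mem _ hg)
      have h3 := hr.orth g (mem_insert_of_mem _ hg)
      linarith
    · have il := igf g₀ hg₀d fl hflr
      have ir := igf g₀ hg₀d fr hfrr
      have e : ∫ x, ‖(f₀ + fl + fr) x‖ ^ 2 = (∫ x, ‖f₀ x‖ ^ 2) + (∫ x, ‖fl x‖ ^ 2) +
          (∫ x, ‖fr x‖ ^ 2) + 2 * (∫ x, g₀ x * fl x).re + 2 * (∫ x, g₀ x * fr x).re := by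
        have r1 : (∫ x, g₀ x * fl x).re = ∫ x, (g₀ x * fl x).re := (integral_re il).symm
        have r2 : (∫ x, g₀ x * fr x).re = ∫ x, (g₀ x * fr x).re := (integral_re ir).symm
        rw [r1, r2, ← integral_const_mul, ← integral_const_mul,
          ← integral_add_three (isq f₀ hf₀r) (isq fl hflr) (isq fr hfrr),
          ← integral_add_three (F := fun x => ‖f₀ x‖ ^ 2 + ‖fl x‖ ^ 2 + ‖fr x‖ ^ 2)
            (G := fun x => 2 * (g₀ x * fl x).re) (H := fun x => 2 * (g₀ x * fr x).re)
            (((isq f₀ hf₀r).add (isq fl hflr)).add (isq fr hfrr))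
            (il.re.const_mul 2) (ir.re.const_mul 2)]
        refine integral_congr_ae (Eventually.of_forall fun x => ?_)
        simp only [add_apply]
        rw [norm_add_sq_of_disjoint (hdisjf x), hf₀ x]
      have h0 : ∫ x, ‖f₀ x‖ ^ 2 ≤ ∫ x, w x := by
        refine integral_mono (isq f₀ hf₀r) iw fun x => ?_
        simp only [hfn]
        nlinarith [hw0 x, hw1 x]
      have h1 := (Complex.re_le_norm _).trans (hl.orth g₀ (mem_insert _ _))
      have h2 := (Complex.re_le_norm _).trans (hr.orth g₀ (mem_insert _ _))
      have h3 := hl.energy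
      have h4 := hr.energy
      rw [e]
      push_cast
      nlinarith [mul_le_mul_of_nonneg_left hIsum (Nat.cast_nonneg (α := ℝ) n)]
    · have e : ∫ x, (Sl x + Sr x + C x) = (∫ x, Sl x) + (∫ x, Sr x) + ∫ x, C x :=
        integral_add_three iSl iSr iC
      rw [e]
      have h1 := hl.lower
      have h2 := hr.lower
      have hqn : 0 ≤ q ^ n := pow_nonneg hq0 _
      have hqn1 : q ^ n ≤ 1 := pow_le_one₀ hq0 hq1
      have hqn1' : q ^ (n + 1) ≤ 1 := pow_le_one₀ hq0 hq1
      have hκn : 0 ≤ κ * n := mul_nonneg hκ (Nat.cast_nonneg _)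
      have h3 : q * (∫ x, w x) - 2 * η ≤ (∫ x, wl x) + ∫ x, wr x := by linarith
      have h4 := mul_le_mul_of_nonneg_left h3 (mul_nonneg hκn hqn)
      have h5 : κ * n * q ^ n * (2 * η) ≤ 2 * (δ / 8) := by
        calc κ * n * q ^ n * (2 * η) ≤ κ * n * 1 * (2 * η) := by gcongr
          _ = 2 * (κ * n * η) := by ring
          _ ≤ _ := by linarith
      have h6 : κ * q ^ (n + 1) * (∫ x, w x) ≤ κ * (∫ x, w x) := by
        calc _ ≤ κ * 1 * (∫ x, w x) := by gcongr
          _ = _ := by rw [mul_one]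
      have h7 : κ * n * q ^ n * (q * (∫ x, w x) - 2 * η) =
          κ * n * q ^ (n + 1) * (∫ x, w x) - κ * n * q ^ n * (2 * η) := by ring
      have h8 : κ * ((n + 1 : ℕ) : ℝ) * q ^ (n + 1) * (∫ x, w x) =
          κ * n * q ^ (n + 1) * (∫ x, w x) + κ * q ^ (n + 1) * (∫ x, w x) := by push_cast; ring
      rw [h8]
      linarith
    · intro x hx j hj
      -- The errors are proportional to the weights, and the weights of the children add up to at
      -- most w. So the relative error grows by ε per level instead of doubling.
      have hb1 : n * ε * (wl x + wr x) ≤ n * ε * w x :=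
        mul_le_mul_of_nonneg_left (hsum x) (by positivity)
      refine ⟨fun hja => ?_, fun hja => ?_⟩
      · have h1 := (has x hx j hj).1 (by omega)
        have h2 := (hl.outer x hx j hj).1 hja
        have h3 := (hr.outer x hx j hj).1 (by omega)
        have e : T j (f₀ + fl + fr) x - A * (f₀ + fl + fr) x =
            (T j f₀ x - A * f₀ x) + (T j fl x - A * fl x) + (T j fr x - A * fr x) := by
          rw [hTadd j hj]; simp only [add_apply]; ring
        rw [e]
        refine norm_add₃_le.trans ?_
        push_cast
        linarith
      · have h1 := (has x hx j hj).2 (by omega)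
        have h2 := (hl.outer x hx j hj).2 (by omega)
        have h3 := (hr.outer x hx j hj).2 (by omega)
        have e : T j (f₀ + fl + fr) x - B * (f₀ + fl + fr) x =
            (T j f₀ x - B * f₀ x) + (T j fl x - B * fl x) + (T j fr x - B * fr x) := by
          rw [hTadd j hj]; simp only [add_apply]; ring
        rw [e]
        refine norm_add₃_le.trans ?_
        push_cast
        linarith
    · intro x hx
      have hb1 : n * ε * (wl x + wr x) ≤ n * ε * w x :=
        mul_le_mul_of_nonneg_left (hsum x) (by positivity)
      by_cases hxl : wl x = 0
      · -- the operators of the right branch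
        obtain ⟨j, hj1, hj2, z, hz, hzb⟩ := hr.inner x hx
        have hjJ : j < J := by omega
        have h1 := (has x hx j hjJ).2 (by omega)
        have h2 := (hl.outer x hx j hjJ).2 hj1
        refine ⟨j, by omega, by omega, z, ?_, ?_⟩
        · have hC0 : C x = 0 := by
            have : C x = wl x * Real.cos (ℓ x) := by simp only [hC, hwl]; ring
            rw [this, hxl, zero_mul]
          rw [hC0, (hl.zero x hxl).2]; linarith
        · have e : T j (f₀ + fl + fr) x - B * (f₀ + fl + fr) x - (A - B) * z =
              (T j f₀ x - B * f₀ x) + (T j fl x - B * fl x) +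
              (T j fr x - B * fr x - (A - B) * z) := by
            rw [hTadd j hjJ]; simp only [add_apply]; ring
          rw [e]
          refine norm_add₃_le.trans ?_
          push_cast
          linarith
      · -- the operators of the left branch
        have hxr : wr x = 0 := (hdisjw x).resolve_left hxl
        obtain ⟨j, hj1, hj2, z, hz, hzb⟩ := hl.inner x hx
        have hjJ : j < J := by omega
        have h1 := (has x hx j hjJ).1 (by omega)
        -- The operators are nonlocal, so T j f_r need not vanish where f_r does; the outer estimate
        -- makes it small there.
        have h2 := (hr.outer x hx j hjJ).1 hj2
        have hfr0 := (hr.zero x hxr).1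
        have hcos : 0 ≤ Real.cos (ℓ x) := by
          by_contra hcon
          exact hxl (by simp only [hwl, hψ.eq_zero _ (not_le.1 hcon).le, mul_zero])
        refine ⟨j, by omega, by omega, z + f₀ x, ?_, ?_⟩
        · have hre : (f₀ x).re = w x * Real.cos (ℓ x) := by
            rw [hf₀, Complex.re_ofReal_mul, modulation, Complex.exp_ofReal_mul_I_re]
          have hCle : C x ≤ w x * Real.cos (ℓ x) := by
            refine mul_le_mul_of_nonneg_left ?_ (hw0 x)
            exact mul_le_of_le_one_left hcos (hψ.le_one _)
          rw [Complex.add_re, hre, (hr.zero x hxr).2]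
          linarith
        · have e : T j (f₀ + fl + fr) x - B * (f₀ + fl + fr) x - (A - B) * (z + f₀ x) =
              (T j f₀ x - A * f₀ x) + (T j fl x - B * fl x - (A - B) * z) +
              (T j fr x - A * fr x) := by
            rw [hTadd j hjJ]; simp only [add_apply, hfr0]; ring
          rw [e]
          refine norm_add₃_le.trans ?_
          push_cast
          linarith

/-! ### Separated Hilbert transforms as ordered multipliers. -/

/-- The Hilbert transforms with well separated parameters form an ordered family of multipliers. -/
theorem exists_isOrderedMultiplier {b₀ : ℝ} (b₁ r₀ r₁ : ℝ) (hb₀ : 1 < b₀) (hr₀ : 0 < r₀) {ε : ℝ}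
    (hε : 0 < ε) :
    ∃ Q ≥ 1, ∀ b cp cm : ℝ, b₀ ≤ b → b ≤ b₁ → cp ≠ 0 → cm ≠ 0 → |cp / cm| ∈ Icc r₀ r₁ →
      ∀ (r : ℝ) (J : ℕ) (v : ℕ → ℝ), (∀ j < J, 0 < v j) → (∀ j, j + 1 < J → Q * v j ≤ v (j + 1)) →
      ∃ s : ℕ → ℝ, IsOrderedMultiplier (fun j f x => curveHilbert b cp cm (v j) f x) J linearValue
        (powerValue b cp cm) b r ε s := by
  obtain ⟨H, hH, h⟩ := exists_threshold_curveHilbert b₁ hb₀ hε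
  -- One factor H serves each regime, and r₁ + r₀⁻¹ bounds the larger of |c₊|, |c₋| by a multiple of
  -- either one.
  refine ⟨max 1 (H ^ 2 * (r₁ + r₀⁻¹)), le_max_left _ _, ?_⟩
  intro b cp cm hb hb' hp hm hr r J v hv hvQ
  have hb1 : 1 < b := hb₀.trans_le hb
  have hp0 : 0 < |cp| := abs_pos.2 hp
  have hm0 : 0 < |cm| := abs_pos.2 hm
  have hH0 : 0 < H := by linarith
  have hr₀i : 0 < r₀⁻¹ := inv_pos.2 hr₀
  have hr₁ : 0 < r₁ := hr₀.trans_le (hr.1.trans hr.2)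
  set m := |cp| + |cm| with hmdef
  have hm' : 0 < m := by positivity
  rw [abs_div] at hr
  have h1 : |cp| ≤ r₁ * |cm| := by rw [← div_le_iff₀ hm0]; exact hr.2
  have h2 : |cm| ≤ r₀⁻¹ * |cp| := by
    rw [← div_eq_inv_mul, le_div_iff₀ hr₀, mul_comm]
    rw [← le_div_iff₀ hm0]; exact hr.1
  -- The largest s for which v_k, and hence each smaller parameter, is still in the linear regime. A
  -- jump by the factor Q to v_{k+1} then lands in the regime of degree b.
  refine ⟨fun k => 1 / (H * max |cp| |cm| * v k), ⟨?_, ?_⟩⟩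
  · intro j hj f g x
    exact curveHilbert_add hb1 cp cm (hv j hj) f g x
  have hmono : ∀ i j, i ≤ j → j < J → v i ≤ v j := by
    intro i j hij
    induction j, hij using Nat.le_induction with
    | base => intro _; exact le_rfl
    | succ j _ ih =>
      intro hj
      refine (ih (by omega)).trans (le_trans ?_ (hvQ j hj))
      exact le_mul_of_one_le_left (hv j (by omega)).le (le_max_left _ _)
  intro k hk G hG hG0 hG1 hGr δ hδ
  have hvk := hv k (by omega)
  set c := max |cp| |cm| with hc
  have hc0 : 0 < c := lt_max_of_lt_left hp0
  have hs : 0 < 1 / (H * c * v k) := by positivity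
  have hall : ∀ᶠ R in atTop, ∀ j ∈ Finset.range J, ∀ f : 𝓢(Plane, ℂ),
      (∀ y, f y = G y * modulation b (1 / (H * c * v k)) R y) → ∀ x, ‖x‖ ≤ r →
        ((H * (1 / (H * c * v k) * v j * |cp|) ≤ 1 → H * (1 / (H * c * v k) * v j * |cm|) ≤ 1 →
          ‖curveHilbert b cp cm (v j) f x - linearValue * f x‖ ≤ ε * G x + δ) ∧
        (H ≤ 1 / (H * c * v k) * v j * |cp| → H ≤ 1 / (H * c * v k) * v j * |cm| →
          ‖curveHilbert b cp cm (v j) f x - powerValue b cp cm * f x‖ ≤ ε * G x + δ)) := by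
    rw [Filter.eventually_all_finset]
    intro j hj
    exact h b cp cm hb hb' hp hm (v j) _ r (hv j (Finset.mem_range.1 hj)) hs G hG hG0 hG1 hGr δ hδ
  filter_upwards [hall] with R hR f hf x hx j hj
  have key := hR j (Finset.mem_range.2 hj) f hf x hx
  have hvj := hv j hj
  refine ⟨fun hjk => key.1 ?_ ?_, fun hkj => key.2 ?_ ?_⟩
  · have := hmono j k hjk (by omega)
    have e : H * (1 / (H * c * v k) * v j * |cp|) = (v j * |cp|) / (v k * c) := by field_simp
    rw [e, div_le_one (by positivity)]
    exact mul_le_mul this (le_max_left _ _) hp0.le hvk.le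
  · have := hmono j k hjk (by omega)
    have e : H * (1 / (H * c * v k) * v j * |cm|) = (v j * |cm|) / (v k * c) := by field_simp
    rw [e, div_le_one (by positivity)]
    exact mul_le_mul this (le_max_right _ _) hm0.le hvk.le
  all_goals
    have hstep : H ^ 2 * (r₁ + r₀⁻¹) * v k ≤ v j :=
      (mul_le_mul_of_nonneg_right (le_max_right 1 _) hvk.le).trans
        ((hvQ k hk).trans (hmono (k + 1) j hkj hj))
  · have e : 1 / (H * c * v k) * v j * |cp| = (v j * |cp|) / (H * c * v k) := by field_simp
    rw [e, le_div_iff₀ (by positivity)]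
    have hcle : c ≤ (r₁ + r₀⁻¹) * |cp| := by
      refine max_le ?_ (h2.trans (by nlinarith))
      have : 1 ≤ r₁ + r₀⁻¹ := by
        have h3 : r₀ ≤ r₁ := hr.1.trans hr.2
        rcases le_total 1 r₀ with h4 | h4
        · linarith
        · linarith [(one_le_inv₀ hr₀).2 h4]
      nlinarith
    calc H * (H * c * v k) = H ^ 2 * c * v k := by ring
      _ ≤ H ^ 2 * ((r₁ + r₀⁻¹) * |cp|) * v k := by gcongr
      _ = H ^ 2 * (r₁ + r₀⁻¹) * v k * |cp| := by ring
      _ ≤ v j * |cp| := by gcongr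
  · have e : 1 / (H * c * v k) * v j * |cm| = (v j * |cm|) / (H * c * v k) := by field_simp
    rw [e, le_div_iff₀ (by positivity)]
    have hcle : c ≤ (r₁ + r₀⁻¹) * |cm| := by
      refine max_le (h1.trans (by nlinarith)) ?_
      have : 1 ≤ r₁ + r₀⁻¹ := by
        have h3 : r₀ ≤ r₁ := hr.1.trans hr.2
        rcases le_total 1 r₀ with h4 | h4
        · linarith
        · linarith [(one_le_inv₀ hr₀).2 h4]
      nlinarith
    calc H * (H * c * v k) = H ^ 2 * c * v k := by ring
      _ ≤ H ^ 2 * ((r₁ + r₀⁻¹) * |cm|) * v k := by gcongr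
      _ = H ^ 2 * (r₁ + r₀⁻¹) * v k * |cm| := by ring
      _ ≤ v j * |cm| := by gcongr

/-! ### From a test function to the maximal operator norm. -/

theorem eLpNorm_two_sq {E : Type*} [TopologicalSpace E] [ContinuousENorm E] (F : Plane → E) :
    eLpNorm F 2 volume ^ 2 = ∫⁻ x, ‖F x‖ₑ ^ 2 := by
  have := eLpNorm_nnreal_pow_eq_lintegral (f := F) (p := 2) (μ := volume) (by norm_num)
  simpa using this

theorem maximalL2Norm_smul {b cp cm : ℝ} {M : ℕ} {u : ℕ → ℝ} (hb : 1 < b)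
    (hu : ∀ j ∈ Icc 1 M, 0 < u j) (c : ℂ) (f : 𝓢(Plane, ℂ)) :
    maximalL2Norm b cp cm M u (c • f) = ‖c‖ₑ * maximalL2Norm b cp cm M u f := by
  have e : ∀ x, (⨆ j ∈ Icc 1 M, ‖curveHilbert b cp cm (u j) (c • f) x‖ₑ) =
      ‖c‖ₑ * ⨆ j ∈ Icc 1 M, ‖curveHilbert b cp cm (u j) f x‖ₑ := by
    intro x
    simp only [ENNReal.mul_iSup]
    refine iSup_congr fun j => iSup_congr fun hj => ?_
    rw [curveHilbert_smul hb cp cm (hu j hj), enorm_mul]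
  have h2 : maximalL2Norm b cp cm M u (c • f) ^ 2 = (‖c‖ₑ * maximalL2Norm b cp cm M u f) ^ 2 := by
    rw [maximalL2Norm, mul_pow, maximalL2Norm, eLpNorm_two_sq, eLpNorm_two_sq]
    simp only [e, enorm_eq_self, mul_pow]
    exact lintegral_const_mul' _ _ (by simp)
  exact (ENNReal.pow_right_strictMono two_ne_zero).injective h2

theorem SchwartzMap.integrable_norm_sq (f : 𝓢(Plane, ℂ)) : Integrable fun x => ‖f x‖ ^ 2 :=
  (f.memLp 2).integrable_norm_pow (by norm_num)

theorem eLpNorm_schwartz_eq (f : 𝓢(Plane, ℂ)) :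
    eLpNorm f 2 volume = ENNReal.ofReal (√(∫ x, ‖f x‖ ^ 2)) := by
  have h1 : ∫⁻ x, ‖f x‖ₑ ^ 2 = ENNReal.ofReal (∫ x, ‖f x‖ ^ 2) := by
    rw [ofReal_integral_eq_lintegral_ofReal f.integrable_norm_sq
      (Eventually.of_forall fun x => by positivity)]
    refine lintegral_congr fun x => ?_
    rw [ENNReal.ofReal_pow (norm_nonneg _), ofReal_norm]
  refine (ENNReal.pow_right_strictMono two_ne_zero).injective ?_
  beta_reduce
  rw [eLpNorm_two_sq, h1, ← ENNReal.ofReal_pow (Real.sqrt_nonneg _),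
    Real.sq_sqrt (integral_nonneg fun x => by positivity)]

/-- A lower bound for the maximal operator norm, from a test function and a pointwise lower bound
for its maximal function on a ball. -/
theorem ofReal_le_iSup_maximalL2Norm {b cp cm : ℝ} {M : ℕ} {u : ℕ → ℝ} (hb : 1 < b)
    (hu : ∀ j ∈ Icc 1 M, 0 < u j) (f : 𝓢(Plane, ℂ)) {r : ℝ} {g : Plane → ℝ} (hg : Continuous g)
    (hgf : ∀ x, ‖x‖ ≤ r → ∃ j ∈ Icc 1 M, g x ≤ ‖curveHilbert b cp cm (u j) f x‖)
    {m E W Y : ℝ} (hm : 0 < m) (hmg : m ≤ ∫ x in Metric.closedBall (0 : Plane) r, g x)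
    (hE : ∫ x, ‖f x‖ ^ 2 ≤ E) (hW : volume.real (Metric.closedBall (0 : Plane) r) ≤ W)
    (hW0 : 0 < W) (hY0 : 0 ≤ Y) (hY : Y ^ 2 * (E * W) ≤ m ^ 2) :
    ENNReal.ofReal Y ≤
      ⨆ (f : 𝓢(Plane, ℂ)) (_ : eLpNorm f 2 volume = 1), maximalL2Norm b cp cm M u f := by
  set K := Metric.closedBall (0 : Plane) r with hK
  have hKm : MeasurableSet K := Metric.isClosed_closedBall.measurableSet
  have hKc : IsCompact K := isCompact_closedBall _ _
  have hKx : ∀ x ∈ K, ‖x‖ ≤ r := fun x hx => by simpa [hK] using hx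
  set p : Plane → ℝ := fun x => max (g x) 0 with hp
  have hpc : Continuous p := hg.max continuous_const
  have hp0 : ∀ x, 0 ≤ p x := fun x => le_max_right _ _
  have ip : IntegrableOn p K := hpc.continuousOn.integrableOn_compact hKc
  have ip2 : IntegrableOn (fun x => p x ^ 2) K := (hpc.pow 2).continuousOn.integrableOn_compact hKc
  have hmp : m ≤ ∫ x in K, p x :=
    hmg.trans (integral_mono (hg.continuousOn.integrableOn_compact hKc) ip fun x => le_max_left _ _)
  -- Cauchy-Schwarz
  have hCS : m ^ 2 / W ≤ ∫ x in K, p x ^ 2 := by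
    -- Cauchy–Schwarz in the form p² ≥ 2λp - λ² with λ = m/W, which needs only an upper bound W for
    -- the measure of the ball.
    have h1 : ∫ x in K, (2 * (m / W) * p x - (m / W) ^ 2) ≤ ∫ x in K, p x ^ 2 :=
      integral_mono ((ip.const_mul _).sub (integrableOn_const hKc.measure_lt_top.ne (by simp))) ip2
        fun x => by simp only; nlinarith [sq_nonneg (p x - m / W)]
    rw [integral_sub (ip.const_mul _) (integrableOn_const hKc.measure_lt_top.ne (by simp)),
      integral_const_mul, setIntegral_const, smul_eq_mul] at h1
    refine le_trans ?_ h1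
    have h2 : volume.real K * (m / W) ^ 2 ≤ W * (m / W) ^ 2 := by gcongr
    have h3 : 2 * (m / W) * m ≤ 2 * (m / W) * ∫ x in K, p x := by gcongr
    have h4 : 2 * (m / W) * m - W * (m / W) ^ 2 = m ^ 2 / W := by field_simp; ring
    linarith
  set E' := ∫ x, ‖f x‖ ^ 2 with hE'
  have hE'0 : 0 ≤ E' := integral_nonneg fun x => by positivity
  -- If f vanished, so would its transforms, and g ≤ 0 on the ball would contradict m > 0. Hence f
  -- can be normalised.
  have hE'pos : 0 < E' := by
    refine lt_of_le_of_ne hE'0 fun h0 => ?_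
    have hf0 : f = 0 := by
      have h1 := (integral_eq_zero_iff_of_nonneg (fun x => by positivity)
        f.integrable_norm_sq).1 h0.symm
      have h2 := (Continuous.ae_eq_iff_eq volume (f.continuous.norm.pow 2)
        (continuous_const (y := (0:ℝ)))).1 h1
      ext x
      have := congrFun h2 x
      simpa using this
    have h3 : ∀ x ∈ K, g x ≤ 0 := fun x hx => by
      obtain ⟨j, hj, hgj⟩ := hgf x (hKx x hx)
      have := curveHilbert_smul hb cp cm (hu j hj) 0 f x
      rw [zero_smul, zero_mul] at this
      rwa [hf0, this, norm_zero] at hgj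
    have h4 := setIntegral_nonpos (μ := volume) hKm h3
    linarith
  have hsq : 0 < √E' := Real.sqrt_pos.2 hE'pos
  set c : ℂ := (((√E')⁻¹ : ℝ) : ℂ) with hc
  have hcn : ‖c‖ₑ = ENNReal.ofReal (√E')⁻¹ := by
    rw [← ofReal_norm, hc, Complex.norm_real, Real.norm_of_nonneg (by positivity)]
  have hnorm : eLpNorm (c • f) 2 volume = 1 := by
    have : (⇑(c • f) : Plane → ℂ) = c • ⇑f := rfl
    rw [this, eLpNorm_const_smul, eLpNorm_schwartz_eq, hcn, ← ENNReal.ofReal_mul (by positivity),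
      inv_mul_cancel₀ hsq.ne', ENNReal.ofReal_one]
  refine le_trans ?_ (le_iSup₂_of_le (c • f) hnorm le_rfl)
  rw [maximalL2Norm_smul hb hu, hcn]
  have hlow : ENNReal.ofReal (Y * √E') ≤ maximalL2Norm b cp cm M u f := by
    refine (ENNReal.pow_le_pow_left_iff two_ne_zero).1 ?_
    rw [maximalL2Norm, eLpNorm_two_sq, ← ENNReal.ofReal_pow (by positivity)]
    calc ENNReal.ofReal ((Y * √E') ^ 2) ≤ ENNReal.ofReal (∫ x in K, p x ^ 2) := by
          refine ENNReal.ofReal_le_ofReal (le_trans ?_ hCS)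
          rw [mul_pow, Real.sq_sqrt hE'0, le_div_iff₀ hW0]
          refine le_trans ?_ hY
          rw [mul_assoc]
          gcongr
      _ = ∫⁻ x in K, ENNReal.ofReal (p x ^ 2) :=
          ofReal_integral_eq_lintegral_ofReal ip2 (Eventually.of_forall fun x => by positivity)
      _ ≤ ∫⁻ x in K, ‖⨆ j ∈ Icc 1 M, ‖curveHilbert b cp cm (u j) f x‖ₑ‖ₑ ^ 2 := by
          refine setLIntegral_mono' hKm fun x hx => ?_
          rw [ENNReal.ofReal_pow (hp0 x)]
          gcongr
          obtain ⟨j, hj, hgj⟩ := hgf x (hKx x hx)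
          rw [enorm_eq_self]
          refine le_trans ?_ (le_iSup₂_of_le j hj le_rfl)
          rw [← ofReal_norm]
          exact ENNReal.ofReal_le_ofReal (max_le hgj (norm_nonneg _))
      _ ≤ _ := setLIntegral_le_lintegral _ _
  calc ENNReal.ofReal Y = ENNReal.ofReal (√E')⁻¹ * ENNReal.ofReal (Y * √E') := by
        rw [← ENNReal.ofReal_mul (by positivity)]
        congr 1; field_simp
    _ ≤ _ := by gcongr

theorem exists_planeBump : ∃ φ : Plane → ℝ, ContDiff ℝ (⊤ : ℕ∞) φ ∧ (∀ y, 0 ≤ φ y) ∧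
    (∀ y, φ y ≤ 1) ∧ (∀ y, 2 < ‖y‖ → φ y = 0) ∧ 0 < ∫ x, φ x := by
  set B : ContDiffBump (0 : Plane) := ⟨1, 2, by norm_num, by norm_num⟩
  exact ⟨B, B.contDiff, fun y => B.nonneg, fun y => B.le_one,
    fun y hy => B.zero_of_le_dist (by simpa using hy.le), B.integral_pos⟩

theorem closedBall_two_pos : 0 < volume.real (Metric.closedBall (0 : Plane) 2) :=
  ENNReal.toReal_pos (Metric.measure_closedBall_pos volume _ (by norm_num)).ne'
    measure_closedBall_lt_top.ne

/-! ### Lower bounds from one bump and from the tree. -/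

/-- A single Hilbert transform already has norm bounded from below. -/
theorem exists_pos_le_iSup_maximalL2Norm {b₀ : ℝ} (b₁ : ℝ) (hb₀ : 1 < b₀) :
    ∃ Y > 0, ∀ b cp cm : ℝ, b₀ ≤ b → b ≤ b₁ → cp ≠ 0 → cm ≠ 0 →
      ∀ (M : ℕ) (u : ℕ → ℝ), 1 ≤ M → (∀ j ∈ Icc 1 M, 0 < u j) → ENNReal.ofReal Y ≤
        ⨆ (f : 𝓢(Plane, ℂ)) (_ : eLpNorm f 2 volume = 1), maximalL2Norm b cp cm M u f := by
  obtain ⟨φ, hφ, hφ0, hφ1, hφr, hI⟩ := exists_planeBump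
  have hD := dirichletConst_pos
  set D := dirichletConst with hDdef
  set I := ∫ x, φ x with hIdef
  set W := volume.real (Metric.closedBall (0 : Plane) 2) with hW
  have hW0 : 0 < W := closedBall_two_pos
  obtain ⟨H, hH, h⟩ := exists_threshold_curveHilbert b₁ hb₀ (ε := D / 2) (by positivity)
  have hH0 : 0 < H := by linarith
  refine ⟨D * √(I / W), by positivity, fun b cp cm hb hb' hp hm M u hM hu => ?_⟩
  have hb1 : 1 < b := hb₀.trans_le hb
  have h1M : 1 ∈ Icc 1 M := ⟨le_rfl, hM⟩
  have hu1 := hu 1 h1M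
  set c := max |cp| |cm| with hc
  have hc0 : 0 < c := lt_max_of_lt_left (abs_pos.2 hp)
  -- This puts the first parameter in the linear regime, where |A| = 2D; the error Dφ/2 leaves 3Dφ/2
  -- - δ. The choice of δ costs DI/2 after integration, so the integral is DI.
  set s := 1 / (H * c * u 1) with hs
  have hs0 : 0 < s := by positivity
  set δ := D * I / (2 * W) with hδ
  obtain ⟨R, hR⟩ := (h b cp cm hb hb' hp hm (u 1) s 2 hu1 hs0 φ (hφ.of_le (by exact_mod_cast le_top))
    hφ0 hφ1 hφr δ (by positivity)).exists
  obtain ⟨f, hf⟩ := exists_schwartz_modulated hφ hφr b s R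
  have hfn : ∀ x, ‖f x‖ = φ x := fun x => by
    rw [hf, norm_mul, norm_modulation, mul_one, Complex.norm_real, Real.norm_of_nonneg (hφ0 x)]
  have iφ : Integrable φ := integrable_of_forall_norm_gt hφ.continuous hφr
  have hle : ∀ t, t ≤ c → H * (s * u 1 * t) ≤ 1 := fun t ht => by
    have : H * (s * u 1 * t) = t / c := by rw [hs]; field_simp
    rw [this, div_le_one hc0]; exact ht
  refine ofReal_le_iSup_maximalL2Norm (r := 2) (g := fun x => 3 / 2 * D * φ x - δ) (m := D * I)
    (E := I) (W := W) hb1 hu f ((hφ.continuous.const_mul _).sub continuous_const) ?_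
    (by positivity) ?_ ?_ le_rfl hW0 (by positivity) ?_
  · intro x hx
    refine ⟨1, h1M, ?_⟩
    have h1 := (hR f hf x hx).1 (hle _ (le_max_left _ _)) (hle _ (le_max_right _ _))
    have h2 := norm_sub_norm_le (linearValue * f x) (curveHilbert b cp cm (u 1) f x)
    rw [norm_sub_rev, norm_mul, norm_linearValue, hfn] at h2
    rw [← hDdef] at h2
    linarith
  · have hset : ∫ x in Metric.closedBall (0 : Plane) 2, φ x = I :=
      setIntegral_eq_integral_of_forall_compl_eq_zero fun x hx => hφr x (by simpa using hx)
    rw [integral_sub (iφ.const_mul _).integrableOn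
      (integrableOn_const measure_closedBall_lt_top.ne (by simp)), integral_const_mul, hset,
      setIntegral_const, smul_eq_mul, ← hW]
    have : W * δ = D * I / 2 := by rw [hδ]; field_simp
    rw [this]; linarith
  · refine integral_mono f.integrable_norm_sq iφ fun x => ?_
    simp only [hfn]
    nlinarith [hφ0 x, hφ1 x]
  · rw [mul_pow, Real.sq_sqrt (by positivity)]
    apply le_of_eq; field_simp

/-- The tree construction gives a lower bound `c √n` if there are `2 ^ n` well separated
parameters. -/
theorem exists_sqrt_le_iSup_maximalL2Norm {b₀ : ℝ} (b₁ r₀ r₁ : ℝ) (hb₀ : 1 < b₀) (hr₀ : 0 < r₀) :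
    ∃ c > 0, ∃ n₀ : ℕ, 1 ≤ n₀ ∧ ∃ Q ≥ 1, ∀ b cp cm : ℝ, b₀ ≤ b → b ≤ b₁ → cp ≠ 0 → cm ≠ 0 →
      |cp / cm| ∈ Icc r₀ r₁ → ∀ (M : ℕ) (u : ℕ → ℝ), (∀ j ∈ Icc 1 M, 0 < u j) →
      ∀ (n : ℕ) (i : ℕ → ℕ), n₀ ≤ n → (∀ j < 2 ^ n, i j ∈ Icc 1 M) →
      (∀ j, j + 1 < 2 ^ n → Q * u (i j) ≤ u (i (j + 1))) →
      ENNReal.ofReal (c * √n) ≤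
        ⨆ (f : 𝓢(Plane, ℂ)) (_ : eLpNorm f 2 volume = 1), maximalL2Norm b cp cm M u f := by
  obtain ⟨φ, hφ, hφ0, hφ1, hφr, hI⟩ := exists_planeBump
  have hD := dirichletConst_pos
  set I := ∫ x, φ x with hIdef
  set W := volume.real (Metric.closedBall (0 : Plane) 2) with hW
  have hW0 : 0 < W := closedBall_two_pos
  set d := 2 * dirichletConst * (1 - 1 / b₀) with hd
  have hd0 : 0 < d := by
    have : 1 / b₀ < 1 := by rw [div_lt_one (by linarith)]; exact hb₀
    have : 0 < 1 - 1 / b₀ := by linarith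
    positivity
  set β := |Real.log r₀| + |Real.log r₁| + 2 * dirichletConst with hβ
  have hβ0 : 0 < β := by positivity
  -- The main term of the integral is n·dI/32. Four losses of at most n·dI/256 each, from ε, from δ
  -- and from the two halves of the bound for Bf, leave n·dI/64.
  set ε := d * I / (256 * W) with hε
  have hε0 : 0 < ε := by positivity
  -- The parameter in |f| ≤ t/2 + |f|²/(2t): the quadratic part, of integral at most n(I + 1)/(2t),
  -- becomes a small multiple of n, and the constant part is absorbed once n ≥ n₀.
  set t := 128 * β * (I + 1) / (d * I) with ht
  have ht0 : 0 < t := by positivity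
  obtain ⟨Q, hQ, h⟩ := exists_isOrderedMultiplier b₁ r₀ r₁ hb₀ hr₀ hε0
  obtain ⟨n₀, hn₀⟩ := exists_nat_ge (β * t * W * 128 / (d * I))
  refine ⟨d * I / (64 * √((I + 1) * W)), by positivity, max n₀ 1, le_max_right _ _, Q, hQ, ?_⟩
  intro b cp cm hb hb' hp hm hr M u hu n i hn hi hiQ
  have hb1 : 1 < b := hb₀.trans_le hb
  have hn1 : 1 ≤ n := (le_max_right _ _).trans hn
  have hnR : (1:ℝ) ≤ n := by exact_mod_cast hn1
  have hnβ : β * t * W / 2 ≤ n * (d * I / 256) := by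
    have h1 : β * t * W * 128 / (d * I) ≤ n :=
      hn₀.trans (by exact_mod_cast (le_max_left _ _).trans hn)
    rw [div_le_iff₀ (by positivity)] at h1
    linarith
  obtain ⟨s, hT⟩ := h b cp cm hb hb' hp hm hr 2 (2 ^ n) (fun j => u (i j))
    (fun j hj => hu _ (hi j hj)) hiQ
  -- the cutoff
  set η : ℝ := min (1 / 4) (1 / (2 * n)) with hη
  have hη0 : 0 < η := by positivity
  have hη4 : η ≤ 1 / 4 := min_le_left _ _
  have hηn : n * η ≤ 1 / 2 := by
    calc (n:ℝ) * η ≤ n * (1 / (2 * n)) := by gcongr; exact min_le_right _ _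
      _ = 1 / 2 := by field_simp
  obtain ⟨ψ, q, κ, hψ, hq, hq1, hκ⟩ := exists_isCosCutoff hη0
  have hq0 : 0 ≤ q := by linarith
  have hκ8 : 1 / 8 ≤ κ := by linarith
  have hqn : 1 / 2 ≤ q ^ n := by
    have h1 := one_add_mul_le_pow (a := -η) (by linarith) n
    have h2 : (1 + -η) ^ n ≤ q ^ n := pow_le_pow_left₀ (by linarith) (by linarith) n
    linarith
  set δ := min (min 1 (I / 32)) (d * I / (256 * W)) with hδ
  have hδ0 : 0 < δ := by positivity
  have hδ1 : δ ≤ 1 := (min_le_left _ _).trans (min_le_left _ _)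
  have hδI : δ ≤ I / 32 := (min_le_left _ _).trans (min_le_right _ _)
  have hδW : W * δ ≤ d * I / 256 := by
    calc W * δ ≤ W * (d * I / (256 * W)) := by gcongr; exact min_le_right _ _
      _ = _ := by field_simp
  obtain ⟨f, S, hfS⟩ := hT.exists_isTreeFunction hψ hε0.le hq0 hq1 (by linarith : 0 ≤ κ) n 0
    (by simp) φ hφ hφ0 hφ1 hφr ∅ finite_empty (by simp) δ hδ0
  set A := linearValue with hA
  set Bv := powerValue b cp cm with hBv
  have hAB : d ≤ ‖A - Bv‖ := le_norm_linearValue_sub_powerValue hb₀ hb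
  have hBβ : ‖Bv‖ ≤ β := norm_powerValue_le hb1 hr₀ hr
  have hAB0 : 0 < ‖A - Bv‖ := hd0.trans_le hAB
  set g : Plane → ℝ := fun x => ‖A - Bv‖ * S x - β * (t / 2 + ‖f x‖ ^ 2 / (2 * t)) - (n * ε + δ)
    with hg
  have hgc : Continuous g := by
    have := hfS.continuous
    have := f.continuous
    fun_prop
  have hSr : ∀ x, 2 < ‖x‖ → S x = 0 := fun x hx => (hfS.zero x (hφr x hx)).2
  have iS : Integrable S := integrable_of_forall_norm_gt hfS.continuous hSr
  have hSI : n * I / 32 ≤ ∫ x, S x := by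
    have h1 := hfS.lower
    have h2 : 1 / 8 * n * (1 / 2) * I ≤ κ * n * q ^ n * I := by gcongr
    have h3 : I / 32 ≤ n * I / 32 := by rw [mul_div_assoc]; exact le_mul_of_one_le_left (by positivity) hnR
    linarith
  have hE : ∫ x, ‖f x‖ ^ 2 ≤ n * (I + 1) := by
    have := hfS.energy
    linarith
  refine ofReal_le_iSup_maximalL2Norm (r := 2) (g := g) (m := n * (d * I / 64))
    (E := n * (I + 1)) (W := W) hb1 hu f hgc ?_ (by positivity) ?_ hE le_rfl hW0 (by positivity) ?_
  · intro x hx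
    obtain ⟨j, _, hj, z, hz, hb⟩ := hfS.inner x hx
    refine ⟨i j, hi j (by simpa using hj), ?_⟩
    set Tf := curveHilbert b cp cm (u (i j)) f x with hTf
    have h1 : ‖(A - Bv) * z‖ ≤ ‖Tf‖ + ‖Bv * f x‖ + ‖Tf - Bv * f x - (A - Bv) * z‖ := by
      calc ‖(A - Bv) * z‖ = ‖(Tf - Bv * f x) - (Tf - Bv * f x - (A - Bv) * z)‖ := by
            rw [sub_sub_cancel]
        _ ≤ ‖Tf - Bv * f x‖ + ‖Tf - Bv * f x - (A - Bv) * z‖ := norm_sub_le _ _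
        _ ≤ _ := by gcongr; exact norm_sub_le _ _
    have h2 : ‖A - Bv‖ * S x ≤ ‖(A - Bv) * z‖ := by
      rw [norm_mul]
      gcongr
      exact hz.trans (Complex.re_le_norm z)
    have h3 : ‖Bv * f x‖ ≤ β * (t / 2 + ‖f x‖ ^ 2 / (2 * t)) := by
      rw [norm_mul]
      gcongr
      have : 0 ≤ (‖f x‖ - t) ^ 2 / (2 * t) := by positivity
      have e : (‖f x‖ - t) ^ 2 / (2 * t) = t / 2 + ‖f x‖ ^ 2 / (2 * t) - ‖f x‖ := by
        field_simp; ring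
      linarith
    have h4 : n * ε * φ x ≤ n * ε := mul_le_of_le_one_right (by positivity) (hφ1 x)
    simp only [hg]
    have h5 : ‖Tf - Bv * f x - (A - Bv) * z‖ ≤ n * ε * φ x + δ := hb
    linarith
  · set K := Metric.closedBall (0 : Plane) 2 with hK
    have hKt : volume K ≠ ∞ := measure_closedBall_lt_top.ne
    have icst : ∀ y : ℝ, IntegrableOn (fun _ : Plane => y) K := fun y =>
      integrableOn_const hKt (by simp)
    have isq : IntegrableOn (fun x => ‖f x‖ ^ 2) K := f.integrable_norm_sq.integrableOn
    have hsetS : ∫ x in K, S x = ∫ x, S x :=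
      setIntegral_eq_integral_of_forall_compl_eq_zero fun x hx => hSr x (by simpa [hK] using hx)
    have hsetf : ∫ x in K, ‖f x‖ ^ 2 ≤ n * (I + 1) :=
      (setIntegral_le_integral f.integrable_norm_sq
        (Eventually.of_forall fun x => by positivity)).trans hE
    have e : ∫ x in K, g x = ‖A - Bv‖ * (∫ x, S x) -
        β * (W * (t / 2) + (∫ x in K, ‖f x‖ ^ 2) / (2 * t)) - W * (n * ε + δ) := by
      have i1 : IntegrableOn (fun x => ‖A - Bv‖ * S x) K := (iS.const_mul _).integrableOn
      have i2 : IntegrableOn (fun x => β * (t / 2 + ‖f x‖ ^ 2 / (2 * t))) K :=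
        ((icst (t / 2)).add (isq.div_const _)).const_mul β
      have e2 : ∫ x in K, (t / 2 + ‖f x‖ ^ 2 / (2 * t)) =
          W * (t / 2) + (∫ x in K, ‖f x‖ ^ 2) / (2 * t) := by
        rw [integral_add (icst (t / 2)) (isq.div_const _), setIntegral_const, smul_eq_mul,
          integral_div]
      have e3 : ∫ x in K, (n * ε + δ) = W * (n * ε + δ) := by
        rw [setIntegral_const, smul_eq_mul]
      rw [← e2, ← e3, ← hsetS, ← integral_const_mul, ← integral_const_mul, ← integral_sub i1 i2]
      exact integral_sub (i1.sub i2) (icst _)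
    rw [e]
    have h1 : d * (n * I / 32) ≤ ‖A - Bv‖ * ∫ x, S x :=
      mul_le_mul hAB hSI (by positivity) hAB0.le
    have h2 : β * ((∫ x in K, ‖f x‖ ^ 2) / (2 * t)) ≤ n * (d * I / 256) := by
      calc _ ≤ β * ((n * (I + 1)) / (2 * t)) := by gcongr
        _ = n * (d * I / 256) := by rw [ht]; field_simp; norm_num
    have h3 : W * ε = d * I / 256 := by rw [hε]; field_simp
    have h4 : W * (n * ε + δ) ≤ n * (d * I / 256) + n * (d * I / 256) := by
      have : d * I / 256 ≤ n * (d * I / 256) := le_mul_of_one_le_left (by positivity) hnR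
      have h5 : W * (n * ε) = n * (d * I / 256) := by rw [← h3]; ring
      linarith
    have h5 : n * (d * I / 64) = d * (n * I / 32) - n * (d * I / 256) - n * (d * I / 256)
      - n * (d * I / 256) - n * (d * I / 256) := by ring
    have h6 : β * (W * (t / 2) + (∫ x in K, ‖f x‖ ^ 2) / (2 * t)) =
      β * t * W / 2 + β * ((∫ x in K, ‖f x‖ ^ 2) / (2 * t)) := by ring
    rw [h6]
    linarith
  · rw [mul_pow, div_pow, mul_pow 64, Real.sq_sqrt (by positivity), Real.sq_sqrt (by positivity)]
    apply le_of_eq; field_simp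

/-! ### Lacunary parameters and the conclusion. -/

theorem one_le_sepParam {b C₀ : ℝ} (hb : 0 ≤ b) (hC : 1 ≤ C₀) (V : Set ℝ) :
    1 ≤ sepParam b C₀ V := by
  refine Real.one_le_rpow ?_ (by linarith)
  have : (1:ℝ) ≤ dyadicCount V := by
    rw [dyadicCount]; push_cast; linarith [Nat.cast_nonneg (α := ℝ)
      {n : ℤ | (Icc ((2 : ℝ) ^ n) ((2 : ℝ) ^ (n + 1)) ∩ V).Nonempty}.ncard]
  nlinarith

theorem pow_mul_le_of_ratio {M : ℕ} {u : ℕ → ℝ} (hu : ∀ j ∈ Ico 1 M, 16 * u j ≤ u (j + 1))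
    {k : ℕ} (hk : 1 ≤ k) (m : ℕ) (hm : k + m ≤ M) : 16 ^ m * u k ≤ u (k + m) := by
  induction m with
  | zero => simp
  | succ m ih =>
    have h1 := ih (by omega)
    have h2 := hu (k + m) ⟨by omega, by omega⟩
    calc 16 ^ (m + 1) * u k = 16 * (16 ^ m * u k) := by ring
      _ ≤ 16 * u (k + m) := by gcongr
      _ ≤ u (k + (m + 1)) := h2

/-- The lower bound `c √(log M)` for lacunary parameters. -/
theorem exists_sqrt_log_le_iSup_maximalL2Norm {b₀ : ℝ} (b₁ r₀ r₁ : ℝ) (hb₀ : 1 < b₀)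
    (hr₀ : 0 < r₀) :
    ∃ c > 0, ∀ b cp cm : ℝ, b₀ ≤ b → b ≤ b₁ → cp ≠ 0 → cm ≠ 0 → |cp / cm| ∈ Icc r₀ r₁ →
      ∀ (M : ℕ) (u : ℕ → ℝ), 1 ≤ M → (∀ j ∈ Icc 1 M, 0 < u j) →
      (∀ j ∈ Ico 1 M, 16 * u j ≤ u (j + 1)) → ENNReal.ofReal (c * √(Real.log M)) ≤
        ⨆ (f : 𝓢(Plane, ℂ)) (_ : eLpNorm f 2 volume = 1), maximalL2Norm b cp cm M u f := by
  obtain ⟨Y, hY, h1⟩ := exists_pos_le_iSup_maximalL2Norm b₁ hb₀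
  obtain ⟨c, hc, n₀, hn₀, Q, hQ, h2⟩ := exists_sqrt_le_iSup_maximalL2Norm b₁ r₀ r₁ hb₀ hr₀
  -- Keeping every L-th parameter turns the ratio 16 into 16^L > Q.
  obtain ⟨L, hL⟩ := pow_unbounded_of_one_lt Q (by norm_num : (1:ℝ) < 16)
  have hL1 : 1 ≤ L := by
    rcases Nat.eq_zero_or_pos L with h | h
    · rw [h, pow_zero] at hL; linarith
    · exact h
  have hLR : (1:ℝ) ≤ L := by exact_mod_cast hL1
  set Λ := 1 + Real.log L with hΛ
  have hlogL : 0 ≤ Real.log L := Real.log_nonneg hLR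
  have hΛ0 : 0 < Λ := by linarith
  have hn₀R : (1:ℝ) ≤ n₀ := by exact_mod_cast hn₀
  refine ⟨min (c / √(2 * Λ)) (Y / √(n₀ * Λ)), by positivity, ?_⟩
  intro b cp cm hb hb' hp hm hr M u hM hu huQ
  -- The largest depth whose 2^n parameters with stride L fit into M, provided M ≥ L; otherwise n =
  -- 0. Since M < 2^{n+1}L, log M is at most a constant times n + 1. For n < n₀ it is bounded, and
  -- the bound from a single operator suffices.
  set n := Nat.log 2 (M / L) with hn
  have hMR : (0:ℝ) < M := by exact_mod_cast hM
  have hlog : Real.log M ≤ (n + 1) * Λ := by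
    have h3 : M < 2 ^ (n + 1) * L := by
      have := Nat.lt_pow_succ_log_self (b := 2) (by norm_num) (M / L)
      rw [Nat.div_lt_iff_lt_mul (by omega)] at this
      exact this
    have h4 : (M:ℝ) ≤ 2 ^ (n + 1) * L := by exact_mod_cast h3.le
    have h5 := Real.log_le_log hMR h4
    rw [Real.log_mul (by positivity) (by positivity), Real.log_pow] at h5
    have h6 : Real.log 2 ≤ 1 := by linarith [Real.log_two_lt_d9]
    push_cast at h5
    have h7 : (0:ℝ) ≤ n := Nat.cast_nonneg n
    nlinarith [mul_nonneg h7 hlogL, mul_nonneg (by linarith : (0:ℝ) ≤ n + 1) (by linarith : (0:ℝ) ≤ 1 - Real.log 2)]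
  rcases lt_or_ge n n₀ with hlt | hge
  · refine le_trans (ENNReal.ofReal_le_ofReal ?_) (h1 b cp cm hb hb' hp hm M u hM hu)
    have h3 : Real.log M ≤ n₀ * Λ := by
      refine hlog.trans (mul_le_mul_of_nonneg_right ?_ hΛ0.le)
      exact_mod_cast hlt
    calc _ ≤ Y / √(n₀ * Λ) * √(n₀ * Λ) := by
          gcongr
          exact min_le_right _ _
      _ = Y := div_mul_cancel₀ _ (Real.sqrt_pos.2 (by positivity)).ne'
  · have hn1 : 1 ≤ n := hn₀.trans hge
    have hnR : (1:ℝ) ≤ n := by exact_mod_cast hn1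
    have hML : M / L ≠ 0 := fun h0 => by rw [h0, Nat.log_zero_right] at hn; omega
    have hpow : 2 ^ n * L ≤ M :=
      (Nat.mul_le_mul_right L (Nat.pow_log_le_self 2 hML)).trans (Nat.div_mul_le_self M L)
    have hidx : ∀ j < 2 ^ n, 1 + j * L ∈ Icc 1 M := fun j hj => by
      refine ⟨by omega, ?_⟩
      have : (j + 1) * L ≤ 2 ^ n * L := Nat.mul_le_mul_right L hj
      rw [add_mul] at this
      omega
    refine le_trans (ENNReal.ofReal_le_ofReal ?_) (h2 b cp cm hb hb' hp hm hr M u hu n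
      (fun j => 1 + j * L) hge hidx fun j hj => ?_)
    · have h3 : Real.log M ≤ 2 * Λ * n := hlog.trans (by nlinarith)
      calc _ ≤ c / √(2 * Λ) * √(2 * Λ * n) := by
            gcongr
            exact min_le_left _ _
        _ = c * √n := by
          rw [Real.sqrt_mul (show 0 ≤ 2 * Λ by positivity), ← mul_assoc,
            div_mul_cancel₀ _ (Real.sqrt_pos.2 (by positivity)).ne']
    · have hlast := (hidx (j + 1) hj).2
      have e : 1 + (j + 1) * L = 1 + j * L + L := by ring
      rw [e] at hlast ⊢
      have h3 := pow_mul_le_of_ratio huQ (k := 1 + j * L) (by omega) L hlast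
      have h4 : 0 < u (1 + j * L) := hu _ (hidx j (by omega))
      exact (mul_le_mul_of_nonneg_right hL.le h4.le).trans h3

end

theorem proposition7p3 :
    -- the principal values defining the Hilbert transforms exist
    (∀ b cp cm u : ℝ, 1 < b → cp ≠ 0 → cm ≠ 0 → 0 < u → ∀ (f : 𝓢(Plane, ℂ)) (x : Plane),
      (∀ ε : ℝ, 0 < ε → IntegrableOn (hilbertIntegrand b cp cm u f x) {t : ℝ | ε < |t|}) ∧
      Tendsto (truncatedHilbert b cp cm u f x) (𝓝[>] (0 : ℝ)) (𝓝 (curveHilbert b cp cm u f x))) ∧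
    -- the lower bound, with a constant that is uniform for `b` in compact subsets of `(1, ∞)` and
    -- `|c₊ / c₋|` in compact subsets of `(0, ∞)`
    (∀ b₀ b₁ r₀ r₁ : ℝ, 1 < b₀ → 0 < r₀ →
      ∃ c : ℝ, 0 < c ∧
        ∀ b cp cm : ℝ, b ∈ Icc b₀ b₁ → cp ≠ 0 → cm ≠ 0 → |cp / cm| ∈ Icc r₀ r₁ →
        ∀ C₀ : ℝ, 1 ≤ C₀ →
        ∀ V : Set ℝ, V.Finite → V ⊆ Ioi 0 →
          (∀ n : ℤ, (Icc ((2 : ℝ) ^ n) ((2 : ℝ) ^ (n + 1)) ∩ V).Subsingleton) →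
        ∀ (M : ℕ) (u : ℕ → ℝ), 1 ≤ M →
          (∀ j ∈ Icc 1 M, u j ∈ V) →
          StrictMonoOn u (Icc 1 M) →
          (∀ j ∈ Ico 1 M, 16 * sepParam b C₀ V ^ 2 ≤ u (j + 1) / u j) →
          ENNReal.ofReal (c * √(Real.log M)) ≤
            ⨆ (f : 𝓢(Plane, ℂ)) (_ : eLpNorm f 2 volume = 1), maximalL2Norm b cp cm M u f) := by
  refine ⟨fun b cp cm u hb _ _ hu f x =>
    ⟨fun ε hε => integrableOn_hilbertIntegrand (by linarith) cp cm u f x hε,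
      tendsto_truncatedHilbert hb cp cm hu f x⟩, fun b₀ b₁ r₀ r₁ hb₀ hr₀ => ?_⟩
  obtain ⟨c, hc, h⟩ := exists_sqrt_log_le_iSup_maximalL2Norm b₁ r₀ r₁ hb₀ hr₀
  refine ⟨c, hc, fun b cp cm hb hp hm hr C₀ hC V _ hV _ M u hM hu _ hsep => ?_⟩
  refine h b cp cm hb.1 hb.2 hp hm hr M u hM (fun j hj => hV (hu j hj)) fun j hj => ?_
  have hj0 : 0 < u j := hV (hu j ⟨hj.1, hj.2.le⟩)
  -- As K ≥ 1, the ratio 16K² is at least 16.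
  have hK := one_le_sepParam (b := b) (by linarith [hb.1]) hC V
  have hK2 : 16 ≤ 16 * sepParam b C₀ V ^ 2 := by nlinarith
  exact (le_div_iff₀ hj0).1 (hK2.trans (hsep j hj))
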